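/- Let $\mathbb{K}=\mathbb{Z}$, $\mathbb{Q}$ or $\mathbb{F}_p$ ($p$ a prime), and let $r\ge 1$. Order the partitions of $\{1,\ldots,r\}$ by refinement: $\lambda\le\mu$ if $\mu$ refines $\lambda$, so that the one-block partition is the smallest and the partition into singletons is the largest. The symmetric group $\Sigma_r$ acts on partitions through its action on $\{1,\ldots,r\}$. Let $\bar K(r)$ be the pointed simplicial set whose $n$-simplices are a base point together with the sequences of partitions $\lambda_0\le\lambda_1\le\cdots\le\lambda_n$ such that $\lambda_0$ is the one-block partition and $\lambda_n$ is the partition into singletons. The face $d_i$ is given by the omission of $\lambda_i$ (the result being the base point if the remaining sequence no longer starts with the one-block partition or no longer ends with the partition into singletons), and the degeneracy $s_j$ by the repetition of $\lambda_j$. The group $\Sigma_r$ acts on $\bar K(r)$, hence on its reduced homology $\tilde H_*(\bar K(r),\mathbb{K})$. Let $L(r)$ be the $r$-th component of the Lie operad over $\mathbb{K}$, that is, the component of weight $(1,\ldots,1)$ of the free Lie algebra over $\mathbb{K}$ on $x_1,\ldots,x_r$ (the $\mathbb{K}$-submodule spanned by the Lie monomials which contain each variable exactly once), on which $w\in\Sigma_r$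 acts by $x_i\mapsto x_{w(i)}$. Let $L(r)^\vee=\operatorname{Hom}_{\mathbb{K}}(L(r),\mathbb{K})$ with the action $(w\cdot f)(x)=f(w^{-1}\cdot x)$, and let $\mathrm{sgn}_r$ be the signature representation of $\Sigma_r$ on $\mathbb{K}$. Then $\tilde H_n(\bar K(r),\mathbb{K})=0$ for all $n\ne r-1$, and there is an isomorphism of $\Sigma_r$-modules over $\mathbb{K}$ $$\tilde H_{r-1}(\bar K(r),\mathbb{K})\;\cong\; L(r)^\vee\otimes_{\mathbb{K}}\mathrm{sgn}_r .$$ -/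

import Mathlib

open CategoryTheory

universe u

/-! ### Partitions and the simplicial set `K̄(r)` -/

/-- The poset of partitions of `{1, …, r}`, a partition being encoded by the equivalence relation
"lying in the same block".  `λ ≤ μ` means that `μ` is a refinement of `λ`, so that the one-block
partition is `⊥` and the partition into singletons is `⊤`. (Mathlib orders `Setoid` the other way
round, whence the order dual.) -/
abbrev PartitionPoset (r : ℕ) : Type := (Setoid (Fin r))ᵒᵈ

namespace PartitionPoset

/-- The image of a partition under a permutation `w`: the blocks of `w • λ` are the `w(B)` for `B` a
block of `λ`, that is, `i` and `j` lie in the same block of `w • λ` iff `w⁻¹ i` and `w⁻¹ j` lie in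
the same block of `λ`. -/
def perm {r : ℕ} (w : Equiv.Perm (Fin r)) (p : PartitionPoset r) : PartitionPoset r :=
  OrderDual.toDual (Setoid.comap (w⁻¹ : Equiv.Perm (Fin r)) (OrderDual.ofDual p))

theorem perm_mono {r : ℕ} (w : Equiv.Perm (Fin r)) : Monotone (perm w) :=
  fun _ _ h _ _ hij => h hij

theorem perm_bot {r : ℕ} (w : Equiv.Perm (Fin r)) : perm w (⊥ : PartitionPoset r) = ⊥ := rfl

theorem perm_top {r : ℕ} (w : Equiv.Perm (Fin r)) : perm w (⊤ : PartitionPoset r) = ⊤ := by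
  change (Setoid.comap (w⁻¹ : Equiv.Perm (Fin r)) (⊥ : Setoid (Fin r))) = ⊥
  ext i j
  exact (w⁻¹ : Equiv.Perm (Fin r)).injective.eq_iff

end PartitionPoset

/-- Sequences of partitions `λ₀ ≤ λ₁ ≤ ⋯ ≤ λₙ` of `{1, …, r}` such that `λ₀` is the one-block
partition and `λₙ` is the partition into singletons. -/
structure PartitionChain (r n : ℕ) where
  /-- the underlying nondecreasing sequence -/
  seq : Fin (n + 1) →o PartitionPoset r
  first : seq 0 = ⊥
  last : seq (Fin.last n) = ⊤

namespace PartitionChain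

theorem ext_seq {r n : ℕ} {c c' : PartitionChain r n} (h : c.seq = c'.seq) : c = c' := by
  cases c; cases c'; congr

open Classical in
/-- The simplicial operator attached to a nondecreasing map `θ : {0 < ⋯ < m} → {0 < ⋯ < n}`: the
sequence `i ↦ λ_{θ(i)}` if that sequence still starts with the one-block partition and ends with the
partition into singletons, and the base point `none` otherwise. -/
noncomputable def pull {r n m : ℕ} (θ : Fin (m + 1) →o Fin (n + 1)) (c : PartitionChain r n) :
    Option (PartitionChain r m) :=
  if h : c.seq (θ 0) = ⊥ ∧ c.seq (θ (Fin.last m)) = ⊤ then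
    some ⟨c.seq.comp θ, h.1, h.2⟩
  else none

theorem pull_pos {r n m : ℕ} (θ : Fin (m + 1) →o Fin (n + 1)) (c : PartitionChain r n)
    (h : c.seq (θ 0) = ⊥ ∧ c.seq (θ (Fin.last m)) = ⊤) :
    pull θ c = some ⟨c.seq.comp θ, h.1, h.2⟩ := dif_pos h

theorem pull_neg {r n m : ℕ} (θ : Fin (m + 1) →o Fin (n + 1)) (c : PartitionChain r n)
    (h : ¬ (c.seq (θ 0) = ⊥ ∧ c.seq (θ (Fin.last m)) = ⊤)) :
    pull θ c = none := dif_neg h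

/-- The action of a permutation on sequences of partitions. -/
def perm {r n : ℕ} (w : Equiv.Perm (Fin r)) (c : PartitionChain r n) : PartitionChain r n where
  seq := ⟨fun i => (c.seq i).perm w, (PartitionPoset.perm_mono w).comp c.seq.monotone⟩
  first := by
    change PartitionPoset.perm w (c.seq 0) = ⊥
    rw [c.first, PartitionPoset.perm_bot]
  last := by
    change PartitionPoset.perm w (c.seq (Fin.last n)) = ⊤
    rw [c.last, PartitionPoset.perm_top]

end PartitionChain

/-- The pointed simplicial set `K̄(r)`. Its `n`-simplices are the sequences of partitions
`λ₀ ≤ ⋯ ≤ λₙ` of `{1, …, r}` with `λ₀` the one-block partition and `λₙ` the partition into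
singletons, together with a base point `none`. The face `dᵢ` omits `λᵢ` (a face which does not
start with the one-block partition or does not end with the partition into singletons being
identified with the base point), and the degeneracy `sⱼ` repeats `λⱼ`. -/
noncomputable def partitionSSet (r : ℕ) : SSet.{0} where
  obj n := Option (PartitionChain r n.unop.len)
  map θ := ↾fun x => x.bind (PartitionChain.pull θ.unop.toOrderHom)
  map_id n := by
    apply ConcreteCategory.hom_ext
    intro x
    cases x with
    | none => rfl
    | some c =>
      have h : c.seq 0 = ⊥ ∧ c.seq (Fin.last n.unop.len) = ⊤ := ⟨c.first, c.last⟩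
      exact dif_pos h
  map_comp {n m k} θ η := by
    apply ConcreteCategory.hom_ext
    intro x
    cases x with
    | none => rfl
    | some c =>
      change PartitionChain.pull (θ.unop.toOrderHom.comp η.unop.toOrderHom) c =
        (PartitionChain.pull θ.unop.toOrderHom c).bind (PartitionChain.pull η.unop.toOrderHom)
      by_cases h : c.seq (θ.unop.toOrderHom 0) = ⊥ ∧
          c.seq (θ.unop.toOrderHom (Fin.last _)) = ⊤
      · have h₁ : PartitionChain.pull θ.unop.toOrderHom c =
            some ⟨c.seq.comp θ.unop.toOrderHom, h.1, h.2⟩ := PartitionChain.pull_pos _ _ h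
        rw [h₁]
        rfl
      · have h₁ : PartitionChain.pull θ.unop.toOrderHom c = none :=
          PartitionChain.pull_neg _ _ h
        rw [h₁]
        refine dif_neg fun h' => h ⟨?_, ?_⟩
        · refine le_bot_iff.mp (le_trans ?_ h'.1.le)
          exact c.seq.monotone (θ.unop.toOrderHom.monotone (Fin.zero_le _))
        · refine top_le_iff.mp (le_trans h'.2.ge ?_)
          exact c.seq.monotone (θ.unop.toOrderHom.monotone (Fin.le_last _))

/-- The simplicial map `K̄(r) → K̄(r)` given by the action of a permutation on partitions. It fixes
the base point. -/
noncomputable def partitionSSetPerm {r : ℕ} (w : Equiv.Perm (Fin r)) :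
    partitionSSet r ⟶ partitionSSet r where
  app _ := ↾fun x => Option.map (PartitionChain.perm w) x
  naturality n m θ := by
    apply ConcreteCategory.hom_ext
    intro x
    cases x with
    | none => rfl
    | some c =>
      change Option.map (PartitionChain.perm w) (PartitionChain.pull θ.unop.toOrderHom c) =
        PartitionChain.pull θ.unop.toOrderHom (PartitionChain.perm w c)
      have inj : Function.Injective (PartitionPoset.perm w) := by
        intro p q hpq
        apply Setoid.ext
        intro i j
        have h := congrArg (fun s : PartitionPoset r => (OrderDual.ofDual s) (w i) (w j)) hpq
        change (OrderDual.ofDual p) (w⁻¹ (w i)) (w⁻¹ (w j)) = (OrderDual.ofDual q) (w⁻¹ (w i)) (w⁻¹ (w j)) at h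
        have e : ∀ k, w⁻¹ (w k) = k := fun k => w.symm_apply_apply k
        rw [e, e] at h
        exact Iff.of_eq h
      have key : ∀ i, ((PartitionChain.perm w c).seq i = ⊥ ↔ c.seq i = ⊥) ∧
          ((PartitionChain.perm w c).seq i = ⊤ ↔ c.seq i = ⊤) := fun i =>
        ⟨⟨fun h => inj (h.trans (PartitionPoset.perm_bot w).symm), fun h =>
            (congrArg (PartitionPoset.perm w) h).trans (PartitionPoset.perm_bot w)⟩,
          ⟨fun h => inj (h.trans (PartitionPoset.perm_top w).symm), fun h =>
            (congrArg (PartitionPoset.perm w) h).trans (PartitionPoset.perm_top w)⟩⟩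
      by_cases h : c.seq (θ.unop.toOrderHom 0) = ⊥ ∧
          c.seq (θ.unop.toOrderHom (Fin.last _)) = ⊤
      · have h₁ : PartitionChain.pull θ.unop.toOrderHom c =
            some ⟨c.seq.comp θ.unop.toOrderHom, h.1, h.2⟩ := PartitionChain.pull_pos _ _ h
        rw [h₁]
        exact (PartitionChain.pull_pos _ _ ⟨(key _).1.2 h.1, (key _).2.2 h.2⟩).symm
      · have h₁ : PartitionChain.pull θ.unop.toOrderHom c = none :=
          PartitionChain.pull_neg _ _ h
        rw [h₁]
        have h₂ : ¬ ((PartitionChain.perm w c).seq (θ.unop.toOrderHom 0) = ⊥ ∧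
            (PartitionChain.perm w c).seq (θ.unop.toOrderHom (Fin.last _)) = ⊤) :=
          fun h' => h ⟨(key _).1.1 h'.1, (key _).2.1 h'.2⟩
        exact (PartitionChain.pull_neg _ _ h₂).symm

theorem partitionSSetPerm_one (r : ℕ) :
    partitionSSetPerm (1 : Equiv.Perm (Fin r)) = 𝟙 (partitionSSet r) := by
  ext n : 1
  apply ConcreteCategory.hom_ext
  intro x
  cases x <;> rfl

theorem partitionSSetPerm_mul {r : ℕ} (v w : Equiv.Perm (Fin r)) :
    partitionSSetPerm (v * w) = partitionSSetPerm w ≫ partitionSSetPerm v := by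
  ext n : 1
  apply ConcreteCategory.hom_ext
  intro x
  cases x <;> rfl

/-! ### Reduced homology -/

/-- The homology `Hₙ(X; K)` of a simplicial set, as a `K`-module. -/
noncomputable abbrev ssetHomology (K : Type) [CommRing K] (X : SSet.{0}) (n : ℕ) :
    ModuleCat.{0} K :=
  SSet.homology X (ModuleCat.of K K) n

/-- The reduced homology `H̃ₙ(X; K)` of a simplicial set: the kernel of the map
`Hₙ(X; K) → Hₙ(pt; K)` induced by the projection of `X` to the point `Δ[0]`. -/
noncomputable def reducedHomology (K : Type) [CommRing K] (X : SSet.{0}) (n : ℕ) :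
    Submodule K (ssetHomology K X n) :=
  LinearMap.ker (SSet.homologyMap (SSet.stdSimplex.isTerminalObj₀.from X)
    (ModuleCat.of K K) n).hom

/-- The action of `Σ_r` on the homology of `K̄(r)` induced by its action on partitions. -/
noncomputable def partitionHomologyRep (K : Type) [CommRing K] (r n : ℕ) :
    Representation K (Equiv.Perm (Fin r))
      (ssetHomology K (partitionSSet r) n) where
  toFun w := (SSet.homologyMap (partitionSSetPerm w) (ModuleCat.of K K) n).hom
  map_one' := by
    rw [partitionSSetPerm_one, SSet.homologyMap_id]
    rfl
  map_mul' v w := by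
    rw [partitionSSetPerm_mul, SSet.homologyMap_comp]
    rfl

/-- The action of `Σ_r` on the reduced homology `H̃ₙ(K̄(r); K)` induced by its action on
partitions. -/
noncomputable def partitionReducedHomologyRep (K : Type) [CommRing K] (r n : ℕ) :
    Representation K (Equiv.Perm (Fin r)) (reducedHomology K (partitionSSet r) n) :=
  (partitionHomologyRep K r n).subrepresentation (reducedHomology K (partitionSSet r) n) <| by
    intro w x hx
    have h : SSet.homologyMap (partitionSSetPerm w) (ModuleCat.of K K) n ≫
        SSet.homologyMap (SSet.stdSimplex.isTerminalObj₀.from (partitionSSet r))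
          (ModuleCat.of K K) n =
        SSet.homologyMap (SSet.stdSimplex.isTerminalObj₀.from (partitionSSet r))
          (ModuleCat.of K K) n := by
      rw [← SSet.homologyMap_comp]
      congr 1
    exact (LinearMap.congr_fun (congrArg ModuleCat.Hom.hom h) x).trans hx

/-! ### The components of the Lie operad -/

/-- The value of a Lie monomial (a bracketed word in `x₁, …, x_r`) in the free Lie algebra. -/
noncomputable def lieMonomial (K : Type) [CommRing K] {r : ℕ} : FreeMagma (Fin r) → FreeLieAlgebra K (Fin r)
  | .of i => FreeLieAlgebra.of K i
  | .mul a b => ⁅lieMonomial K a, lieMonomial K b⁆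

/-- The weight of a Lie monomial: the number of occurrences of each variable. -/
def lieWeight {r : ℕ} : FreeMagma (Fin r) → Fin r → ℕ
  | .of i => Pi.single i 1
  | .mul a b => lieWeight a + lieWeight b

/-- `L(r)`, the `r`-th component of the Lie operad: the component of weight `(1, …, 1)` of the free
Lie algebra `L(x₁, …, x_r)`, spanned by the Lie monomials which have degree one in each variable. -/
noncomputable def lieComponent (K : Type) [CommRing K] (r : ℕ) : Submodule K (FreeLieAlgebra K (Fin r)) :=
  Submodule.span K (lieMonomial K '' {a | lieWeight a = 1})

/-- The action of `Σ_r` on the free Lie algebra `L(x₁, …, x_r)` by permutation of the variables,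
`w • x_i = x_{w(i)}`. -/
noncomputable def freeLiePermRep (K : Type) [CommRing K] (r : ℕ) :
    Representation K (Equiv.Perm (Fin r)) (FreeLieAlgebra K (Fin r)) where
  toFun w := (FreeLieAlgebra.lift K fun i => FreeLieAlgebra.of K (w i) :
    FreeLieAlgebra K (Fin r) →ₗ⁅K⁆ FreeLieAlgebra K (Fin r))
  map_one' := by
    have h : FreeLieAlgebra.lift K
        (fun i => FreeLieAlgebra.of K ((1 : Equiv.Perm (Fin r)) i)) = LieHom.id := by
      ext i
      simp
    rw [h]
    rfl
  map_mul' v w := by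
    have h : FreeLieAlgebra.lift K (fun i => FreeLieAlgebra.of K ((v * w) i)) =
        (FreeLieAlgebra.lift K fun i => FreeLieAlgebra.of K (v i)).comp
          (FreeLieAlgebra.lift K fun i => FreeLieAlgebra.of K (w i)) := by
      ext i
      simp
    rw [h]
    rfl

theorem freeLiePermRep_monomial (K : Type) [CommRing K] {r : ℕ} (w : Equiv.Perm (Fin r))
    (a : FreeMagma (Fin r)) :
    freeLiePermRep K r w (lieMonomial K a) = lieMonomial K (FreeMagma.map w a) := by
  induction a using FreeMagma.rec with
  | of i => exact FreeLieAlgebra.lift_of_apply _ i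
  | mul a b ha hb =>
    have h : freeLiePermRep K r w ⁅lieMonomial K a, lieMonomial K b⁆ =
        ⁅freeLiePermRep K r w (lieMonomial K a), freeLiePermRep K r w (lieMonomial K b)⁆ :=
      LieHom.map_lie (FreeLieAlgebra.lift K fun i => FreeLieAlgebra.of K (w i)) _ _
    rw [ha, hb] at h
    exact h

theorem lieWeight_map {r : ℕ} (w : Equiv.Perm (Fin r)) (a : FreeMagma (Fin r)) (i : Fin r) :
    lieWeight (FreeMagma.map w a) (w i) = lieWeight a i := by
  induction a using FreeMagma.rec with
  | of j =>
    change (Pi.single (w j) 1 : Fin r → ℕ) (w i) = (Pi.single j 1 : Fin r → ℕ) i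
    simp [Pi.single_apply]
  | mul a b ha hb => exact congrArg₂ (· + ·) ha hb

/-- The representation `L(r)` of `Σ_r`. -/
noncomputable def lieRep (K : Type) [CommRing K] (r : ℕ) :
    Representation K (Equiv.Perm (Fin r)) (lieComponent K r) :=
  (freeLiePermRep K r).subrepresentation (lieComponent K r) <| by
    intro w
    refine Submodule.span_le.mpr ?_
    rintro _ ⟨a, ha, rfl⟩
    refine Submodule.subset_span ⟨FreeMagma.map w a, ?_, (freeLiePermRep_monomial K w a).symm⟩
    funext i
    have h := lieWeight_map w a (w⁻¹ i)
    rw [ha] at h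
    simpa using h

/-- The signature representation `sgn_r` of `Σ_r` on `K`. -/
def sgnRep (K : Type) [CommRing K] (r : ℕ) : Representation K (Equiv.Perm (Fin r)) K where
  toFun w := ((Equiv.Perm.sign w : ℤ) : K) • LinearMap.id
  map_one' := by simp; rfl
  map_mul' v w := by
    ext
    simp [mul_comm]

/-! ### Linear maps on finitely supported functions with restricted support -/

/-! For r ≥ 2, discard the degenerate simplices and the base point, and drop the two fixed ends of
each sequence. What remains of K̄(r) is, up to signs, the augmented chain complex of the open
interval (⊥, ⊤) in the lattice of equivalence relations, a list of length m standing in simplicial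
degree m + 1. The case r = 1, where the two ends coincide, is treated by hand.

The vanishing is homotopy complementation. In the interval above the relation with a single
nontrivial block J, the coatom p = J | Jᶜ has as complements the atoms obtained by adjoining one
element to J. Away from these atoms, a ≥ a ⊓ p ≤ p contracts the interval (`exists_bd_eq_of_avoid`).
The lists which start with such an atom come from an interval of the same kind with one element
fewer outside the block. By induction (`exists_bd_eq`), a cycle outside the top degree bounds. A
cycle of top degree bounds as soon as its coefficients vanish at the chains which merge a letter t
successively with the other letters, taken in any order u.

Both sides of the isomorphism are then presented as quotients of K[Σ_r] and compared in coordinates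
indexed by the arrangements u of the letters other than t. In homology, w goes to the class of the
fundamental cycle `fund` of the Boolean lattice of partitions into consecutive blocks of the word of
w; the coordinates are the coefficients above. On the Lie side, w goes to the linear form
"coefficient of the word of w in the free associative algebra", tensored with the sign of w; the
coordinates are the values at the brackets [x_{uₙ}, […, [x_{u₁}, x_t]]], which span L(r).

In both cases the word of w has to be built from t by attaching the letters of u in turn on the left
or on the right (`zipCoeff`), because merging neighbours and bracketing both do exactly this. Only
the signs differ. The inversions of the word convert one system of signs into the other, up to a
sign depending on u alone (`wordSign_mul_zipCoeff`); this is where the signature comes from. Hence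
both maps have the kernel of the single matrix `zipMap`. The words starting with t give an identity
submatrix, so `zipMap` is surjective, and therefore so are both maps from K[Σ_r]. They are
equivariant, so the two quotients are isomorphic representations. -/

theorem Finsupp.map_mem_of_mem_supported {R ι M : Type*} [CommRing R] [AddCommGroup M] [Module R M]
    (f : (ι →₀ R) →ₗ[R] M) (N : Submodule R M) {s : Set ι}
    (h : ∀ i ∈ s, f (Finsupp.single i 1) ∈ N) {z : ι →₀ R} (hz : z ∈ Finsupp.supported R R s) :
    f z ∈ N := by
  rw [Finsupp.supported_eq_span_single] at hz
  have h2 := Submodule.mem_map_of_mem (f := f) hz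
  rw [Submodule.map_span] at h2
  refine Submodule.span_le.mpr ?_ h2
  rintro _ ⟨_, ⟨i, hi, rfl⟩, rfl⟩
  exact h i hi

theorem Finsupp.map_eq_of_mem_supported {R ι M : Type*} [CommRing R] [AddCommGroup M] [Module R M]
    (f g : (ι →₀ R) →ₗ[R] M) {s : Set ι}
    (h : ∀ i ∈ s, f (Finsupp.single i 1) = g (Finsupp.single i 1)) {z : ι →₀ R}
    (hz : z ∈ Finsupp.supported R R s) : f z = g z := by
  have := Finsupp.map_mem_of_mem_supported (f - g) ⊥ (s := s)
    (fun i hi => by simpa [sub_eq_zero] using h i hi) hz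
  simpa [sub_eq_zero] using this

/-! ### Alternating removal of entries from lists -/

namespace ListChain

variable (K : Type) [CommRing K] {α : Type}

/-- Adjoining a head to lists, extended linearly. -/
noncomputable def consMap (a : α) : (List α →₀ K) →ₗ[K] (List α →₀ K) :=
  Finsupp.lmapDomain K K (List.cons a)

variable {K} in
@[simp]
theorem consMap_single (a : α) (l : List α) (c : K) :
    consMap K a (Finsupp.single l c) = Finsupp.single (a :: l) c :=
  Finsupp.mapDomain_single

/-- The alternating sum of the lists obtained by removing one entry. -/
noncomputable def face : List α → (List α →₀ K)
  | [] => 0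
  | a :: l => Finsupp.single l 1 - consMap K a (face l)

/-- The boundary operator on linear combinations of lists. -/
noncomputable def bd : (List α →₀ K) →ₗ[K] (List α →₀ K) :=
  Finsupp.linearCombination K (face K)

@[simp]
theorem bd_single (l : List α) : bd K (Finsupp.single l 1) = face K l := by
  simp [bd]

/-- The cone formula: prepending a vertex is a contracting homotopy of the complex augmented by the
empty list. The inductions on lists below rest on it. -/
theorem bd_consMap (a : α) (z : List α →₀ K) :
    bd K (consMap K a z) = z - consMap K a (bd K z) := by
  have h : bd K ∘ₗ consMap K a = LinearMap.id - consMap K a ∘ₗ bd K := by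
    ext l : 2
    simp [face]
  exact LinearMap.congr_fun h z

theorem bd_bd (z : List α →₀ K) : bd K (bd K z) = 0 := by
  have h : bd K ∘ₗ bd K = (0 : (List α →₀ K) →ₗ[K] _) := by
    ext l : 2
    simp only [LinearMap.comp_apply, Finsupp.lsingle_apply, bd_single, LinearMap.zero_apply]
    induction l with
    | nil => simp [face]
    | cons a l ih => rw [face, map_sub, bd_single, bd_consMap, ih, map_zero, sub_zero, sub_self]
  exact LinearMap.congr_fun h z

/-- The prism operator attached to a self-map `π` and an element `p`. -/
noncomputable def prismList (π : α → α) (p : α) : List α → (List α →₀ K)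
  | [] => Finsupp.single [p] 1
  | a :: l => Finsupp.single (π a :: a :: l) 1 - consMap K (π a) (prismList π p l)

/-- The linear extension of the prism operator. -/
noncomputable def prism (π : α → α) (p : α) : (List α →₀ K) →ₗ[K] (List α →₀ K) :=
  Finsupp.linearCombination K (prismList K π p)

@[simp]
theorem prism_single (π : α → α) (p : α) (l : List α) :
    prism K π p (Finsupp.single l 1) = prismList K π p l := by
  simp [prism]

theorem prism_consMap (π : α → α) (p a : α) (z : List α →₀ K) :
    prism K π p (consMap K a z) =
      consMap K (π a) (consMap K a z) - consMap K (π a) (prism K π p z) := by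
  have h : prism K π p ∘ₗ consMap K a =
      consMap K (π a) ∘ₗ consMap K a - consMap K (π a) ∘ₗ prism K π p := by
    ext l : 2
    simp [prismList]
  exact LinearMap.congr_fun h z

/-- The prism of (a₁, …, aₙ) is the alternating sum of the lists (πa₁, …, πaᵢ, aᵢ, …, aₙ), closed by
(πa₁, …, πaₙ, p). It joins the identity to π and then π to the constant p in a single homotopy. The
identity is formal; order matters only when these lists have to be increasing. -/
theorem bd_prism (π : α → α) (p : α) (z : List α →₀ K) :
    bd K (prism K π p z) + prism K π p (bd K z) = z := by
  have h : bd K ∘ₗ prism K π p + prism K π p ∘ₗ bd K = LinearMap.id := by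
    ext l : 2
    induction l with
    | nil => simp [prismList, face, consMap]
    | cons a l ih =>
      have ih' : bd K (prismList K π p l) + prism K π p (face K l) = Finsupp.single l 1 := by
        simpa using ih
      have e : bd K (prismList K π p (a :: l)) + prism K π p (face K (a :: l)) =
          Finsupp.single (a :: l) 1 := by
        have e1 : bd K (Finsupp.single (π a :: a :: l) (1 : K)) =
            Finsupp.single (a :: l) 1 - consMap K (π a) (face K (a :: l)) := by
          simp only [bd_single]
          rw [face]
        rw [prismList, map_sub, e1, bd_consMap, face, map_sub, map_sub, prism_single,
          prism_consMap, consMap_single]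
        have := congrArg (consMap K (π a)) ih'
        rw [map_add, consMap_single] at this
        rw [← this]
        abel
      simpa using e
  exact LinearMap.congr_fun h z

variable {K} in
/-- A set of lists closed under taking sublists spans a subcomplex. -/
theorem bd_mem_supported {s : Set (List α)} {n : ℕ}
    (hs : ∀ l ∈ s, ∀ l', l'.Sublist l → l' ∈ s) {z : List α →₀ K}
    (hz : z ∈ Finsupp.supported K K {l | l ∈ s ∧ l.length = n + 1}) :
    bd K z ∈ Finsupp.supported K K {l | l ∈ s ∧ l.length = n} := by
  have key : ∀ (n : ℕ) (l : List α), l.length = n + 1 →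
      face K l ∈ Finsupp.supported K K {l' | l'.Sublist l ∧ l'.length = n} := by
    intro n l
    induction l generalizing n with
    | nil => intro h; simp at h
    | cons a l ih =>
      intro h
      have hl : l.length = n := by simpa using h
      rw [face]
      refine Submodule.sub_mem _ (Finsupp.single_mem_supported K _ ?_) ?_
      · exact ⟨List.sublist_cons_self a l, hl⟩
      · cases n with
        | zero =>
          have : l = [] := List.length_eq_zero_iff.mp hl
          subst this
          simp [face]
        | succ n =>
          have := ih n hl
          refine Finsupp.map_mem_of_mem_supported (consMap K a) _ (fun l' hl' => ?_) this
          simp only [consMap_single]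
          refine Finsupp.single_mem_supported K _ ⟨?_, ?_⟩
          · exact hl'.1.cons_cons a
          · simp [hl'.2]
  refine Finsupp.map_mem_of_mem_supported (bd K) _ (fun l hl => ?_) hz
  simp only [bd_single]
  refine Finsupp.supported_mono ?_ (key n l hl.2)
  intro l' hl'
  exact ⟨hs l hl.1 l' hl'.1, hl'.2⟩

variable {K} in
theorem consMap_mem_supported {s t : Set (List α)} {a : α} (h : ∀ l ∈ s, a :: l ∈ t)
    {z : List α →₀ K} (hz : z ∈ Finsupp.supported K K s) :
    consMap K a z ∈ Finsupp.supported K K t := by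
  refine Finsupp.map_mem_of_mem_supported (consMap K a) _ (fun l hl => ?_) hz
  simpa using Finsupp.single_mem_supported K _ (h l hl)

variable {K} in
theorem prism_mem_supported {π : α → α} {p : α} {s t : Set (List α)}
    (h : ∀ l ∈ s, prismList K π p l ∈ Finsupp.supported K K t)
    {z : List α →₀ K} (hz : z ∈ Finsupp.supported K K s) :
    prism K π p z ∈ Finsupp.supported K K t := by
  refine Finsupp.map_mem_of_mem_supported (prism K π p) _ (fun l hl => ?_) hz
  simpa using h l hl

/-! ### Discarding the lists with repetitions -/

section Strict

variable [PartialOrder α]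

open Classical in
/-- The projection which kills the lists that are not strictly increasing. -/
noncomputable def strictify : (List α →₀ K) →ₗ[K] (List α →₀ K) :=
  Finsupp.linearCombination K
    fun l => if l.Pairwise (· < ·) then Finsupp.single l 1 else 0

open Classical in
theorem strictify_single (l : List α) :
    strictify K (Finsupp.single l 1) = if l.Pairwise (· < ·) then Finsupp.single l 1 else 0 := by
  simp [strictify]

variable {K} in
theorem strictify_eq_self {z : List α →₀ K}
    (hz : z ∈ Finsupp.supported K K {l | l.Pairwise (· < ·)}) : strictify K z = z := by
  refine Finsupp.map_eq_of_mem_supported (strictify K) LinearMap.id (fun l hl => ?_) hz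
  simp only [strictify_single]
  exact if_pos hl

variable {K} in
theorem strictify_mem_supported {s : Set (List α)} {z : List α →₀ K}
    (hz : z ∈ Finsupp.supported K K s) :
    strictify K z ∈ Finsupp.supported K K {l | l ∈ s ∧ l.Pairwise (· < ·)} := by
  refine Finsupp.map_mem_of_mem_supported (strictify K) _ (fun l hl => ?_) hz
  simp only [strictify_single]
  split_ifs with h
  · exact Finsupp.single_mem_supported K _ ⟨hl, h⟩
  · exact Submodule.zero_mem _

variable {K} in
theorem strictify_consMap {a : α} {z : List α →₀ K}
    (hz : z ∈ Finsupp.supported K K {l | ∀ b ∈ l, a < b}) :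
    strictify K (consMap K a z) = consMap K a (strictify K z) := by
  refine Finsupp.map_eq_of_mem_supported (strictify K ∘ₗ consMap K a) (consMap K a ∘ₗ strictify K)
    (fun l hl => ?_) hz
  have hl' : ∀ b ∈ l, a < b := hl
  simp only [LinearMap.comp_apply, consMap_single, strictify_single]
  by_cases h : l.Pairwise (· < ·)
  · rw [if_pos (List.pairwise_cons.mpr ⟨hl', h⟩), if_pos h, consMap_single]
  · rw [if_neg (fun h' => h (List.pairwise_cons.mp h').2), if_neg h, map_zero]

theorem strictify_consMap_consMap_self (a : α) (z : List α →₀ K) :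
    strictify K (consMap K a (consMap K a z)) = 0 := by
  have h : strictify K ∘ₗ consMap K a ∘ₗ consMap K a = 0 := by
    ext l : 2
    simp [strictify_single]
  exact LinearMap.congr_fun h z

/-- In a weakly increasing list with a repetition, removing either of two equal neighbours gives the
same list with opposite signs, and every other face still has a repetition. So the repeated lists
form a subcomplex, and killing them commutes with the boundary. The induction splits on whether the
head is repeated. -/
theorem strictify_face {l : List α} (hl : l.Pairwise (· ≤ ·)) :
    strictify K (face K l) = bd K (strictify K (Finsupp.single l 1)) := by
  induction l with
  | nil => simp [face, strictify_single]
  | cons a l ih =>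
    rw [List.pairwise_cons] at hl
    by_cases hlt : ∀ b ∈ l, a < b
    · have h1 : Finsupp.single (a :: l) (1 : K) = consMap K a (Finsupp.single l 1) := by simp
      have hm : Finsupp.single l (1 : K) ∈ Finsupp.supported K K {l | ∀ b ∈ l, a < b} :=
        Finsupp.single_mem_supported K _ hlt
      have hf : face K l ∈ Finsupp.supported K K {l | ∀ b ∈ l, a < b} := by
        cases hn : l.length with
        | zero =>
          rw [List.length_eq_zero_iff] at hn
          subst hn
          exact Submodule.zero_mem _
        | succ n =>
          have := bd_mem_supported (K := K) (s := {l : List α | ∀ b ∈ l, a < b}) (n := n)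
            (fun l hl l' hl' b hb => hl b (hl'.subset hb))
            (z := Finsupp.single l 1) (Finsupp.single_mem_supported K _ ⟨hlt, hn⟩)
          rw [bd_single] at this
          exact Finsupp.supported_mono (fun l' h => h.1) this
      rw [h1, strictify_consMap hm, bd_consMap, face, map_sub, strictify_consMap hf, ih hl.2]
    · cases l with
      | nil => simp at hlt
      | cons b t =>
        have hab : a = b := by
          by_contra hne
          refine hlt fun c hc => ?_
          have hab : a < b := lt_of_le_of_ne (hl.1 b List.mem_cons_self) hne
          rcases List.mem_cons.mp hc with rfl | hc
          · exact hab
          · exact hab.trans_le ((List.pairwise_cons.mp hl.2).1 c hc)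
        subst hab
        have h1 : Finsupp.single (a :: a :: t) (1 : K) =
            consMap K a (consMap K a (Finsupp.single t 1)) := by simp
        rw [h1, strictify_consMap_consMap_self, map_zero, face, face, map_sub, map_sub (consMap K a), consMap_single,
          ← map_sub, sub_sub_cancel, strictify_consMap_consMap_self]

variable {K} in
theorem strictify_bd {z : List α →₀ K}
    (hz : z ∈ Finsupp.supported K K {l | l.Pairwise (· ≤ ·)}) :
    strictify K (bd K z) = bd K (strictify K z) := by
  have h := Finsupp.map_eq_of_mem_supported (strictify K ∘ₗ bd K) (bd K ∘ₗ strictify K)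
    (s := {l : List α | l.Pairwise (· ≤ ·)}) (fun l hl => by
      rw [LinearMap.comp_apply, LinearMap.comp_apply, bd_single]
      exact strictify_face K hl) hz
  exact h

end Strict

end ListChain

/-! ### Partitions with at most one nontrivial block -/

section BlockSetoid

variable {X : Type}

/-- The equivalence relation whose only possibly nontrivial class is `J`. -/
def blockSetoid (J : Finset X) : Setoid X where
  r i j := i = j ∨ (i ∈ J ∧ j ∈ J)
  iseqv :=
    { refl := fun _ => Or.inl rfl
      symm := fun h => h.elim (fun h => Or.inl h.symm) fun h => Or.inr ⟨h.2, h.1⟩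
      trans := by
        rintro i j k (rfl | ⟨h1, h2⟩) (rfl | ⟨h3, h4⟩)
        · exact Or.inl rfl
        · exact Or.inr ⟨h3, h4⟩
        · exact Or.inr ⟨h1, h2⟩
        · exact Or.inr ⟨h1, h4⟩ }

/-- The equivalence relation whose classes are `J` and its complement. -/
def splitSetoid (J : Finset X) : Setoid X where
  r i j := i ∈ J ↔ j ∈ J
  iseqv := ⟨fun _ => Iff.rfl, Iff.symm, Iff.trans⟩

theorem splitSetoid_rel {J : Finset X} {i j : X} : splitSetoid J i j ↔ (i ∈ J ↔ j ∈ J) := Iff.rfl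

theorem blockSetoid_le_iff {J : Finset X} {a : Setoid X} :
    blockSetoid J ≤ a ↔ ∀ i ∈ J, ∀ j ∈ J, a i j := by
  constructor
  · exact fun h i hi j hj => h (Or.inr ⟨hi, hj⟩)
  · rintro h i j (rfl | ⟨hi, hj⟩)
    · exact a.refl' _
    · exact h i hi j hj

theorem blockSetoid_le_splitSetoid (J : Finset X) : blockSetoid J ≤ splitSetoid J :=
  blockSetoid_le_iff.mpr fun _ hi _ hj => ⟨fun _ => hj, fun _ => hi⟩

theorem Setoid.exists_rel_of_lt {a b : Setoid X} (h : a < b) : ∃ s t, b s t ∧ ¬ a s t := by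
  by_contra! hc
  exact h.not_ge fun s t hst => hc s t hst

theorem not_blockSetoid_rel {J : Finset X} {i s : X} (hi : i ∉ J) (hs : s ∈ J) :
    ¬ blockSetoid J s i := by
  rintro (rfl | h)
  · exact hi hs
  · exact hi h.2

variable [DecidableEq X]

theorem blockSetoid_insert_le {J : Finset X} {a : Setoid X} (h : blockSetoid J ≤ a) {s t : X}
    (hs : s ∈ J) (hst : a s t) : blockSetoid (insert t J) ≤ a := by
  rw [blockSetoid_le_iff] at h ⊢
  intro i hi j hj
  have key : ∀ i ∈ insert t J, a s i := fun i hi =>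
    (Finset.mem_insert.mp hi).elim (fun h' => h' ▸ hst) (h s hs i)
  exact a.trans' (a.symm' (key i hi)) (key j hj)

theorem blockSetoid_insert_rel {J : Finset X} {i s : X} (hs : s ∈ J) :
    blockSetoid (insert i J) s i :=
  Or.inr ⟨Finset.mem_insert_of_mem hs, Finset.mem_insert_self i J⟩

theorem blockSetoid_lt_insert {J : Finset X} (hJ : J.Nonempty) {i : X} (hi : i ∉ J) :
    blockSetoid J < blockSetoid (insert i J) := by
  obtain ⟨s, hs⟩ := hJ
  refine lt_of_le_of_ne ?_ fun h => ?_
  · exact blockSetoid_le_iff.mpr fun a ha b hb =>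
      Or.inr ⟨Finset.mem_insert_of_mem ha, Finset.mem_insert_of_mem hb⟩
  · have := blockSetoid_insert_rel (i := i) hs
    rw [← h] at this
    exact not_blockSetoid_rel hi hs this

theorem blockSetoid_insert_injective {J : Finset X} (hJ : J.Nonempty) {i j : X} (hi : i ∉ J)
    (h : blockSetoid (insert i J) = blockSetoid (insert j J)) : i = j := by
  obtain ⟨s, hs⟩ := hJ
  have := blockSetoid_insert_rel (i := i) hs
  rw [h] at this
  rcases this with rfl | h
  · exact absurd hs hi
  · exact (Finset.mem_insert.mp h.2).resolve_right hi

/-- A relation above `blockSetoid J` either merges `J` with an element, or merges two elements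
outside `J`. -/
theorem exists_of_blockSetoid_lt {J : Finset X} {a : Setoid X} (h : blockSetoid J < a) :
    (∃ i ∉ J, blockSetoid (insert i J) ≤ a) ∨ ∃ s ∉ J, ∃ t ∉ J, s ≠ t ∧ a s t := by
  obtain ⟨s, t, hst, hn⟩ := Setoid.exists_rel_of_lt h
  have hne : s ≠ t := fun h' => hn (Or.inl h')
  by_cases hs : s ∈ J <;> by_cases ht : t ∈ J
  · exact absurd (Or.inr ⟨hs, ht⟩) hn
  · exact Or.inl ⟨t, ht, blockSetoid_insert_le h.le hs hst⟩
  · exact Or.inl ⟨s, hs, blockSetoid_insert_le h.le ht (a.symm' hst)⟩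
  · exact Or.inr ⟨s, hs, t, ht, hne, hst⟩

/-- Adjoining one element to the block gives an atom of the interval above `blockSetoid J`.
Consequently such a relation can occur in an increasing list only as its head. -/
theorem blockSetoid_covBy_insert {J : Finset X} {i : X} {a : Setoid X} (h : blockSetoid J < a)
    (ha : a ≤ blockSetoid (insert i J)) : blockSetoid (insert i J) ≤ a := by
  rcases exists_of_blockSetoid_lt h with ⟨j, hj, hle⟩ | ⟨s, hs, t, ht, hne, hst⟩
  · by_cases hJ : J.Nonempty
    · obtain ⟨s, hs⟩ := hJ
      have := ha (hle (blockSetoid_insert_rel (i := j) hs))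
      rcases this with rfl | h'
      · exact absurd hs hj
      · rwa [(Finset.mem_insert.mp h'.2).resolve_right hj] at hle
    · rw [Finset.not_nonempty_iff_eq_empty] at hJ
      subst hJ
      refine blockSetoid_le_iff.mpr fun s hs t ht => ?_
      simp only [insert_empty_eq, Finset.mem_singleton] at hs ht
      subst hs ht
      exact a.refl' _
  · rcases ha hst with rfl | h'
    · exact absurd rfl hne
    · rw [(Finset.mem_insert.mp h'.1).resolve_right hs,
        (Finset.mem_insert.mp h'.2).resolve_right ht] at hne
      exact absurd rfl hne

/-- A relation meeting the coatom J | Jᶜ trivially cannot identify two elements outside J, hence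
cannot attach two of them to J either. This determines the complements of the coatom. -/
theorem eq_insert_of_inf_splitSetoid {J : Finset X} {a : Setoid X} (h : blockSetoid J < a)
    (ha : a ⊓ splitSetoid J ≤ blockSetoid J) : ∃ i ∉ J, a = blockSetoid (insert i J) := by
  have hout : ∀ s ∉ J, ∀ t ∉ J, a s t → s = t := fun s hs t ht hst =>
    (ha (show (a ⊓ splitSetoid J) s t from
      ⟨hst, ⟨fun h' => absurd h' hs, fun h' => absurd h' ht⟩⟩)).elim id fun h' => absurd h'.1 hs
  rcases exists_of_blockSetoid_lt h with ⟨i, hi, hle⟩ | ⟨s, hs, t, ht, hne, hst⟩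
  · refine ⟨i, hi, le_antisymm ?_ hle⟩
    have key : ∀ s ∈ J, ∀ t ∉ J, a s t → t = i := fun s hs t ht hst =>
      hout t ht i hi (a.trans' (a.symm' hst) (hle (blockSetoid_insert_rel hs)))
    intro s t hst
    by_cases hs : s ∈ J <;> by_cases ht : t ∈ J
    · exact Or.inr ⟨Finset.mem_insert_of_mem hs, Finset.mem_insert_of_mem ht⟩
    · rw [key s hs t ht hst]
      exact blockSetoid_insert_rel hs
    · rw [key t ht s hs (a.symm' hst)]
      exact (blockSetoid _).symm' (blockSetoid_insert_rel ht)
    · exact Or.inl (hout s hs t ht hst)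
  · exact absurd (hout s hs t ht hst) hne

variable [Fintype X]

theorem blockSetoid_lt_splitSetoid {J : Finset X} (h : 1 < Jᶜ.card) :
    blockSetoid J < splitSetoid J := by
  refine lt_of_le_of_ne (blockSetoid_le_splitSetoid J) fun he => ?_
  obtain ⟨s, hs, t, ht, hne⟩ := Finset.one_lt_card.mp h
  rw [Finset.mem_compl] at hs ht
  have : splitSetoid J s t := ⟨fun h' => absurd h' hs, fun h' => absurd h' ht⟩
  rw [← he] at this
  exact this.elim hne fun h' => hs h'.1

theorem splitSetoid_lt_top {J : Finset X} (hJ : J.Nonempty) (h : 0 < Jᶜ.card) :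
    splitSetoid J < ⊤ := by
  refine lt_top_iff_ne_top.mpr fun he => ?_
  obtain ⟨s, hs⟩ := hJ
  obtain ⟨t, ht⟩ := Finset.card_pos.mp h
  have : splitSetoid J s t := by
    rw [he]
    trivial
  exact (Finset.mem_compl.mp ht) (this.mp hs)

theorem blockSetoid_lt_top {J : Finset X} (hJ : J.Nonempty) (h : 0 < Jᶜ.card) :
    blockSetoid J < ⊤ :=
  (blockSetoid_le_splitSetoid J).trans_lt (splitSetoid_lt_top hJ h)

theorem eq_top_of_blockSetoid_lt {J : Finset X} (h : Jᶜ.card = 1) {a : Setoid X}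
    (ha : blockSetoid J < a) : a = ⊤ := by
  obtain ⟨t, ht⟩ := Finset.card_eq_one.mp h
  have hJ : ∀ x, x ∉ J ↔ x = t := fun x => by rw [← Finset.mem_compl, ht, Finset.mem_singleton]
  rcases exists_of_blockSetoid_lt ha with ⟨i, hi, hle⟩ | ⟨s, hs, t', ht', hne, hst⟩
  · refine top_le_iff.mp fun x y _ => hle (Or.inr ?_)
    have : ∀ x, x ∈ insert i J := fun x => by
      by_cases hx : x ∈ J
      · exact Finset.mem_insert_of_mem hx
      · rw [(hJ x).mp hx, (hJ i).mp hi]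
        exact Finset.mem_insert_self _ _
    exact ⟨this x, this y⟩
  · exact absurd (((hJ s).mp hs).trans ((hJ t').mp ht').symm) hne

end BlockSetoid

/-! ### Acyclicity of the intervals of the partition lattice -/

namespace ListChain

variable (K : Type) [CommRing K] {X : Type}

/-- The strictly increasing lists of equivalence relations strictly between `x` and `⊤`. -/
def interior (x : Setoid X) : Set (List (Setoid X)) :=
  {l | l.Pairwise (· < ·) ∧ ∀ a ∈ l, x < a ∧ a < ⊤}

theorem interior_sublist {x : Setoid X} {l l' : List (Setoid X)} (hl : l ∈ interior x)
    (h : l'.Sublist l) : l' ∈ interior x :=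
  ⟨hl.1.sublist h, fun a ha => hl.2 a (h.subset ha)⟩

theorem cons_mem_interior_iff {x a : Setoid X} {l : List (Setoid X)} :
    a :: l ∈ interior x ↔ x < a ∧ a < ⊤ ∧ l ∈ interior a := by
  constructor
  · rintro ⟨h1, h2⟩
    rw [List.pairwise_cons] at h1
    exact ⟨(h2 a List.mem_cons_self).1, (h2 a List.mem_cons_self).2, h1.2,
      fun b hb => ⟨h1.1 b hb, (h2 b (List.mem_cons_of_mem _ hb)).2⟩⟩
  · rintro ⟨h1, h2, h3⟩
    refine ⟨List.pairwise_cons.mpr ⟨fun b hb => (h3.2 b hb).1, h3.1⟩, fun b hb => ?_⟩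
    rcases List.mem_cons.mp hb with rfl | hb
    · exact ⟨h1, h2⟩
    · exact ⟨h1.trans (h3.2 b hb).1, (h3.2 b hb).2⟩

theorem interior_mono {x y : Setoid X} (h : x ≤ y) : interior y ⊆ interior x :=
  fun _ hl => ⟨hl.1, fun a ha => ⟨h.trans_lt (hl.2 a ha).1, (hl.2 a ha).2⟩⟩

/-- The span of the lists of length `m` in the interior of `[x, ⊤]`. -/
noncomputable def chains (x : Setoid X) (m : ℕ) : Submodule K (List (Setoid X) →₀ K) :=
  Finsupp.supported K K {l | l ∈ interior x ∧ l.length = m}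

variable {K}

theorem bd_mem_chains {x : Setoid X} {m : ℕ} {z : List (Setoid X) →₀ K}
    (hz : z ∈ chains K x (m + 1)) : bd K z ∈ chains K x m :=
  bd_mem_supported (fun _ hl _ h => interior_sublist hl h) hz

theorem consMap_mem_chains {x a : Setoid X} (hx : x < a) (ha : a < ⊤) {m : ℕ}
    {z : List (Setoid X) →₀ K} (hz : z ∈ chains K a m) :
    consMap K a z ∈ chains K x (m + 1) :=
  consMap_mem_supported (t := {l | l ∈ interior x ∧ l.length = m + 1})
    (fun _ hl => ⟨cons_mem_interior_iff.mpr ⟨hx, ha, hl.1⟩, by simpa using hl.2⟩) hz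

variable (K) in
/-- The part of a linear combination of lists formed by the lists with head `a`. -/
noncomputable def tailAt {α : Type} (a : α) : (List α →₀ K) →ₗ[K] (List α →₀ K) :=
  Finsupp.lcomapDomain (List.cons a) (List.cons_injective)

theorem tailAt_apply {α : Type} (a : α) (z : List α →₀ K) (l : List α) :
    tailAt K a z l = z (a :: l) := rfl

theorem tailAt_single_self {α : Type} (a : α) (l : List α) (c : K) :
    tailAt K a (Finsupp.single (a :: l) c) = Finsupp.single l c := by
  classical
  ext l'
  rw [tailAt_apply, Finsupp.single_apply, Finsupp.single_apply]
  simp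

theorem tailAt_single_of_ne {α : Type} {a : α} {l : List α} (h : ∀ l', l ≠ a :: l') (c : K) :
    tailAt K a (Finsupp.single l c) = 0 := by
  classical
  ext l'
  rw [tailAt_apply, Finsupp.single_apply, if_neg (h l')]
  rfl

theorem tailAt_consMap_self {α : Type} (a : α) (z : List α →₀ K) :
    tailAt K a (consMap K a z) = z := by
  have h : tailAt K a ∘ₗ consMap K a = LinearMap.id := by
    ext l : 2
    simp [tailAt_single_self]
  exact LinearMap.congr_fun h z

theorem tailAt_consMap_of_ne {α : Type} {a b : α} (hab : a ≠ b) (z : List α →₀ K) :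
    tailAt K a (consMap K b z) = 0 := by
  have h : tailAt K a ∘ₗ consMap K b = 0 := by
    ext l : 2
    simp only [LinearMap.comp_apply, Finsupp.lsingle_apply, consMap_single]
    rw [tailAt_single_of_ne (fun l' h => hab (List.cons.inj h).1.symm)]
    simp
  exact LinearMap.congr_fun h z

theorem tailAt_mem_chains {x a : Setoid X} {m : ℕ} {z : List (Setoid X) →₀ K}
    (hz : z ∈ chains K x (m + 1)) : tailAt K a z ∈ chains K a m := by
  refine (Finsupp.mem_supported' K _).mpr fun l hl => ?_
  rw [tailAt_apply]
  refine (Finsupp.mem_supported' K _).mp hz _ fun h => hl ?_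
  exact ⟨(cons_mem_interior_iff.mp h.1).2.2, by simpa using h.2⟩

/-- If `a` is an atom over `x`, taking the lists with head `a` anticommutes with the boundary. -/
theorem tailAt_bd {x a : Setoid X} (hxa : ∀ b, x < b → ¬ b < a) {m : ℕ}
    {z : List (Setoid X) →₀ K} (hz : z ∈ chains K x m) :
    tailAt K a (bd K z) = - bd K (tailAt K a z) := by
  have := Finsupp.map_eq_of_mem_supported (tailAt K a ∘ₗ bd K) (-(bd K ∘ₗ tailAt K a))
    (s := {l | l ∈ interior x ∧ l.length = m}) ?_ hz
  · exact this
  rintro l ⟨hl, -⟩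
  simp only [LinearMap.comp_apply, LinearMap.neg_apply, bd_single]
  cases l with
  | nil =>
    rw [tailAt_single_of_ne (by simp)]
    simp [face]
  | cons b l =>
    obtain ⟨h1, h2, h3⟩ := cons_mem_interior_iff.mp hl
    have hl0 : tailAt K a (Finsupp.single l (1 : K)) = 0 :=
      tailAt_single_of_ne (fun l' h => hxa b h1 (h3.2 a (by rw [h]; exact List.mem_cons_self)).1) 1
    rw [face, map_sub, hl0, zero_sub]
    by_cases hab : a = b
    · subst hab
      rw [tailAt_single_self, tailAt_consMap_self, bd_single]
    · rw [tailAt_consMap_of_ne hab,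
        tailAt_single_of_ne (fun l' h => hab (List.cons.inj h).1.symm), map_zero]

/-! ### Homotopy complementation in the intervals above one block -/

section Acyclic

variable [DecidableEq X] [Fintype X]

/-- The increasing list of equivalence relations obtained by merging the block `J` successively
with the entries of a list, where the last merge is left out. -/
def mergeList : List X → Finset X → List (Setoid X)
  | [], _ => []
  | [_], _ => []
  | a :: b :: u, J => blockSetoid (insert a J) :: mergeList (b :: u) (insert a J)

/-- When no entry `a` is a complement of the coatom, `a ⊓ splitSetoid J` stays strictly above
`blockSetoid J`, so the prism does not leave the open interval. The clause on lower bounds `b` is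
the invariant that keeps the lists increasing when the meet of the next entry is prepended. -/
theorem prismList_mem_supported {J : Finset X} (hJ : J.Nonempty) (hc : 1 < Jᶜ.card) :
    ∀ (l : List (Setoid X)) (m : ℕ), l ∈ interior (blockSetoid J) → l.length = m →
      (∀ a ∈ l, ∀ i ∉ J, a ≠ blockSetoid (insert i J)) →
      prismList K (· ⊓ splitSetoid J) (splitSetoid J) l ∈ Finsupp.supported K K
        {l' : List (Setoid X) | (l'.Pairwise (· ≤ ·) ∧
          ∀ a ∈ l', blockSetoid J < a ∧ a < ⊤ ∧ ∀ b, (∀ c ∈ l, b ≤ c) →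
            b ⊓ splitSetoid J ≤ a) ∧ l'.length = m + 1} := by
  have hp := blockSetoid_lt_splitSetoid hc
  have hp' := splitSetoid_lt_top hJ (zero_lt_one.trans hc)
  intro l
  induction l with
  | nil =>
    rintro m - hm -
    rw [prismList]
    refine Finsupp.single_mem_supported K _ ⟨⟨List.pairwise_singleton _ _, ?_⟩, ?_⟩
    · intro a ha
      rw [List.mem_singleton.mp ha]
      exact ⟨hp, hp', fun b _ => inf_le_right⟩
    · simpa using hm.symm
  | cons a l ih =>
    rintro m hl hm hne
    obtain ⟨h1, h2, h3⟩ := cons_mem_interior_iff.mp hl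
    have hπ : blockSetoid J < a ⊓ splitSetoid J := by
      refine lt_of_le_of_ne (le_inf h1.le hp.le) fun h => ?_
      obtain ⟨i, hi, h'⟩ := eq_insert_of_inf_splitSetoid h1 h.ge
      exact hne a List.mem_cons_self i hi h'
    rw [prismList]
    refine Submodule.sub_mem _ ?_ ?_
    · refine Finsupp.single_mem_supported K _ ⟨⟨?_, ?_⟩, ?_⟩
      · rw [List.pairwise_cons]
        refine ⟨fun b hb => ?_, hl.1.imp le_of_lt⟩
        rcases List.mem_cons.mp hb with rfl | hb
        · exact inf_le_left
        · exact inf_le_left.trans (h3.2 b hb).1.le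
      · intro b hb
        rcases List.mem_cons.mp hb with rfl | hb
        · exact ⟨hπ, inf_le_left.trans_lt h2,
            fun c hc => inf_le_inf_right _ (hc _ List.mem_cons_self)⟩
        · exact ⟨(hl.2 b hb).1, (hl.2 b hb).2, fun c hc => inf_le_left.trans (hc b hb)⟩
      · simpa using hm
    · cases m with
      | zero => simp at hm
      | succ m =>
        refine consMap_mem_supported ?_ (ih m (interior_mono h1.le h3) (by simpa using hm)
          fun b hb => hne b (List.mem_cons_of_mem _ hb))
        rintro l' ⟨⟨h4, h5⟩, h6⟩
        refine ⟨⟨List.pairwise_cons.mpr ⟨fun b hb => ?_, h4⟩, fun b hb => ?_⟩, by simpa using h6⟩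
        · exact (h5 b hb).2.2 a fun c hc => (h3.2 c hc).1.le
        · rcases List.mem_cons.mp hb with rfl | hb
          · exact ⟨hπ, inf_le_left.trans_lt h2,
              fun c hc => inf_le_inf_right _ (hc _ List.mem_cons_self)⟩
          · exact ⟨(h5 b hb).1, (h5 b hb).2.1, fun c hc =>
              (h5 b hb).2.2 c fun d hd => hc d (List.mem_cons_of_mem _ hd)⟩

/-- Cycles avoiding the complements `blockSetoid (insert i J)` of `splitSetoid J` are boundaries. -/
theorem exists_bd_eq_of_avoid {J : Finset X} (hJ : J.Nonempty) (hc : 1 < Jᶜ.card) {m : ℕ}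
    {z : List (Setoid X) →₀ K}
    (hz : z ∈ Finsupp.supported K K {l | (l ∈ interior (blockSetoid J) ∧ l.length = m) ∧
      ∀ a ∈ l, ∀ i ∉ J, a ≠ blockSetoid (insert i J)})
    (hbd : bd K z = 0) : ∃ y ∈ chains K (blockSetoid J) (m + 1), bd K y = z := by
  -- The contraction a ≥ a ⊓ p ≤ p fills the cycle with weakly increasing lists; `strictify` then
  -- removes the repetitions without changing the boundary.
  set h := prism K (· ⊓ splitSetoid J) (splitSetoid J) z with hh
  have hmem : h ∈ Finsupp.supported K K {l' : List (Setoid X) | (l'.Pairwise (· ≤ ·) ∧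
      ∀ a ∈ l', blockSetoid J < a ∧ a < ⊤) ∧ l'.length = m + 1} := by
    refine prism_mem_supported (fun l hl => ?_) hz
    refine Finsupp.supported_mono ?_ (prismList_mem_supported hJ hc l m hl.1.1 hl.1.2 hl.2)
    exact fun l' hl' => ⟨⟨hl'.1.1, fun a ha => ⟨(hl'.1.2 a ha).1, (hl'.1.2 a ha).2.1⟩⟩, hl'.2⟩
  have hbdh : bd K h = z := by
    have := bd_prism K (· ⊓ splitSetoid J) (splitSetoid J) z
    rwa [hbd, map_zero, add_zero] at this
  refine ⟨strictify K h, ?_, ?_⟩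
  · refine Finsupp.supported_mono ?_ (strictify_mem_supported hmem)
    exact fun l hl => ⟨⟨hl.2, hl.1.1.2⟩, hl.1.2⟩
  · rw [← strictify_bd (Finsupp.supported_mono (fun l hl => hl.1.1) hmem), hbdh]
    exact strictify_eq_self (Finsupp.supported_mono (fun l hl => hl.1.1.1) hz)

/-- A complement is an atom, so it can only be the head of a list, and distinct elements give
distinct complements. The sum therefore removes each list that meets a complement exactly once. -/
theorem sub_sum_consMap_tailAt_mem {J : Finset X} (hJ : J.Nonempty) {m : ℕ}
    {z : List (Setoid X) →₀ K} (hz : z ∈ chains K (blockSetoid J) m) :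
    z - ∑ i ∈ Jᶜ, consMap K (blockSetoid (insert i J)) (tailAt K (blockSetoid (insert i J)) z) ∈
      Finsupp.supported K K {l | (l ∈ interior (blockSetoid J) ∧ l.length = m) ∧
        ∀ a ∈ l, ∀ i ∉ J, a ≠ blockSetoid (insert i J)} := by
  have := Finsupp.map_mem_of_mem_supported (LinearMap.id - ∑ i ∈ Jᶜ,
    consMap K (blockSetoid (insert i J)) ∘ₗ tailAt K (blockSetoid (insert i J)))
    (Finsupp.supported K K {l | (l ∈ interior (blockSetoid J) ∧ l.length = m) ∧
        ∀ a ∈ l, ∀ i ∉ J, a ≠ blockSetoid (insert i J)}) ?_ hz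
  · simpa using this
  rintro l ⟨hl, hm⟩
  simp only [LinearMap.sub_apply, LinearMap.id_apply, LinearMap.sum_apply, LinearMap.comp_apply]
  by_cases hex : ∃ i ∉ J, ∃ l', l = blockSetoid (insert i J) :: l'
  · obtain ⟨i, hi, l', rfl⟩ := hex
    rw [Finset.sum_eq_single i]
    · rw [tailAt_single_self, consMap_single, sub_self]
      exact Submodule.zero_mem _
    · intro j hj hne
      rw [tailAt_single_of_ne, map_zero]
      intro l'' h
      exact hne (blockSetoid_insert_injective hJ hi (List.cons.inj h).1).symm
    · intro h
      exact absurd (Finset.mem_compl.mpr hi) h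
  · push Not at hex
    rw [Finset.sum_eq_zero, sub_zero]
    · refine Finsupp.single_mem_supported K _ ⟨⟨hl, hm⟩, fun a ha i hi h => ?_⟩
      subst h
      cases l with
      | nil => simp at ha
      | cons b l =>
        obtain ⟨h1, h2, h3⟩ := cons_mem_interior_iff.mp hl
        rcases List.mem_cons.mp ha with rfl | ha
        · exact hex i hi l rfl
        · exact ((h3.2 _ ha).1).not_ge (blockSetoid_covBy_insert h1 (h3.2 _ ha).1.le)
    · intro i hi
      rw [tailAt_single_of_ne (hex i (Finset.mem_compl.mp hi)), map_zero]

/-- A cycle of the open interval between `blockSetoid J` and `⊤` is a boundary if it does not have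
the top degree, or if it has the top degree and its coefficients at the chains `mergeList u J`
vanish. -/
theorem exists_bd_eq (k : ℕ) : ∀ {J : Finset X} (_ : J.Nonempty) (_ : Jᶜ.card = k + 1) (m : ℕ)
    {z : List (Setoid X) →₀ K} (_ : z ∈ chains K (blockSetoid J) m) (_ : bd K z = 0)
    (_ : m = k → ∀ u : List X, u.Nodup → (∀ a, a ∈ u ↔ a ∉ J) → z (mergeList u J) = 0),
    ∃ y ∈ chains K (blockSetoid J) (m + 1), bd K y = z := by
  induction k with
  | zero =>
    intro J hJ hc m z hz hbd hspec
    -- With a single element outside J the open interval is empty. Only the empty list remains; it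
    -- is `mergeList [t] J`, so its coefficient vanishes by `hspec`.
    refine ⟨0, Submodule.zero_mem _, ?_⟩
    rw [map_zero]
    ext l
    symm
    rw [Finsupp.coe_zero, Pi.zero_apply]
    by_contra hne
    obtain ⟨hl, hm⟩ : l ∈ interior (blockSetoid J) ∧ l.length = m := by
      by_contra h
      exact hne ((Finsupp.mem_supported' K _).mp hz l h)
    cases l with
    | nil =>
      obtain ⟨t, ht⟩ := Finset.card_eq_one.mp hc
      refine hne (hspec (by simpa using hm.symm) [t] (List.nodup_singleton t) fun a => ?_)
      rw [← Finset.mem_compl, ht]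
      simp
    | cons a l =>
      have h := cons_mem_interior_iff.mp hl
      exact h.2.1.ne (eq_top_of_blockSetoid_lt hc h.1)
  | succ k ih =>
    intro J hJ hc m z hz hbd hspec
    have hc1 : 1 < Jᶜ.card := by omega
    cases m with
    | zero =>
      refine exists_bd_eq_of_avoid hJ hc1 (Finsupp.supported_mono ?_ hz) hbd
      rintro l ⟨hl, hm⟩
      refine ⟨⟨hl, hm⟩, ?_⟩
      rw [List.length_eq_zero_iff.mp hm]
      simp
    | succ m =>
      have hcard : ∀ i ∉ J, (insert i J)ᶜ.card = k + 1 := fun i hi => by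
        have := Finset.card_insert_of_notMem hi
        have h1 := Finset.card_add_card_compl J
        have h2 := Finset.card_add_card_compl (insert i J)
        omega
      -- The lists headed by an atom have tails which form a cycle in the interval above that atom.
      -- The coefficient condition there for `u` is the condition here for `i :: u`.
      have hy : ∀ i, ∃ y, i ∉ J → y ∈ chains K (blockSetoid (insert i J)) (m + 1) ∧
          bd K y = tailAt K (blockSetoid (insert i J)) z := by
        intro i
        by_cases hi : i ∈ J
        · exact ⟨0, fun h => absurd hi h⟩
        obtain ⟨y, hy1, hy2⟩ := ih (Finset.insert_nonempty i J) (hcard i hi) m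
          (tailAt_mem_chains hz) (by
            have := tailAt_bd (a := blockSetoid (insert i J)) (fun b hb hlt =>
              hlt.not_ge (blockSetoid_covBy_insert hb hlt.le)) hz
            rwa [hbd, map_zero, eq_comm, neg_eq_zero] at this) (by
            rintro rfl u hu hmem
            rw [tailAt_apply]
            have hne : u ≠ [] := by
              rintro rfl
              obtain ⟨t, ht⟩ := Finset.card_pos.mp (by rw [hcard i hi]; omega)
              exact absurd ((hmem t).mpr (Finset.mem_compl.mp ht)) (by simp)
            obtain ⟨b, u, rfl⟩ := List.exists_cons_of_ne_nil hne
            refine hspec rfl (i :: b :: u) (List.nodup_cons.mpr ⟨fun h =>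
              (hmem i).mp h (Finset.mem_insert_self i J), hu⟩) fun a => ?_
            rw [List.mem_cons, hmem, Finset.mem_insert, not_or]
            refine ⟨?_, fun h => ?_⟩
            · rintro (rfl | h)
              · exact hi
              · exact h.2
            · by_cases ha : a = i
              · exact Or.inl ha
              · exact Or.inr ⟨ha, h⟩)
        exact ⟨y, fun _ => ⟨hy1, hy2⟩⟩
      choose y hy using hy
      have htop : ∀ i ∉ J, blockSetoid (insert i J) < ⊤ := fun i hi =>
        blockSetoid_lt_top (Finset.insert_nonempty i J) (by rw [hcard i hi]; omega)
      -- By the cone formula, the boundary of `Y` is the sum of the `y i` minus the part of `z`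
      -- headed by complements. The `y i` live strictly above atoms and so contain no complement;
      -- hence `z + bd K Y` avoids all of them.
      set Y := ∑ i ∈ Jᶜ, consMap K (blockSetoid (insert i J)) (y i) with hY
      have hYmem : Y ∈ chains K (blockSetoid J) (m + 1 + 1) := by
        refine Submodule.sum_mem _ fun i hi => ?_
        have hi' := Finset.mem_compl.mp hi
        exact consMap_mem_chains (blockSetoid_lt_insert hJ hi') (htop i hi') (hy i hi').1
      have hYbd : bd K Y = ∑ i ∈ Jᶜ, y i - ∑ i ∈ Jᶜ, consMap K (blockSetoid (insert i J))
          (tailAt K (blockSetoid (insert i J)) z) := by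
        rw [hY, map_sum, ← Finset.sum_sub_distrib]
        refine Finset.sum_congr rfl fun i hi => ?_
        rw [bd_consMap, (hy i (Finset.mem_compl.mp hi)).2]
      have hz' : z + bd K Y ∈ Finsupp.supported K K {l | (l ∈ interior (blockSetoid J) ∧
          l.length = m + 1) ∧ ∀ a ∈ l, ∀ i ∉ J, a ≠ blockSetoid (insert i J)} := by
        rw [hYbd, add_sub_left_comm]
        refine Submodule.add_mem _ (Submodule.sum_mem _ fun i hi => ?_)
          (sub_sum_consMap_tailAt_mem hJ hz)
        have hi' := Finset.mem_compl.mp hi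
        refine Finsupp.supported_mono ?_ (hy i hi').1
        rintro l ⟨hl, hm⟩
        refine ⟨⟨interior_mono (blockSetoid_lt_insert hJ hi').le hl, hm⟩, ?_⟩
        rintro a ha j hj rfl
        have hlt := (hl.2 _ ha).1
        have := blockSetoid_covBy_insert (blockSetoid_lt_insert hJ hi') hlt.le
        exact hlt.not_ge this
      obtain ⟨w, hw1, hw2⟩ := exists_bd_eq_of_avoid hJ hc1 hz' (by
        rw [map_add, hbd, zero_add, bd_bd])
      exact ⟨w - Y, Submodule.sub_mem _ hw1 hYmem, by rw [map_sub, hw2, add_sub_cancel_right]⟩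

end Acyclic

end ListChain

/-! ### Words of blocks and the fundamental cycles of the Boolean sublattices -/

namespace ListChain

variable (K : Type) [CommRing K] {X : Type}

/-- Merging a block with the first block of a word of blocks. -/
noncomputable def mergeHeadList (B : List X) : List (List X) → (List (List X) →₀ K)
  | [] => 0
  | B' :: l => Finsupp.single ((B ++ B') :: l) 1

/-- The alternating sum of the merges of two consecutive blocks in a word of blocks. -/
noncomputable def barList : List (List X) → (List (List X) →₀ K)
  | [] => 0
  | B :: l => mergeHeadList K B l - consMap K B (barList l)

/-- The linear extension of `mergeHeadList`. -/
noncomputable def mergeHead (B : List X) : (List (List X) →₀ K) →ₗ[K] (List (List X) →₀ K) :=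
  Finsupp.linearCombination K (mergeHeadList K B)

/-- The linear extension of `barList`. -/
noncomputable def bar : (List (List X) →₀ K) →ₗ[K] (List (List X) →₀ K) :=
  Finsupp.linearCombination K (barList K)

@[simp]
theorem mergeHead_single (B : List X) (l : List (List X)) :
    mergeHead K B (Finsupp.single l 1) = mergeHeadList K B l := by
  simp [mergeHead]

@[simp]
theorem bar_single (l : List (List X)) : bar K (Finsupp.single l 1) = barList K l := by
  simp [bar]

theorem mergeHead_consMap (B B' : List X) (z : List (List X) →₀ K) :
    mergeHead K B (consMap K B' z) = consMap K (B ++ B') z := by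
  have h : mergeHead K B ∘ₗ consMap K B' = consMap K (B ++ B') := by
    ext l : 2
    simp [mergeHeadList]
  exact LinearMap.congr_fun h z

theorem bar_consMap (B : List X) (z : List (List X) →₀ K) :
    bar K (consMap K B z) = mergeHead K B z - consMap K B (bar K z) := by
  have h : bar K ∘ₗ consMap K B = mergeHead K B - consMap K B ∘ₗ bar K := by
    ext l : 2
    simp [barList]
  exact LinearMap.congr_fun h z

/-- This is associativity of concatenation. It is what makes `bar`, the differential of a bar
construction, square to zero. -/
theorem bar_mergeHeadList (B : List X) (l : List (List X)) :
    bar K (mergeHeadList K B l) = mergeHead K B (barList K l) := by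
  cases l with
  | nil => simp [mergeHeadList, barList]
  | cons B' l =>
    rw [mergeHeadList, bar_single, barList, barList, map_sub, mergeHead_consMap]
    congr 1
    cases l with
    | nil => simp [mergeHeadList]
    | cons C l => rw [mergeHeadList, mergeHeadList, mergeHead_single, mergeHeadList,
        List.append_assoc]

theorem bar_barList (l : List (List X)) : bar K (barList K l) = 0 := by
  induction l with
  | nil => simp [barList]
  | cons B l ih =>
    rw [barList, map_sub, bar_consMap, ih, map_zero, sub_zero, bar_mergeHeadList, sub_self]

/-- `S` is obtained from the word of blocks `T` by merging two consecutive blocks. -/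
def IsMerge (T S : List (List X)) : Prop :=
  ∃ l B B' l', T = l ++ B :: B' :: l' ∧ S = l ++ (B ++ B') :: l'

theorem barList_mem (T : List (List X)) :
    barList K T ∈ Finsupp.supported K K {S | IsMerge T S} := by
  induction T with
  | nil => exact Submodule.zero_mem _
  | cons B l ih =>
    rw [barList]
    refine Submodule.sub_mem _ ?_ (consMap_mem_supported ?_ ih)
    · cases l with
      | nil => exact Submodule.zero_mem _
      | cons B' l => exact Finsupp.single_mem_supported K _ ⟨[], B, B', l, rfl, rfl⟩
    · rintro S ⟨l₁, C, C', l₂, rfl, rfl⟩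
      exact ⟨B :: l₁, C, C', l₂, rfl, rfl⟩

variable [DecidableEq X]

/-- The partition generated by the blocks of a word of blocks. -/
def wordPartition : List (List X) → Setoid X
  | [] => ⊥
  | B :: l => blockSetoid B.toFinset ⊔ wordPartition l

theorem wordPartition_le_iff {T : List (List X)} {a : Setoid X} :
    wordPartition T ≤ a ↔ ∀ B ∈ T, ∀ i ∈ B, ∀ j ∈ B, a i j := by
  induction T with
  | nil => simp [wordPartition]
  | cons B l ih => simp [wordPartition, ih, blockSetoid_le_iff]

theorem wordPartition_rel {T : List (List X)} {B : List X} (hB : B ∈ T) {i j : X} (hi : i ∈ B)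
    (hj : j ∈ B) : wordPartition T i j :=
  wordPartition_le_iff.mp le_rfl B hB i hi j hj

/-- The words of pairwise disjoint nonempty blocks. -/
def IsBlockWord (T : List (List X)) : Prop :=
  T.flatten.Nodup ∧ ∀ B ∈ T, B ≠ []

/-- Every block of the word is B or is disjoint from B, so the generated partition lies below
`splitSetoid B.toFinset`, which separates i from j. -/
theorem not_wordPartition_rel {l l' : List (List X)} {B C : List X}
    (h : IsBlockWord (l ++ B :: C :: l')) {i j : X} (hi : i ∈ B) (hj : j ∈ C) :
    ¬ wordPartition (l ++ B :: C :: l') i j := by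
  have hd := (List.nodup_flatten.mp h.1).2
  have hj' : j ∉ B := fun hj' => by
    have := (List.pairwise_append.mp hd).2.1
    exact (List.pairwise_cons.mp this).1 C List.mem_cons_self hj' hj
  have hle : wordPartition (l ++ B :: C :: l') ≤ splitSetoid B.toFinset := by
    refine wordPartition_le_iff.mpr fun D hD s hs t ht => ?_
    rw [splitSetoid_rel, List.mem_toFinset, List.mem_toFinset]
    have hdisj : D = B ∨ List.Disjoint D B := by
      rcases List.mem_append.mp hD with hD | hD
      · exact Or.inr ((List.pairwise_append.mp hd).2.2 D hD B List.mem_cons_self)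
      · rcases List.mem_cons.mp hD with rfl | hD
        · exact Or.inl rfl
        · exact Or.inr ((List.pairwise_cons.mp (List.pairwise_append.mp hd).2.1).1 D hD).symm
    rcases hdisj with rfl | hdisj
    · exact ⟨fun _ => ht, fun _ => hs⟩
    · exact ⟨fun h => absurd h (hdisj hs), fun h => absurd h (hdisj ht)⟩
  intro hr
  have := hle hr
  rw [splitSetoid_rel, List.mem_toFinset, List.mem_toFinset] at this
  exact hj' (this.mp hi)

omit [DecidableEq X] in
theorem IsMerge.isBlockWord {T S : List (List X)} (h : IsMerge T S) (hT : IsBlockWord T) :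
    IsBlockWord S := by
  obtain ⟨l, B, B', l', rfl, rfl⟩ := h
  refine ⟨by simpa using hT.1, fun C hC => ?_⟩
  rcases List.mem_append.mp hC with hC | hC
  · exact hT.2 C (List.mem_append_left _ hC)
  · rcases List.mem_cons.mp hC with rfl | hC
    · have := hT.2 B (by simp)
      simp [this]
    · exact hT.2 C (by simp [hC])

omit [DecidableEq X] in
theorem IsMerge.length {T S : List (List X)} (h : IsMerge T S) : T.length = S.length + 1 := by
  obtain ⟨l, B, B', l', rfl, rfl⟩ := h
  simp
  omega

theorem IsMerge.wordPartition_lt {T S : List (List X)} (h : IsMerge T S) (hT : IsBlockWord T) :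
    wordPartition T < wordPartition S := by
  obtain ⟨l, B, B', l', rfl, rfl⟩ := h
  obtain ⟨i, hi⟩ := List.exists_mem_of_ne_nil B (hT.2 B (by simp))
  obtain ⟨j, hj⟩ := List.exists_mem_of_ne_nil B' (hT.2 B' (by simp))
  refine lt_of_le_of_ne ?_ fun he => ?_
  · refine wordPartition_le_iff.mpr fun C hC s hs t ht => ?_
    have : ∃ D ∈ l ++ (B ++ B') :: l', s ∈ D ∧ t ∈ D := by
      rcases List.mem_append.mp hC with hC | hC
      · exact ⟨C, by simp [hC], hs, ht⟩
      · rcases List.mem_cons.mp hC with rfl | hC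
        · exact ⟨C ++ B', by simp, by simp [hs], by simp [ht]⟩
        · rcases List.mem_cons.mp hC with rfl | hC
          · exact ⟨B ++ C, by simp, by simp [hs], by simp [ht]⟩
          · exact ⟨C, by simp [hC], hs, ht⟩
    obtain ⟨D, hD, hs, ht⟩ := this
    exact wordPartition_rel hD hs ht
  · refine not_wordPartition_rel hT hi hj ?_
    rw [he]
    exact wordPartition_rel (B := B ++ B') (by simp) (by simp [hi]) (by simp [hj])

theorem wordPartition_lt_top {T : List (List X)} (hT : IsBlockWord T) (h : 2 ≤ T.length) :
    wordPartition T < ⊤ := by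
  match T, h with
  | B :: C :: l, _ =>
    obtain ⟨i, hi⟩ := List.exists_mem_of_ne_nil B (hT.2 B (by simp))
    obtain ⟨j, hj⟩ := List.exists_mem_of_ne_nil C (hT.2 C (by simp))
    refine lt_top_iff_ne_top.mpr fun he => not_wordPartition_rel (l := []) hT hi hj ?_
    rw [List.nil_append, he]
    trivial

/-- The fundamental cycle of the Boolean lattice of partitions obtained by merging consecutive
blocks in a word of `n + 2` blocks. -/
noncomputable def fund : ℕ → List (List X) → (List (Setoid X) →₀ K)
  | 0, _ => Finsupp.single [] 1
  | n + 1, T =>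
    Finsupp.linearCombination K (fun S => consMap K (wordPartition S) (fund n S)) (barList K T)

variable {K}

theorem fund_mem_chains (n : ℕ) {T : List (List X)} (hT : IsBlockWord T) (h : T.length = n + 2) :
    fund K n T ∈ chains K (wordPartition T) n := by
  induction n generalizing T with
  | zero =>
    exact Finsupp.single_mem_supported K _ ⟨⟨List.Pairwise.nil, by simp⟩, rfl⟩
  | succ n ih =>
    refine Finsupp.map_mem_of_mem_supported _ _ (fun S hS => ?_) (barList_mem K T)
    have hS' : IsBlockWord S := IsMerge.isBlockWord hS hT
    have hl : S.length = n + 2 := by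
      have := IsMerge.length hS
      omega
    rw [Finsupp.linearCombination_single, one_smul]
    exact consMap_mem_chains (IsMerge.wordPartition_lt hS hT)
      (wordPartition_lt_top hS' (by omega)) (ih hS' hl)

/-- Since the inner terms are cycles, the cone formula reduces the boundary of `fund (n + 1) T` to
the signed sum of `fund n S` over the merges S of T. Unfolding `fund n` once more produces `bar`
applied twice. In the bottom case there are three blocks, and the two merges cancel. -/
theorem bd_fund (n : ℕ) {T : List (List X)} (h : T.length = n + 2) : bd K (fund K n T) = 0 := by
  induction n generalizing T with
  | zero => simp [fund, face]
  | succ n ih =>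
    have h1 : bd K (fund K (n + 1) T) =
        Finsupp.linearCombination K (fund K n) (barList K T) := by
      refine Finsupp.map_eq_of_mem_supported (bd K ∘ₗ Finsupp.linearCombination K
        (fun S => consMap K (wordPartition S) (fund K n S))) _ (fun S hS => ?_) (barList_mem K T)
      have hl : S.length = n + 2 := by
        have := IsMerge.length hS
        omega
      simp only [LinearMap.comp_apply, Finsupp.linearCombination_single, one_smul]
      rw [bd_consMap, ih hl, map_zero, sub_zero]
    rw [h1]
    cases n with
    | zero =>
      match T, h with
      | [A, B, C], _ => simp [barList, mergeHeadList, fund]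
    | succ n =>
      have h2 : Finsupp.linearCombination K (fund K (n + 1)) =
          Finsupp.linearCombination K (fun S => consMap K (wordPartition S) (fund K n S)) ∘ₗ
            bar (X := X) K := by
        ext S : 2
        simp [fund]
      rw [h2, LinearMap.comp_apply, bar_barList, map_zero]

/-! ### Naturality of the fundamental cycles under permutations -/

omit [DecidableEq X] in
theorem comap_perm_le {w : Equiv.Perm X} {a b : Setoid X} :
    Setoid.comap (w⁻¹ : Equiv.Perm X) a ≤ b ↔ a ≤ Setoid.comap w b := by
  constructor
  · intro h i j hij
    refine h (?_ : a _ _)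
    simpa using hij
  · intro h i j hij
    have : b (w (w⁻¹ i)) (w (w⁻¹ j)) := h hij
    simpa using this

theorem wordPartition_map (w : Equiv.Perm X) (T : List (List X)) :
    wordPartition (T.map (List.map w)) = Setoid.comap (w⁻¹ : Equiv.Perm X) (wordPartition T) := by
  refine eq_of_forall_ge_iff fun a => ?_
  rw [comap_perm_le, wordPartition_le_iff, wordPartition_le_iff]
  simp [Setoid.comap_rel]

omit [DecidableEq X] in
theorem barList_map (f : X → X) (T : List (List X)) :
    barList K (T.map (List.map f)) =
      Finsupp.lmapDomain K K (List.map (List.map f)) (barList K T) := by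
  induction T with
  | nil => simp [barList]
  | cons B l ih =>
    have h : ∀ z : List (List X) →₀ K, consMap K (B.map f)
        (Finsupp.lmapDomain K K (List.map (List.map f)) z) =
        Finsupp.lmapDomain K K (List.map (List.map f)) (consMap K B z) := fun z => by
      simp only [consMap, Finsupp.lmapDomain_apply, ← Finsupp.mapDomain_comp]
      rfl
    rw [List.map_cons, barList, barList, ih, h, map_sub]
    congr 1
    cases l with
    | nil => simp [mergeHeadList]
    | cons C l => simp [mergeHeadList]

/-- Relabelling commutes with every ingredient of the recursion. This yields the equivariance of the
map from permutations to cycles. -/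
theorem fund_map (w : Equiv.Perm X) (n : ℕ) (T : List (List X)) :
    fund K n (T.map (List.map w)) = Finsupp.lmapDomain K K
      (List.map (Setoid.comap (w⁻¹ : Equiv.Perm X))) (fund K n T) := by
  induction n generalizing T with
  | zero => simp [fund]
  | succ n ih =>
    have h : ∀ (a : Setoid X) (z : List (Setoid X) →₀ K),
        consMap K (Setoid.comap (w⁻¹ : Equiv.Perm X) a)
          (Finsupp.lmapDomain K K (List.map (Setoid.comap (w⁻¹ : Equiv.Perm X))) z) =
        Finsupp.lmapDomain K K (List.map (Setoid.comap (w⁻¹ : Equiv.Perm X)))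
          (consMap K a z) := fun a z => by
      simp only [consMap, Finsupp.lmapDomain_apply, ← Finsupp.mapDomain_comp]
      rfl
    rw [fund, fund, barList_map]
    generalize barList K T = z
    refine LinearMap.congr_fun (f := Finsupp.linearCombination K _ ∘ₗ
      Finsupp.lmapDomain K K (List.map (List.map w))) (g := Finsupp.lmapDomain K K _ ∘ₗ
        Finsupp.linearCombination K _) ?_ z
    ext S : 2
    simp only [LinearMap.comp_apply, Finsupp.lsingle_apply, Finsupp.lmapDomain_apply,
      Finsupp.mapDomain_single, Finsupp.linearCombination_single, one_smul]
    rw [ih, wordPartition_map, h]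
    rfl

/-! ### Coefficients of the fundamental cycles -/

/-- The coefficient of the word `α.reverse ++ t :: β` in an iterated product of `t` with the letters
of a list, where multiplying on the left or on the right with a letter introduces a
sign depending on the number of letters to the left of `t`. -/
def zipCoeff (s t : ℕ → K) : List X → List X → List X → K
  | [], α, β => if α = [] ∧ β = [] then 1 else 0
  | a :: u, α, β =>
    (if α.head? = some a then s (α.length - 1) * zipCoeff s t u α.tail β else 0) +
      (if β.head? = some a then t α.length * zipCoeff s t u α β.tail else 0)

/-- The linear functional `φ` vanishes on the words which have a block containing two distinct
elements, at least one of which is not in `P`. -/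
def VanishesOutside (φ : (List (List X) →₀ K) →ₗ[K] K) (P : Finset X) : Prop :=
  ∀ S : List (List X), (∃ B ∈ S, ∃ c ∈ B, ∃ d ∈ B, c ≠ d ∧ c ∉ P) → φ (Finsupp.single S 1) = 0

omit [DecidableEq X] in
theorem VanishesOutside.comp_consMap {φ : (List (List X) →₀ K) →ₗ[K] K} {P : Finset X}
    (h : VanishesOutside φ P) (B : List X) : VanishesOutside (φ ∘ₗ consMap K B) P := by
  rintro S ⟨C, hC, h'⟩
  simp only [LinearMap.comp_apply, consMap_single]
  exact h _ ⟨C, List.mem_cons_of_mem _ hC, h'⟩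

variable (K) in
/-- Adjoining letters on the left as blocks with one element. -/
noncomputable def prefixMap : List X → (List (List X) →₀ K) →ₗ[K] (List (List X) →₀ K)
  | [] => LinearMap.id
  | c :: A => consMap K [c] ∘ₗ prefixMap A

omit [DecidableEq X] in
theorem prefixMap_single (A : List X) (S : List (List X)) :
    prefixMap K A (Finsupp.single S 1) = Finsupp.single (A.map (fun x => [x]) ++ S) 1 := by
  induction A with
  | nil => rfl
  | cons c A ih => simp [prefixMap, ih]

omit [DecidableEq X] in
theorem VanishesOutside.comp_prefixMap {φ : (List (List X) →₀ K) →ₗ[K] K} {P : Finset X}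
    (h : VanishesOutside φ P) (A : List X) : VanishesOutside (φ ∘ₗ prefixMap K A) P := by
  induction A generalizing φ with
  | nil => exact h
  | cons c A ih => exact ih (h.comp_consMap [c])

-- Merging a letter outside P with its right neighbour creates a block on which φ vanishes. A prefix
-- of such singletons thus contributes only the sign of its length.
omit [DecidableEq X] in
theorem VanishesOutside.barList_prefix {P : Finset X} {D : List X} (hD : D ≠ [])
    (R : List (List X)) (A : List X) {φ : (List (List X) →₀ K) →ₗ[K] K}
    (h : VanishesOutside φ P) (hA : ∀ c ∈ A, c ∉ P) (hn : (A ++ D).Nodup) :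
    φ (barList K (A.map (fun x => [x]) ++ D :: R)) =
      (-1) ^ A.length * φ (prefixMap K A (barList K (D :: R))) := by
  induction A generalizing φ with
  | nil => simp [prefixMap]
  | cons c A ih =>
    have hn' := List.nodup_cons.mp hn
    have h1 : φ (mergeHeadList K [c] (A.map (fun x => [x]) ++ D :: R)) = 0 := by
      have key : ∀ (C : List X) (R' : List (List X)) (d : X), d ∈ C → c ≠ d →
          φ (mergeHeadList K [c] (C :: R')) = 0 := fun C R' d hd hcd =>
        h _ ⟨[c] ++ C, List.mem_cons_self, c, by simp, d, by simp [hd], hcd,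
          hA c List.mem_cons_self⟩
      cases A with
      | nil =>
        obtain ⟨d, hd⟩ := List.exists_mem_of_ne_nil D hD
        exact key D R d hd fun h => hn'.1 (by simp [h, hd])
      | cons d A => exact key [d] _ d (by simp) fun h => hn'.1 (by simp [h])
    have h2 := ih (h.comp_consMap [c]) (fun d hd => hA d (List.mem_cons_of_mem _ hd)) hn'.2
    simp only [LinearMap.comp_apply] at h2
    rw [List.map_cons, List.cons_append, barList, map_sub, h1, h2, List.length_cons, pow_succ,
      prefixMap, LinearMap.comp_apply]
    ring

-- Each merge joins two distinct letters, at least one of them outside P, so every term is killed.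
omit [DecidableEq X] in
theorem VanishesOutside.barList_singletons {P : Finset X} (β : List X)
    {φ : (List (List X) →₀ K) →ₗ[K] K} (h : VanishesOutside φ P) (hn : β.Nodup)
    (hβ : ∀ c ∈ β, ∀ d ∈ β, c ≠ d → c ∉ P ∨ d ∉ P) :
    φ (barList K (β.map fun x => [x])) = 0 := by
  induction β generalizing φ with
  | nil => simp [barList]
  | cons b β ih =>
    have h2 := ih (h.comp_consMap [b]) (List.nodup_cons.mp hn).2 fun c hc d hd =>
      hβ c (List.mem_cons_of_mem _ hc) d (List.mem_cons_of_mem _ hd)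
    simp only [LinearMap.comp_apply] at h2
    rw [List.map_cons, barList, map_sub, h2, sub_zero]
    cases β with
    | nil => simp [mergeHeadList]
    | cons c β =>
      have hbc : b ≠ c := fun h => (List.nodup_cons.mp hn).1 (by simp [h])
      rcases hβ b (by simp) c (by simp) hbc with hb | hc
      · exact h _ ⟨[b] ++ [c], List.mem_cons_self, b, by simp, c, by simp, hbc, hb⟩
      · exact h _ ⟨[b] ++ [c], List.mem_cons_self, c, by simp, b, by simp, hbc.symm, hc⟩

/-- With P equal to I together with `a`, the only merge that can survive joins I to its right
neighbour, and only if this neighbour is `a`. -/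
theorem VanishesOutside.barList_cons_singletons {I : List X} {a : X} (hI : I ≠ []) {β : List X}
    {φ : (List (List X) →₀ K) →ₗ[K] K} (h : VanishesOutside φ (insert a I.toFinset))
    (hn : (I ++ β).Nodup) :
    φ (barList K (I :: β.map fun x => [x])) =
      if β.head? = some a then
        φ (Finsupp.single ((I ++ [a]) :: β.tail.map fun x => [x]) 1) else 0 := by
  obtain ⟨hI', hβ, hd⟩ := List.nodup_append.mp hn
  have hout : ∀ b ∈ β, b ≠ a → b ∉ insert a I.toFinset := fun b hb hba hmem => by
    rcases Finset.mem_insert.mp hmem with hmem | hmem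
    · exact hba hmem
    · exact hd b (List.mem_toFinset.mp hmem) b hb rfl
  have h2 := (h.comp_consMap I).barList_singletons β hβ fun c hc d hd' hcd => by
    by_cases hca : c = a
    · exact Or.inr (hout d hd' fun hda => hcd (hca.trans hda.symm))
    · exact Or.inl (hout c hc hca)
  simp only [LinearMap.comp_apply] at h2
  rw [barList, map_sub, h2, sub_zero]
  cases β with
  | nil => simp [mergeHeadList]
  | cons b β =>
    simp only [List.head?_cons, Option.some.injEq, List.tail_cons, List.map_cons, mergeHeadList]
    split_ifs with hba
    · rw [hba]
    · obtain ⟨d, hd'⟩ := List.exists_mem_of_ne_nil I hI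
      exact h _ ⟨I ++ [b], List.mem_cons_self, b, by simp, d, by simp [hd'],
        fun h => hd d hd' b List.mem_cons_self h.symm, hout b List.mem_cons_self hba⟩

/-- The word of blocks whose only possibly nontrivial block is `I`. -/
def zipWord (α I β : List X) : List (List X) :=
  α.reverse.map (fun x => [x]) ++ I :: β.map fun x => [x]

/-- Only a merge of I with an adjacent `a` survives. The left part α is stored from right to left,
so both neighbours of I are heads. The sign counts the blocks to the left of the merge: `α.length -
1` for a left neighbour and `α.length` for a right one. -/
theorem VanishesOutside.barList_zipWord {I : List X} {a : X} (hI : I ≠ []) {α β : List X}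
    {φ : (List (List X) →₀ K) →ₗ[K] K} (h : VanishesOutside φ (insert a I.toFinset))
    (hn : (α.reverse ++ I ++ β).Nodup) :
    φ (barList K (zipWord α I β)) =
      (if α.head? = some a then
        (-1) ^ (α.length - 1) * φ (Finsupp.single (zipWord α.tail (a :: I) β) 1) else 0) +
      (if β.head? = some a then
        (-1) ^ α.length * φ (Finsupp.single (zipWord α (I ++ [a]) β.tail) 1) else 0) := by
  have hnIβ : (I ++ β).Nodup := by
    rw [List.append_assoc] at hn
    exact (List.nodup_append.mp hn).2.1
  have hnαI : (α.reverse ++ I).Nodup := (List.nodup_append.mp hn).1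
  have hout : ∀ c ∈ α, c ≠ a → c ∉ insert a I.toFinset := fun c hc hca hmem => by
    rcases Finset.mem_insert.mp hmem with hmem | hmem
    · exact hca hmem
    · exact (List.nodup_append.mp hnαI).2.2 c (List.mem_reverse.mpr hc) c
        (List.mem_toFinset.mp hmem) rfl
  by_cases ha : a ∈ α
  · have hβ : β.head? ≠ some a := fun hβ => by
      refine (List.nodup_append.mp hn).2.2 a (by simp [ha]) a ?_ rfl
      cases β with
      | nil => simp at hβ
      | cons b β => simp at hβ; simp [hβ]
    rw [if_neg hβ, add_zero]
    -- The word is cut at the block [a]. The merges strictly to the left and strictly to the right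
    -- of it vanish under φ, so only [a] with its right neighbour is left; it survives exactly when
    -- that neighbour is I, that is, when α₁ is empty.
    obtain ⟨α₁, α₂, rfl⟩ := List.append_of_mem ha
    have hnα : (α₁ ++ a :: α₂).Nodup := by
      have := (List.nodup_append.mp hnαI).1
      rwa [List.nodup_reverse] at this
    have hane : ∀ c ∈ α₁ ++ α₂, c ≠ a := fun c hc hca => by
      subst hca
      rw [List.nodup_middle] at hnα
      exact (List.nodup_cons.mp hnα).1 hc
    have hz : zipWord (α₁ ++ a :: α₂) I β = α₂.reverse.map (fun x => [x]) ++
        [a] :: (α₁.reverse.map (fun x => [x]) ++ I :: β.map fun x => [x]) := by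
      simp [zipWord]
    rw [hz, VanishesOutside.barList_prefix (by simp) _ _ h
      (fun c hc => hout c (by simp at hc; simp [hc]) (hane c (by simp at hc; simp [hc])))
      (by
        have : (α₂.reverse ++ [a]).Sublist (α₁ ++ a :: α₂).reverse := by simp
        exact (List.nodup_reverse.mpr hnα).sublist this)]
    have hrest : (φ ∘ₗ prefixMap K α₂.reverse ∘ₗ consMap K [a]) (barList K
        (α₁.reverse.map (fun x => [x]) ++ I :: β.map fun x => [x])) = 0 := by
      have h' : VanishesOutside (φ ∘ₗ prefixMap K α₂.reverse ∘ₗ consMap K [a])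
          (insert a I.toFinset) := (h.comp_prefixMap α₂.reverse).comp_consMap [a]
      rw [VanishesOutside.barList_prefix hI _ _ h'
        (fun c hc => hout c (by simp at hc; simp [hc]) (hane c (by simp at hc; simp [hc])))
        (hnαI.sublist (by simp))]
      have := (h'.comp_prefixMap α₁.reverse).barList_cons_singletons hI hnIβ
      rw [if_neg hβ] at this
      simp only [LinearMap.comp_apply] at this ⊢
      rw [this, mul_zero]
    simp only [LinearMap.comp_apply] at hrest
    rw [barList, map_sub, map_sub, hrest, sub_zero]
    cases α₁ with
    | nil => simp [mergeHeadList, prefixMap_single, zipWord]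
    | cons c α₁ =>
      have hca : c ≠ a := hane c (by simp)
      rw [if_neg (by simpa using hca)]
      obtain ⟨d, hd, R, hR⟩ : ∃ d ∈ c :: α₁, ∃ R, (c :: α₁).reverse.map (fun x => [x]) ++
          I :: β.map (fun x => [x]) = [d] :: R := by
        cases hr : (c :: α₁).reverse with
        | nil => simp at hr
        | cons d R =>
          refine ⟨d, ?_, _, rfl⟩
          rw [← List.mem_reverse, hr]
          exact List.mem_cons_self
      rw [hR, mergeHeadList]
      have hda := hane d (List.mem_append_left _ hd)
      have := h.comp_prefixMap α₂.reverse (([a] ++ [d]) :: R) ⟨_, List.mem_cons_self, d, by simp,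
        a, by simp, hda, hout d (List.mem_append_left _ hd) hda⟩
      rw [LinearMap.comp_apply] at this
      rw [this, mul_zero]
  · have hα : α.head? ≠ some a := fun hα => by
      cases α with
      | nil => simp at hα
      | cons b α => simp at hα; simp [hα] at ha
    rw [if_neg hα, zero_add, zipWord, VanishesOutside.barList_prefix hI _ _ h
      (fun c hc => hout c (List.mem_reverse.mp hc)
        fun h => ha (h ▸ List.mem_reverse.mp hc)) hnαI]
    have := (h.comp_prefixMap α.reverse).barList_cons_singletons hI hnIβ
    simp only [LinearMap.comp_apply] at this
    rw [this]
    split_ifs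
    · rw [prefixMap_single, List.length_reverse]
      rfl
    · rw [mul_zero]

theorem wordPartition_zipWord (α I β : List X) :
    wordPartition (zipWord α I β) = blockSetoid I.toFinset := by
  refine eq_of_forall_ge_iff fun a => ?_
  rw [wordPartition_le_iff, blockSetoid_le_iff]
  constructor
  · intro h i hi j hj
    exact h I (by simp [zipWord]) i (List.mem_toFinset.mp hi) j (List.mem_toFinset.mp hj)
  · intro h B hB i hi j hj
    simp only [zipWord, List.mem_append, List.mem_map, List.mem_cons] at hB
    rcases hB with ⟨x, -, rfl⟩ | rfl | ⟨x, -, rfl⟩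
    · rw [List.mem_singleton.mp hi, List.mem_singleton.mp hj]
    · exact h i (List.mem_toFinset.mpr hi) j (List.mem_toFinset.mpr hj)
    · rw [List.mem_singleton.mp hi, List.mem_singleton.mp hj]

/-- The coefficients of the fundamental cycles at the chains `mergeList u J`. -/
theorem fund_zipWord_mergeList (n : ℕ) : ∀ {u α I β : List X} (_ : I ≠ [])
    (_ : (α.reverse ++ I ++ β).Nodup) (_ : u.Nodup) (_ : ∀ a ∈ u, a ∉ I) (_ : u.length = n + 1)
    (_ : u.length = α.length + β.length) (_ : ∀ a ∈ α ++ β, a ∈ u),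
    fund K n (zipWord α I β) (mergeList u I.toFinset) =
      zipCoeff (fun m => (-1) ^ m) (fun m => (-1) ^ m) u α β := by
  induction n with
  | zero =>
    intro u α I β hI hn hun hu hl hl' hmem
    obtain ⟨a, rfl⟩ := List.length_eq_one_iff.mp hl
    -- The last merge is left out of `mergeList`, so a single remaining letter corresponds to the
    -- empty list.
    have h1 : fund K 0 (zipWord α I β) (mergeList [a] I.toFinset) = 1 := by
      simp [fund, mergeList]
    rw [h1]
    match α, β, hl', hmem with
    | [b], [], _, hmem =>
      have : b = a := by simpa using hmem
      simp [zipCoeff, this]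
    | [], [b], _, hmem =>
      have : b = a := by simpa using hmem
      simp [zipCoeff, this]
    | [], [], h, _ => simp at h
    | [], _ :: _ :: _, h, _ => simp at h
    | _ :: _ :: _, [], h, _ => simp at h
    | _ :: _, _ :: _, h, _ => simp at h; omega
  | succ n ih =>
    classical
    intro u α I β hI hn hun hu hl hl' hmem
    match u, hl with
    | a :: b :: u, hl =>
    set x := blockSetoid (insert a I.toFinset) with hx
    set l := mergeList (b :: u) (insert a I.toFinset) with hlst
    -- φ reads off the coefficient of `x :: l`. It sees only the merges whose partition is x, that
    -- is, whose only nontrivial block is I together with a.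
    let φ : (List (List X) →₀ K) →ₗ[K] K := Finsupp.lapply l ∘ₗ tailAt K x ∘ₗ
      Finsupp.linearCombination K (fun S => consMap K (wordPartition S) (fund K n S))
    have hφ : ∀ S, φ (Finsupp.single S 1) = if wordPartition S = x then fund K n S l else 0 := by
      intro S
      simp only [φ, LinearMap.comp_apply, Finsupp.linearCombination_single, one_smul]
      split_ifs with h
      · rw [h, tailAt_consMap_self]
        rfl
      · rw [tailAt_consMap_of_ne (Ne.symm h), map_zero]
    have hv : VanishesOutside φ (insert a I.toFinset) := by
      rintro S ⟨B, hB, c, hc, d, hd, hcd, hcP⟩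
      rw [hφ, if_neg]
      intro h
      have := wordPartition_rel hB hc hd
      rw [h] at this
      exact this.elim hcd fun h => hcP h.1
    have haI : a ∉ I := hu a (by simp)
    have hcoef : fund K (n + 1) (zipWord α I β) (mergeList (a :: b :: u) I.toFinset) =
        φ (barList K (zipWord α I β)) := rfl
    rw [hcoef, hv.barList_zipWord hI hn, zipCoeff]
    have hab := List.nodup_cons.mp hun
    have hu' : ∀ c ∈ b :: u, c ∉ insert a I.toFinset := fun c hc hc' => by
      rcases Finset.mem_insert.mp hc' with rfl | hc'
      · exact hab.1 hc
      · exact hu c (List.mem_cons_of_mem _ hc) (List.mem_toFinset.mp hc')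
    have hrec : ∀ α' I' β', I'.toFinset = insert a I.toFinset → I' ≠ [] →
        (α'.reverse ++ I' ++ β').Nodup → (b :: u).length = α'.length + β'.length →
        (∀ c ∈ α' ++ β', c ∈ α ++ β) → φ (Finsupp.single (zipWord α' I' β') 1) =
          zipCoeff (fun m => (-1) ^ m) (fun m => (-1) ^ m) (b :: u) α' β' := by
      intro α' I' β' hI' hne hn' hlen hmem'
      rw [hφ, wordPartition_zipWord, if_pos (by rw [hI']), hlst, ← hI']
      refine ih hne hn' hab.2 (fun c hc hc' => hu' c hc ?_) (by simpa using hl) hlen ?_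
      · rw [← hI']
        exact List.mem_toFinset.mpr hc'
      · intro c hc
        refine (List.mem_cons.mp (hmem c (hmem' c hc))).resolve_left ?_
        rintro rfl
        have hcI : c ∈ I' := by
          rw [← List.mem_toFinset, hI']
          exact Finset.mem_insert_self _ _
        rcases List.mem_append.mp hc with hc | hc
        · exact (List.nodup_append.mp (List.nodup_append.mp hn').1).2.2 c
            (List.mem_reverse.mpr hc) c hcI rfl
        · exact (List.nodup_append.mp hn').2.2 c (List.mem_append_right _ hcI) c hc rfl
    congr 1
    · cases α with
      | nil => simp
      | cons c α =>
        by_cases hc : c = a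
        · subst hc
          rw [List.head?_cons, if_pos rfl, if_pos rfl, hrec _ _ _ (by simp) (by simp) (by simpa using hn)
            (by simp at hl' ⊢; omega) (by
              intro d hd
              rw [List.tail_cons] at hd
              simp at hd ⊢
              tauto)]
        · rw [if_neg (by simpa using hc), if_neg (by simpa using hc)]
    · cases β with
      | nil => simp
      | cons c β =>
        by_cases hc : c = a
        · subst hc
          rw [List.head?_cons, if_pos rfl, if_pos rfl, hrec _ _ _ (by ext; simp) (by simp)
            (by simpa using hn) (by simp at hl' ⊢; omega) (by
              intro d hd
              rw [List.tail_cons] at hd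
              simp at hd ⊢
              tauto)]
        · rw [if_neg (by simpa using hc), if_neg (by simpa using hc)]

end ListChain

/-! ### Right-normed brackets -/

section NestedBracket

variable {X L L' : Type*} [LieRing L] [LieRing L']

/-- The right-normed bracket `⁅x aₙ, ⁅…, ⁅x a₁, y⁆⁆⁆`. -/
def nestedBracket (x : X → L) : List X → L → L
  | [], y => y
  | a :: u, y => nestedBracket x u ⁅x a, y⁆

theorem nestedBracket_append (x : X → L) (u v : List X) (y : L) :
    nestedBracket x (u ++ v) y = nestedBracket x v (nestedBracket x u y) := by
  induction u generalizing y with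
  | nil => rfl
  | cons a u ih => exact ih _

theorem nestedBracket_sub (x : X → L) (u : List X) (y y' : L) :
    nestedBracket x u (y - y') = nestedBracket x u y - nestedBracket x u y' := by
  induction u generalizing y y' with
  | nil => rfl
  | cons a u ih => rw [nestedBracket, lie_sub, ih]; rfl

theorem map_nestedBracket {R : Type*} [CommRing R] [LieAlgebra R L] [LieAlgebra R L']
    (f : L →ₗ⁅R⁆ L') (x : X → L) (u : List X) (y : L) :
    f (nestedBracket x u y) = nestedBracket (fun a => f (x a)) u (f y) := by
  induction u generalizing y with
  | nil => rfl
  | cons a u ih => rw [nestedBracket, ih, LieHom.map_lie]; rfl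

end NestedBracket

namespace LieWord

open ListChain

variable (K : Type) [CommRing K]

/-! ### Right-normed brackets span the multilinear part -/

section Span

variable {r : ℕ}

/-- The right-normed brackets in the free Lie algebra. -/
noncomputable def nest (u : List (Fin r)) (y : FreeLieAlgebra K (Fin r)) :
    FreeLieAlgebra K (Fin r) :=
  nestedBracket (FreeLieAlgebra.of K) u y

/-- By the Jacobi identity, the adjoint action of [b, c] is the commutator of those of b and c. So
the adjoint action of a monomial is a combination of iterated brackets with letters, of the same
weight. -/
theorem lie_lieMonomial_mem (m : FreeMagma (Fin r)) (y : FreeLieAlgebra K (Fin r)) :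
    ⁅lieMonomial K m, y⁆ ∈ Submodule.span K
      ((fun u => nest K u y) '' {u | ∀ i, u.count i = lieWeight m i}) := by
  induction m using FreeMagma.rec generalizing y with
  | of i =>
    refine Submodule.subset_span ⟨[i], fun j => ?_, rfl⟩
    simp only [lieWeight, Pi.single_apply, List.count_singleton, beq_iff_eq]
    simp only [eq_comm]
  | mul b c hb hc =>
    have key : ∀ (b c : FreeMagma (Fin r)),
        (∀ y, ⁅lieMonomial K b, y⁆ ∈ Submodule.span K
          ((fun u => nest K u y) '' {u | ∀ i, u.count i = lieWeight b i})) →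
        (∀ y, ⁅lieMonomial K c, y⁆ ∈ Submodule.span K
          ((fun u => nest K u y) '' {u | ∀ i, u.count i = lieWeight c i})) →
        ⁅lieMonomial K b, ⁅lieMonomial K c, y⁆⁆ ∈ Submodule.span K
          ((fun u => nest K u y) '' {u | ∀ i, u.count i = lieWeight b i + lieWeight c i}) := by
      intro b c hb hc
      have h := Submodule.mem_map_of_mem
        (f := (LieAlgebra.ad K (FreeLieAlgebra K (Fin r)) (lieMonomial K b))) (hc y)
      rw [Submodule.map_span] at h
      refine Submodule.span_le.mpr ?_ h
      rintro _ ⟨_, ⟨u, hu, rfl⟩, rfl⟩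
      refine Submodule.span_mono ?_ (hb (nest K u y))
      rintro _ ⟨v, hv, rfl⟩
      refine ⟨u ++ v, fun i => ?_, nestedBracket_append _ _ _ _⟩
      rw [List.count_append, hu i, hv i, add_comm]
    have h1 := key b c hb hc
    have h2 := key c b hc hb
    have h3 : ⁅lieMonomial K (FreeMagma.mul b c), y⁆ =
        ⁅lieMonomial K b, ⁅lieMonomial K c, y⁆⁆ - ⁅lieMonomial K c, ⁅lieMonomial K b, y⁆⁆ :=
      lie_lie _ _ _
    have h4 : ∀ i, lieWeight (FreeMagma.mul b c) i = lieWeight b i + lieWeight c i := fun _ => rfl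
    refine h3 ▸ Submodule.sub_mem _ ?_ ?_
    · simpa only [h4] using h1
    · simpa only [h4, add_comm] using h2

/-- Since t occurs once, exactly one factor of a bracket contains it. Antisymmetry makes this the
right factor; it is rewritten by induction, and then the adjoint action of the other factor is
expanded into letters. -/
theorem lieMonomial_mem (t : Fin r) (m : FreeMagma (Fin r)) (hm : lieWeight m t = 1) :
    lieMonomial K m ∈ Submodule.span K ((fun u => nest K u (FreeLieAlgebra.of K t)) ''
      {u | ∀ i, u.count i + (if i = t then 1 else 0) = lieWeight m i}) := by
  induction m using FreeMagma.rec with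
  | of i =>
    have hit : i = t := by
      by_contra h
      simp [lieWeight, Ne.symm h] at hm
    subst hit
    refine Submodule.subset_span ⟨[], fun j => ?_, rfl⟩
    simp [lieWeight, Pi.single_apply]
  | mul b c hb hc =>
    have key : ∀ (b c : FreeMagma (Fin r)),
        lieMonomial K c ∈ Submodule.span K ((fun u => nest K u (FreeLieAlgebra.of K t)) ''
          {u | ∀ i, u.count i + (if i = t then 1 else 0) = lieWeight c i}) →
        ⁅lieMonomial K b, lieMonomial K c⁆ ∈ Submodule.span K
          ((fun u => nest K u (FreeLieAlgebra.of K t)) ''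
            {u | ∀ i, u.count i + (if i = t then 1 else 0) = lieWeight b i + lieWeight c i}) := by
      intro b c hc
      have h := Submodule.mem_map_of_mem
        (f := (LieAlgebra.ad K (FreeLieAlgebra K (Fin r)) (lieMonomial K b))) hc
      rw [Submodule.map_span] at h
      refine Submodule.span_le.mpr ?_ h
      rintro _ ⟨_, ⟨u, hu, rfl⟩, rfl⟩
      refine Submodule.span_mono ?_ (lie_lieMonomial_mem K b (nest K u (FreeLieAlgebra.of K t)))
      rintro _ ⟨v, hv, rfl⟩
      refine ⟨u ++ v, fun i => ?_, nestedBracket_append _ _ _ _⟩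
      rw [List.count_append, ← hu i, hv i]
      ring
    have h4 : ∀ i, lieWeight (FreeMagma.mul b c) i = lieWeight b i + lieWeight c i := fun _ => rfl
    rw [h4] at hm
    by_cases hct : lieWeight c t = 1
    · exact key b c (hc hct)
    · have h5 : lieMonomial K (FreeMagma.mul b c) = -⁅lieMonomial K c, lieMonomial K b⁆ :=
        (lie_skew _ _).symm
      rw [h5]
      refine Submodule.neg_mem _ ?_
      simpa only [h4, add_comm] using key c b (hb (by omega))

theorem nest_eq_lieMonomial (u : List (Fin r)) (m : FreeMagma (Fin r)) :
    ∃ m', nest K u (lieMonomial K m) = lieMonomial K m' ∧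
      ∀ i, lieWeight m' i = u.count i + lieWeight m i := by
  induction u generalizing m with
  | nil => exact ⟨m, rfl, by simp⟩
  | cons a u ih =>
    obtain ⟨m', h1, h2⟩ := ih (FreeMagma.mul (FreeMagma.of a) m)
    refine ⟨m', h1, fun i => ?_⟩
    rw [h2]
    change _ + ((Pi.single a 1 : Fin r → ℕ) i + lieWeight m i) = _
    rw [List.count_cons, Pi.single_apply, add_assoc]
    simp only [beq_iff_eq, eq_comm (a := i)]

/-- The arrangements of the letters distinct from `t`. -/
def Arrangement (t : Fin r) : Set (List (Fin r)) := {u | u.Nodup ∧ ∀ a, a ∈ u ↔ a ≠ t}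

theorem count_arrangement {t : Fin r} {u : List (Fin r)} :
    u ∈ Arrangement t ↔ ∀ i, u.count i + (if i = t then 1 else 0) = 1 := by
  constructor
  · rintro ⟨h1, h2⟩ i
    by_cases hi : i = t
    · rw [if_pos hi, List.count_eq_zero_of_not_mem (fun h => (h2 i).mp h hi)]
    · rw [if_neg hi, List.count_eq_one_of_mem h1 ((h2 i).mpr hi)]
  · intro h
    refine ⟨List.nodup_iff_count_le_one.mpr fun a => ?_, fun a => ?_⟩
    · have := h a
      omega
    · rw [← List.count_pos_iff]
      have := h a
      split_ifs at this with hat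
      · simp only [hat, ne_eq, not_true_eq_false, iff_false]
        rw [hat] at this
        omega
      · simp only [ne_eq, hat, not_false_eq_true, iff_true]
        omega

theorem nest_mem_lieComponent {t : Fin r} {u : List (Fin r)} (hu : u ∈ Arrangement t) :
    nest K u (FreeLieAlgebra.of K t) ∈ lieComponent K r := by
  obtain ⟨m, h1, h2⟩ := nest_eq_lieMonomial K u (FreeMagma.of t)
  refine Submodule.subset_span ⟨m, ?_, h1.symm⟩
  funext i
  rw [h2, Pi.one_apply, ← count_arrangement.mp hu i, lieWeight, Pi.single_apply]

theorem lieComponent_le_span (t : Fin r) : lieComponent K r ≤ Submodule.span K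
    ((fun u => nest K u (FreeLieAlgebra.of K t)) '' Arrangement t) := by
  refine Submodule.span_le.mpr ?_
  rintro _ ⟨m, hm, rfl⟩
  have hm' : lieWeight m = 1 := hm
  have := lieMonomial_mem K t m (by rw [hm']; rfl)
  refine Submodule.span_mono (Set.image_mono fun u hu => count_arrangement.mpr fun i => ?_) this
  rw [hu i, hm']
  rfl

/-- Linear forms on the Lie operad which agree on the right-normed brackets are equal. -/
theorem lieComponent_dual_ext (t : Fin r) {f g : Module.Dual K (lieComponent K r)}
    (h : ∀ (u : List (Fin r)) (hu : u ∈ Arrangement t),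
      f ⟨_, nest_mem_lieComponent K hu⟩ = g ⟨_, nest_mem_lieComponent K hu⟩) : f = g := by
  ext ⟨x, hx⟩
  have key : ∀ y ∈ Submodule.span K ((fun u => nest K u (FreeLieAlgebra.of K t)) '' Arrangement t),
      ∀ hy : y ∈ lieComponent K r, f ⟨y, hy⟩ = g ⟨y, hy⟩ := by
    have hle : Submodule.span K ((fun u => nest K u (FreeLieAlgebra.of K t)) '' Arrangement t) ≤
        lieComponent K r := by
      refine Submodule.span_le.mpr ?_
      rintro _ ⟨u, hu, rfl⟩
      exact nest_mem_lieComponent K hu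
    intro y hy
    induction hy using Submodule.span_induction with
    | mem y hy =>
      obtain ⟨u, hu, rfl⟩ := hy
      exact fun _ => h u hu
    | zero => exact fun hy => (map_zero f).trans (map_zero g).symm
    | add a b ha hb iha ihb =>
      intro hy
      have e : (⟨a + b, hy⟩ : lieComponent K r) = ⟨a, hle ha⟩ + ⟨b, hle hb⟩ := rfl
      rw [e, map_add, map_add, iha, ihb]
    | smul c a ha iha =>
      intro hy
      have e : (⟨c • a, hy⟩ : lieComponent K r) = c • ⟨a, hle ha⟩ := rfl
      rw [e, map_smul, map_smul, iha]
  exact key x (lieComponent_le_span K t hx) hx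

end Span

/-! ### Coefficients of words -/

attribute [local instance] LieRing.ofAssociativeRing

section Words

variable {X : Type}

/-- A word in the free associative algebra. -/
noncomputable def word (l : List X) : MonoidAlgebra K (FreeMonoid X) :=
  MonoidAlgebra.single (FreeMonoid.ofList l) 1

/-- The coefficient of a word, for elements of the free associative algebra. -/
noncomputable def wordCoeff (l : List X) : MonoidAlgebra K (FreeMonoid X) →ₗ[K] K where
  toFun z := z.coeff (FreeMonoid.ofList l)
  map_add' _ _ := by simp
  map_smul' _ _ := by simp

theorem wordCoeff_word [DecidableEq X] (l l' : List X) :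
    wordCoeff K l (word K l') = if l' = l then 1 else 0 := by
  change (MonoidAlgebra.single (FreeMonoid.ofList l') (1 : K)).coeff (FreeMonoid.ofList l) = _
  rw [MonoidAlgebra.coeff_single]
  split_ifs with h
  · rw [h, Finsupp.single_eq_same]
  · exact Finsupp.single_eq_of_ne (fun h' => h (FreeMonoid.ofList.injective h').symm)

theorem lie_word (l l' : List X) :
    ⁅word K l, word K l'⁆ = word K (l ++ l') - word K (l' ++ l) := by
  simp [LieRing.of_associative_ring_bracket, word, MonoidAlgebra.single_mul_single]

theorem nestedBracket_word_cons (u p : List X) (a : X) :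
    nestedBracket (fun a => word K [a]) (a :: u) (word K p) =
      nestedBracket (fun a => word K [a]) u (word K (a :: p)) -
        nestedBracket (fun a => word K [a]) u (word K (p ++ [a])) := by
  rw [nestedBracket, lie_word, nestedBracket_sub]
  rfl

variable {K}

/-- Bracketing with a letter only attaches it at one end, so p survives as a factor, preceded by
letters of u. -/
theorem wordCoeff_nestedBracket_eq_zero (u p l : List X)
    (h : ∀ γ δ, (∀ c ∈ γ, c ∈ u) → l ≠ γ ++ p ++ δ) :
    wordCoeff K l (nestedBracket (fun a => word K [a]) u (word K p)) = 0 := by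
  classical
  induction u generalizing p with
  | nil =>
    rw [nestedBracket, wordCoeff_word, if_neg]
    rintro rfl
    exact h [] [] (by simp) (by simp)
  | cons a u ih =>
    rw [nestedBracket_word_cons, map_sub, ih, ih, sub_zero]
    · rintro γ δ hγ rfl
      exact h γ (a :: δ) (fun c hc => List.mem_cons_of_mem _ (hγ c hc)) (by simp)
    · rintro γ δ hγ rfl
      refine h (γ ++ [a]) δ (fun c hc => ?_) (by simp)
      rcases List.mem_append.mp hc with hc | hc
      · exact List.mem_cons_of_mem _ (hγ c hc)
      · simp at hc
        simp [hc]

/-- Bracketing with `a` puts it on the left with sign + or on the right with sign −; which of the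
two can contribute is decided by the letter next to the current factor. The induction needs a
general factor p₁ t p₂ in place of the single letter t. -/
theorem wordCoeff_nestedBracket [DecidableEq X] (t : X) (u : List X) (hu : t ∉ u)
    (p₁ p₂ α β : List X) (hp : t ∉ p₁) (hα : t ∉ α) :
    wordCoeff K (α.reverse ++ (p₁ ++ t :: p₂) ++ β)
      (nestedBracket (fun a => word K [a]) u (word K (p₁ ++ t :: p₂))) =
        zipCoeff (fun _ => 1) (fun _ => -1) u α β := by
  -- The first occurrence of t fixes the position of the factor inside the word.
  have inj : ∀ {x₁ x₂ z₁ z₂ : List X}, t ∉ x₁ → t ∉ x₂ → x₁ ++ t :: z₁ = x₂ ++ t :: z₂ →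
      x₁ = x₂ ∧ z₁ = z₂ := by
    intro x₁ x₂ z₁ z₂ h1 h2 h
    have h' := congrArg (List.takeWhile (fun x => x ≠ t)) h
    have e : ∀ {x z : List X}, t ∉ x → (x ++ t :: z).takeWhile (fun x => x ≠ t) = x := by
      intro x z hx
      rw [List.takeWhile_append_of_pos]
      · simp
      · intro a ha
        simp only [ne_eq, decide_not, Bool.not_eq_eq_eq_not, Bool.not_true, decide_eq_false_iff_not]
        rintro rfl
        exact hx ha
    rw [e h1, e h2] at h'
    subst h'
    simpa using h
  induction u generalizing p₁ p₂ α β with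
  | nil =>
    rw [nestedBracket, wordCoeff_word, zipCoeff]
    congr 1
    apply propext
    constructor
    · intro h
      have h2 := congrArg List.length h
      simp only [List.length_append, List.length_reverse] at h2
      exact ⟨List.length_eq_zero_iff.mp (by omega), List.length_eq_zero_iff.mp (by omega)⟩
    · rintro ⟨rfl, rfl⟩
      simp
  | cons a u ih =>
    have hau : t ≠ a ∧ t ∉ u := by simpa using hu
    rw [nestedBracket_word_cons, map_sub, zipCoeff, sub_eq_add_neg]
    congr 1
    · split_ifs with hhead
      · obtain ⟨α', rfl⟩ : ∃ α', α = a :: α' := by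
          cases α with
          | nil => simp at hhead
          | cons c α => exact ⟨α, by simp at hhead; rw [hhead]⟩
        have := ih hau.2 (a :: p₁) p₂ α' β (by simp [hau.1, hp])
          (fun h => hα (List.mem_cons_of_mem _ h))
        simpa using this
      · refine wordCoeff_nestedBracket_eq_zero u _ _ fun γ δ hγ h => hhead ?_
        have h' : (α.reverse ++ p₁) ++ t :: (p₂ ++ β) = (γ ++ a :: p₁) ++ t :: (p₂ ++ δ) := by
          simpa using h
        have hγt : t ∉ γ := fun h => hau.2 (hγ t h)
        have h1 := (inj (by simp [hα, hp]) (by simp [hγt, hau.1, hp]) h').1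
        have h2 : α.reverse = γ ++ [a] := by
          have : α.reverse ++ p₁ = (γ ++ [a]) ++ p₁ := by simpa using h1
          exact List.append_cancel_right this
        have h3 : α = a :: γ.reverse := by
          have := congrArg List.reverse h2
          simpa using this
        rw [h3]
        rfl
    · split_ifs with hhead
      · obtain ⟨β', rfl⟩ : ∃ β', β = a :: β' := by
          cases β with
          | nil => simp at hhead
          | cons c β => exact ⟨β, by simp at hhead; rw [hhead]⟩
        have := ih hau.2 p₁ (p₂ ++ [a]) α β' hp hα
        simpa using this
      · rw [neg_eq_zero]
        refine wordCoeff_nestedBracket_eq_zero u _ _ fun γ δ hγ h => hhead ?_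
        have h' : (α.reverse ++ p₁) ++ t :: (p₂ ++ β) = (γ ++ p₁) ++ t :: (p₂ ++ a :: δ) := by
          simpa using h
        have hγt : t ∉ γ := fun h => hau.2 (hγ t h)
        have h1 := (inj (by simp [hα, hp]) (by simp [hγt, hp]) h').2
        rw [List.append_cancel_left h1]
        rfl

end Words

section Assoc

variable {r : ℕ}

/-- The canonical map from the free Lie algebra to the free associative algebra. -/
noncomputable def toAssoc :
    FreeLieAlgebra K (Fin r) →ₗ⁅K⁆ MonoidAlgebra K (FreeMonoid (Fin r)) :=
  FreeLieAlgebra.lift K fun a => word K [a]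

theorem toAssoc_nest (u : List (Fin r)) (t : Fin r) :
    toAssoc K (nest K u (FreeLieAlgebra.of K t)) =
      nestedBracket (fun a => word K [a]) u (word K [t]) := by
  rw [nest, map_nestedBracket]
  simp [toAssoc]

theorem wordCoeff_toAssoc_perm (w : Equiv.Perm (Fin r)) (l : List (Fin r))
    (x : FreeLieAlgebra K (Fin r)) :
    wordCoeff K (l.map w) (toAssoc K (freeLiePermRep K r w x)) =
      wordCoeff K l (toAssoc K x) := by
  let φ : MonoidAlgebra K (FreeMonoid (Fin r)) →ₐ[K] MonoidAlgebra K (FreeMonoid (Fin r)) :=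
    MonoidAlgebra.mapDomainAlgHom K K (FreeMonoid.map w)
  have h : (toAssoc K).comp (FreeLieAlgebra.lift K fun i => FreeLieAlgebra.of K (w i)) =
      φ.toLieHom.comp (toAssoc K) := by
    ext i : 1
    simp [toAssoc, φ, word, MonoidAlgebra.mapDomain_single]
  have h1 : toAssoc K (freeLiePermRep K r w x) = φ (toAssoc K x) := LieHom.congr_fun h x
  rw [h1]
  have h2 : ∀ y : MonoidAlgebra K (FreeMonoid (Fin r)),
      wordCoeff K (l.map w) (φ y) = wordCoeff K l y := by
    intro y
    have inj : Function.Injective (FreeMonoid.map w : FreeMonoid (Fin r) → _) :=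
      List.map_injective_iff.mpr w.injective
    exact Finsupp.mapDomain_apply inj y.coeff (FreeMonoid.ofList l)
  exact h2 _

/-- The linear form on the Lie operad given by the coefficient of a word. -/
noncomputable def lieWordCoeff (l : List (Fin r)) : Module.Dual K (lieComponent K r) :=
  wordCoeff K l ∘ₗ (toAssoc K).toLinearMap ∘ₗ (lieComponent K r).subtype

theorem lieWordCoeff_nest {t : Fin r} {u : List (Fin r)} (hu : u ∈ Arrangement t)
    (α β : List (Fin r)) (hα : t ∉ α) :
    lieWordCoeff K (α.reverse ++ t :: β) ⟨_, nest_mem_lieComponent K hu⟩ =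
      zipCoeff (fun _ => 1) (fun _ => -1) u α β := by
  have h := wordCoeff_nestedBracket (K := K) t u (fun h => (hu.2 t).mp h rfl) [] [] α β (by simp) hα
  rw [← h]
  change wordCoeff K _ (toAssoc K (nest K u (FreeLieAlgebra.of K t))) = _
  rw [toAssoc_nest]
  simp

theorem dual_lieWordCoeff (w : Equiv.Perm (Fin r)) (l : List (Fin r)) :
    (lieRep K r).dual w (lieWordCoeff K l) = lieWordCoeff K (l.map w) := by
  ext x
  have h := wordCoeff_toAssoc_perm K w l (freeLiePermRep K r w⁻¹ x)
  have h2 : freeLiePermRep K r w (freeLiePermRep K r w⁻¹ (x : FreeLieAlgebra K (Fin r))) = x := by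
    rw [← Module.End.mul_apply, ← map_mul, mul_inv_cancel, map_one]
    rfl
  rw [h2] at h
  exact h.symm

end Assoc

end LieWord

/-! ### The sign of a word -/

namespace LieWord

open ListChain

variable {X : Type} [LinearOrder X]

/-- The sign of a word: the parity of its number of inversions. -/
def wordSign : List X → ℤ
  | [] => 1
  | a :: l => (-1) ^ (l.countP (· < a)) * wordSign l

theorem wordSign_middle (l₁ l₂ : List X) (a : X) :
    wordSign (l₁ ++ a :: l₂) =
      (-1) ^ (l₁.countP (a < ·) + l₂.countP (· < a)) * wordSign (l₁ ++ l₂) := by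
  induction l₁ with
  | nil => simp [wordSign]
  | cons b l ih =>
    rw [List.cons_append, wordSign, ih, List.cons_append, wordSign, List.countP_append,
      List.countP_cons, List.countP_append, List.countP_cons]
    simp only [decide_eq_true_eq, pow_add]
    ring

theorem countP_lt_add_countP_gt {l : List X} {a : X} (h : a ∉ l) :
    l.countP (a < ·) + l.countP (· < a) = l.length := by
  induction l with
  | nil => rfl
  | cons b l ih =>
    simp only [List.mem_cons, not_or] at h
    rw [List.countP_cons, List.countP_cons, List.length_cons, ← ih h.2]
    rcases lt_or_gt_of_ne h.1 with hlt | hlt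
    · simp [hlt, hlt.not_gt]
      ring
    · simp [hlt, hlt.not_gt]
      ring

/-- The sign relating the Lie coefficients to the coefficients of the fundamental cycles. -/
def arrangementSign (t : X) : List X → ℤ
  | [] => 1
  | a :: u => (-1) ^ ((t :: u).countP (· < a)) * arrangementSign t u

theorem arrangementSign_mul_self (t : X) (u : List X) :
    arrangementSign t u * arrangementSign t u = 1 := by
  induction u with
  | nil => rfl
  | cons a u ih =>
    rw [arrangementSign, mul_mul_mul_comm, ih, ← pow_add, ← two_mul]
    simp

/-- Let N be the number of letters of `t :: u` smaller than the next letter `a`. Up to parity,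
removing `a` from just left of t destroys `α.length - 1 + N` inversions, and from just right of t it
destroys `α.length + 1 + N`. Multiplied by the Lie signs 1 and −1, these give the bar signs with
exponents `α.length - 1` and `α.length`. The common factor (−1)^N depends only on the arrangement
and is collected in `arrangementSign`. -/
theorem wordSign_mul_zipCoeff (K : Type) [CommRing K] (t : X) (u α β : List X)
    (hn : (t :: u).Nodup) (hp : (α.reverse ++ t :: β).Perm (t :: u)) :
    (wordSign (α.reverse ++ t :: β) : K) * zipCoeff (fun _ => (1 : K)) (fun _ => -1) u α β =
      arrangementSign t u * zipCoeff (fun m => (-1 : K) ^ m) (fun m => (-1) ^ m) u α β := by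
  induction u generalizing α β with
  | nil =>
    have h : (α.reverse ++ t :: β) = [t] := List.perm_singleton.mp hp
    have h' := congrArg List.length h
    simp only [List.length_append, List.length_reverse, List.length_cons, List.length_nil] at h'
    obtain rfl : α = [] := List.length_eq_zero_iff.mp (by omega)
    obtain rfl : β = [] := List.length_eq_zero_iff.mp (by omega)
    simp [zipCoeff, wordSign, arrangementSign]
  | cons a u ih =>
    have hn' : (t :: u).Nodup ∧ a ∉ t :: u := by
      simp only [List.nodup_cons, List.mem_cons, not_or] at hn ⊢
      exact ⟨⟨hn.1.2, hn.2.2⟩, Ne.symm hn.1.1, hn.2.1⟩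
    have hswap : (t :: a :: u).Perm (a :: t :: u) := List.Perm.swap _ _ _
    rw [zipCoeff, zipCoeff, mul_add, mul_add]
    congr 1
    · cases α with
      | nil => simp
      | cons c α =>
        by_cases hc : c = a
        swap
        · rw [if_neg (by simpa using hc), if_neg (by simpa using hc), mul_zero, mul_zero]
        subst hc
        have hperm : (α.reverse ++ t :: β).Perm (t :: u) := by
          have h1 : ((c :: α).reverse ++ t :: β).Perm (c :: (α.reverse ++ t :: β)) := by
            simp only [List.reverse_cons, List.append_assoc, List.singleton_append]
            exact List.perm_middle
          exact (h1.symm.trans (hp.trans hswap)).cons_inv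
        have hcα : c ∉ α.reverse := fun h => hn'.2 (hperm.subset (List.mem_append_left _ h))
        have h1 := wordSign_middle α.reverse (t :: β) c
        have h2 := countP_lt_add_countP_gt hcα
        have h3 := hperm.countP_eq (fun x => decide (x < c))
        rw [List.countP_append] at h3
        have h4 : wordSign ((c :: α).reverse ++ t :: β) =
            (-1) ^ α.length * (-1) ^ ((t :: u).countP (· < c)) *
              wordSign (α.reverse ++ t :: β) := by
          rw [List.reverse_cons, List.append_assoc, List.singleton_append, h1, ← h3,
            ← List.length_reverse, ← h2]
          simp only [pow_add]
          have : ((-1 : ℤ) ^ (α.reverse.countP (· < c))) * (-1) ^ (α.reverse.countP (· < c)) = 1 := by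
            rw [← pow_add, ← two_mul]
            simp
          linear_combination (-(-1 : ℤ) ^ (α.reverse.countP (c < ·)) *
            (-1) ^ ((t :: β).countP (· < c)) * wordSign (α.reverse ++ t :: β)) * this
        have := ih α β hn'.1 hperm
        rw [h4, List.head?_cons, if_pos rfl, if_pos rfl, arrangementSign, List.tail_cons,
          List.length_cons, Nat.add_sub_cancel]
        push_cast
        linear_combination ((-1 : K) ^ α.length * (-1) ^ ((t :: u).countP (· < c))) * this
    · cases β with
      | nil => simp
      | cons c β =>
        by_cases hc : c = a
        swap
        · rw [if_neg (by simpa using hc), if_neg (by simpa using hc), mul_zero, mul_zero]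
        subst hc
        have hperm : (α.reverse ++ t :: β).Perm (t :: u) := by
          have h1 : (α.reverse ++ t :: c :: β).Perm (c :: (α.reverse ++ t :: β)) := by
            have := List.perm_middle (l₁ := α.reverse ++ [t]) (l₂ := β) (a := c)
            simpa using this
          exact (h1.symm.trans (hp.trans hswap)).cons_inv
        have hcα : c ∉ α.reverse ++ [t] := fun h => hn'.2 (hperm.subset (by
          rcases List.mem_append.mp h with h | h
          · exact List.mem_append_left _ h
          · exact List.mem_append_right _ (by simp at h; simp [h])))
        have h1 := wordSign_middle (α.reverse ++ [t]) β c
        have h2 := countP_lt_add_countP_gt hcα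
        have h3 := hperm.countP_eq (fun x => decide (x < c))
        have h3' : (α.reverse ++ [t]).countP (· < c) + β.countP (· < c) =
            (t :: u).countP (· < c) := by
          rw [← h3, ← List.countP_append]
          simp
        have h4 : wordSign (α.reverse ++ t :: c :: β) =
            (-1) ^ (α.length + 1) * (-1) ^ ((t :: u).countP (· < c)) *
              wordSign (α.reverse ++ t :: β) := by
          have e1 : α.reverse ++ t :: c :: β = (α.reverse ++ [t]) ++ c :: β := by simp
          have e2 : α.reverse ++ t :: β = (α.reverse ++ [t]) ++ β := by simp
          have e3 : α.length + 1 = (α.reverse ++ [t]).length := by simp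
          rw [e1, e2, e3, h1, ← h3', ← h2]
          simp only [pow_add]
          have : ((-1 : ℤ) ^ ((α.reverse ++ [t]).countP (· < c))) *
              (-1) ^ ((α.reverse ++ [t]).countP (· < c)) = 1 := by
            rw [← pow_add, ← two_mul]
            simp
          linear_combination (-(-1 : ℤ) ^ ((α.reverse ++ [t]).countP (c < ·)) *
            (-1) ^ (β.countP (· < c)) * wordSign ((α.reverse ++ [t]) ++ β)) * this
        have := ih α β hn'.1 hperm
        rw [h4, List.head?_cons, if_pos rfl, if_pos rfl, arrangementSign, List.tail_cons]
        push_cast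
        linear_combination ((-1 : K) ^ α.length * (-1) ^ ((t :: u).countP (· < c))) * this

end LieWord

/-! ### Inversions and the signature -/

namespace LieWord

theorem wordSign_ofFn {X : Type} [LinearOrder X] {n : ℕ} {f : Fin n → X}
    (hf : Function.Injective f) :
    wordSign (List.ofFn f) = ∏ i, ∏ j ∈ Finset.Ioi i, if f i < f j then 1 else -1 := by
  induction n with
  | zero => simp [wordSign]
  | succ n ih =>
    have aux : ∀ (l : List X) (a : X), a ∉ l →
        (-1 : ℤ) ^ (l.countP (· < a)) = (l.map fun b => if a < b then (1 : ℤ) else -1).prod := by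
      intro l a
      induction l with
      | nil => simp
      | cons b l ih =>
        intro h
        simp only [List.mem_cons, not_or] at h
        rw [List.countP_cons, List.map_cons, List.prod_cons, ← ih h.2, pow_add, mul_comm]
        rcases lt_or_gt_of_ne h.1 with hlt | hlt
        · simp [hlt, hlt.not_gt]
        · simp [hlt, hlt.not_gt]
    have ih' : wordSign (List.ofFn fun i => f i.succ) = _ := ih (hf.comp (Fin.succ_injective n))
    rw [List.ofFn_succ, wordSign, ih', Fin.prod_univ_succ,
      Fin.prod_Ioi_zero, aux]
    · congr 1
      · rw [List.map_ofFn, List.prod_ofFn]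
        rfl
      · exact Finset.prod_congr rfl fun i _ => (Fin.prod_Ioi_succ
        (fun j => if f i.succ < f j then (1 : ℤ) else -1) i).symm
    · intro h
      obtain ⟨i, hi⟩ := List.mem_ofFn.mp h
      exact Fin.succ_ne_zero i (hf hi)

theorem wordSign_perm {r : ℕ} (w : Equiv.Perm (Fin r)) :
    wordSign (List.ofFn w) = (Equiv.Perm.sign w : ℤ) := by
  rw [wordSign_ofFn w.injective, Equiv.Perm.sign_eq_prod_prod_Ioi, Units.coe_prod]
  refine Finset.prod_congr rfl fun i _ => ?_
  rw [Units.coe_prod]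
  refine Finset.prod_congr rfl fun j _ => ?_
  split_ifs <;> rfl

end LieWord

/-! ### Homology classes in complexes of modules -/

section HomologyClass

variable {K : Type} [CommRing K]

/-- In degree 0 the truncated subtraction gives 0, which is also the default value of `next`. So `d
0 (0 - 1)` is zero and every chain of degree 0 counts as a cycle. -/
theorem next_down_eq (n : ℕ) : (ComplexShape.down ℕ).next n = n - 1 := by
  cases n with
  | zero => simp
  | succ n => exact ChainComplex.next_nat_succ n

/-- The homology class of a cycle. -/
noncomputable def homologyClass (C : ChainComplex (ModuleCat.{0} K) ℕ) (n : ℕ) :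
    LinearMap.ker (C.d n (n - 1)).hom →ₗ[K] C.homology n :=
  (C.homologyπ n).hom ∘ₗ
    (C.liftCycles (ModuleCat.ofHom (LinearMap.ker (C.d n (n - 1)).hom).subtype) (n - 1)
      (next_down_eq n) (by ext x; exact x.2)).hom

theorem iCycles_injective (C : ChainComplex (ModuleCat.{0} K) ℕ) (n : ℕ) :
    Function.Injective (C.iCycles n).hom :=
  (ModuleCat.mono_iff_injective _).mp inferInstance

theorem iCycles_liftCycles_apply (C : ChainComplex (ModuleCat.{0} K) ℕ) (n : ℕ)
    (z : LinearMap.ker (C.d n (n - 1)).hom) :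
    (C.iCycles n).hom ((C.liftCycles (ModuleCat.ofHom (LinearMap.ker (C.d n (n - 1)).hom).subtype)
      (n - 1) (next_down_eq n) (by ext x; exact x.2)).hom z) = z :=
  LinearMap.congr_fun (congrArg ModuleCat.Hom.hom (C.liftCycles_i
    (ModuleCat.ofHom (LinearMap.ker (C.d n (n - 1)).hom).subtype) (n - 1) (next_down_eq n)
      (by ext x; exact x.2))) z

theorem homologyClass_surjective (C : ChainComplex (ModuleCat.{0} K) ℕ) (n : ℕ) :
    Function.Surjective (homologyClass C n) := by
  intro h
  obtain ⟨y, rfl⟩ := (ModuleCat.epi_iff_surjective (C.homologyπ n)).mp inferInstance h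
  have hy : (C.d n (n - 1)).hom ((C.iCycles n).hom y) = 0 :=
    LinearMap.congr_fun (congrArg ModuleCat.Hom.hom (C.iCycles_d n (n - 1))) y
  refine ⟨⟨(C.iCycles n).hom y, hy⟩, ?_⟩
  refine congrArg (C.homologyπ n).hom (iCycles_injective C n ?_)
  exact iCycles_liftCycles_apply C n ⟨_, hy⟩

theorem homologyClass_eq_zero_iff (C : ChainComplex (ModuleCat.{0} K) ℕ) (n : ℕ)
    (z : LinearMap.ker (C.d n (n - 1)).hom) :
    homologyClass C n z = 0 ↔ ∃ y, (C.d (n + 1) n).hom y = z := by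
  have hex := (ShortComplex.mk _ _ (C.toCycles_comp_homologyπ (n + 1) n)).exact_of_g_is_cokernel
    (C.homologyIsCokernel (n + 1) n (ChainComplex.prev ℕ n))
  have hi : ∀ y, (C.iCycles n).hom ((C.toCycles (n + 1) n).hom y) = (C.d (n + 1) n).hom y :=
    fun y => LinearMap.congr_fun (congrArg ModuleCat.Hom.hom (C.toCycles_i (n + 1) n)) y
  constructor
  · intro h
    obtain ⟨y, hy⟩ := (ShortComplex.moduleCat_exact_iff _).mp hex _ h
    refine ⟨y, ?_⟩
    rw [← hi]
    refine (congrArg (C.iCycles n).hom hy).trans (iCycles_liftCycles_apply C n z)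
  · rintro ⟨y, hy⟩
    have h0 : (C.homologyπ n).hom ((C.toCycles (n + 1) n).hom y) = 0 :=
      LinearMap.congr_fun (congrArg ModuleCat.Hom.hom (C.toCycles_comp_homologyπ (n + 1) n)) y
    refine Eq.trans (congrArg (C.homologyπ n).hom (iCycles_injective C n ?_)) h0
    rw [hi, hy]
    exact iCycles_liftCycles_apply C n z

theorem homologyMap_homologyClass {C D : ChainComplex (ModuleCat.{0} K) ℕ} (f : C ⟶ D) (n : ℕ)
    (z : LinearMap.ker (C.d n (n - 1)).hom) (z' : LinearMap.ker (D.d n (n - 1)).hom)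
    (h : (f.f n).hom z = z') :
    (HomologicalComplex.homologyMap f n).hom (homologyClass C n z) = homologyClass D n z' := by
  have h1 := LinearMap.congr_fun (congrArg ModuleCat.Hom.hom
    (HomologicalComplex.homologyπ_naturality f n))
    ((C.liftCycles (ModuleCat.ofHom (LinearMap.ker (C.d n (n - 1)).hom).subtype)
      (n - 1) (next_down_eq n) (by ext x; exact x.2)).hom z)
  refine h1.trans (congrArg (D.homologyπ n).hom (iCycles_injective D n ?_))
  have h2 := LinearMap.congr_fun (congrArg ModuleCat.Hom.hom
    (HomologicalComplex.cyclesMap_i f n))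
    ((C.liftCycles (ModuleCat.ofHom (LinearMap.ker (C.d n (n - 1)).hom).subtype)
      (n - 1) (next_down_eq n) (by ext x; exact x.2)).hom z)
  refine h2.trans ?_
  have h3 := iCycles_liftCycles_apply C n z
  refine (congrArg (f.f n).hom h3).trans (h.trans ?_)
  exact (iCycles_liftCycles_apply D n z').symm

end HomologyClass

/-! ### Chains of simplicial sets -/

open Simplicial

namespace SSetChain

variable (K : Type) [CommRing K] {X Y : SSet.{0}}

/-- The `n`-chain given by an `n`-simplex. -/
noncomputable def ofSimplex {n : ℕ} (x : X _⦋n⦌) : (X.chainComplex (ModuleCat.of K K)).X n :=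
  (X.ιChainComplex x : ModuleCat.of K K ⟶ _).hom (1 : K)

theorem d_ofSimplex {n : ℕ} (x : X _⦋n + 1⦌) :
    ((X.chainComplex (ModuleCat.of K K)).d (n + 1) n).hom (ofSimplex K x) =
      ∑ i : Fin (n + 2), (-1 : K) ^ (i : ℕ) • ofSimplex K (X.δ i x) := by
  have h := LinearMap.congr_fun (congrArg ModuleCat.Hom.hom
    (SSet.ιChainComplex_d X (ModuleCat.of K K) x)) (1 : K)
  refine h.trans ?_
  rw [ModuleCat.hom_sum, LinearMap.sum_apply]
  refine Finset.sum_congr rfl fun i _ => ?_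
  rw [ModuleCat.hom_zsmul, LinearMap.smul_apply, ← Int.cast_smul_eq_zsmul K]
  push_cast
  rfl

theorem map_ofSimplex (f : X ⟶ Y) {n : ℕ} (x : X _⦋n⦌) :
    ((SSet.chainComplexMap f (ModuleCat.of K K)).f n).hom (ofSimplex K x) =
      ofSimplex K (f.app _ x) :=
  LinearMap.congr_fun (congrArg ModuleCat.Hom.hom
    (SSet.ι_chainComplexMap_f (X := X) (Y := Y) (f := f) (R := ModuleCat.of K K) (x := x))) (1 : K)

variable {K} in
theorem hom_ext {n : ℕ} {M : Type} [AddCommGroup M] [Module K M]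
    {f g : (X.chainComplex (ModuleCat.of K K)).X n →ₗ[K] M}
    (h : ∀ x : X _⦋n⦌, f (ofSimplex K x) = g (ofSimplex K x)) : f = g := by
  have : ModuleCat.ofHom f = ModuleCat.ofHom g := by
    refine SSet.chainComplex_hom_ext fun x => ?_
    ext
    exact h x
  exact congrArg ModuleCat.Hom.hom this

/-- The linear map on chains with prescribed values on simplices. -/
noncomputable def lift {n : ℕ} {M : Type} [AddCommGroup M] [Module K M] (g : X _⦋n⦌ → M) :
    (X.chainComplex (ModuleCat.of K K)).X n →ₗ[K] M :=
  ((X.isColimitChainComplexXCofan (ModuleCat.of K K) n).desc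
    (Limits.Cofan.mk (ModuleCat.of K M)
      fun x => ModuleCat.ofHom (LinearMap.toSpanSingleton K M (g x)))).hom

@[simp]
theorem lift_ofSimplex {n : ℕ} {M : Type} [AddCommGroup M] [Module K M] (g : X _⦋n⦌ → M)
    (x : X _⦋n⦌) : lift K g (ofSimplex K x) = g x := by
  have h := LinearMap.congr_fun (congrArg ModuleCat.Hom.hom
    ((X.isColimitChainComplexXCofan (ModuleCat.of K K) n).fac
    (Limits.Cofan.mk (ModuleCat.of K M)
      fun x => ModuleCat.ofHom (LinearMap.toSpanSingleton K M (g x))) ⟨x⟩)) (1 : K)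
  refine h.trans ?_
  exact one_smul K (g x)

/-! Degenerate chains. -/

open AlgebraicTopology DoldKan

/-- The projector on the normalized chains. -/
noncomputable def normalize (X : SSet.{0}) (n : ℕ) :
    (X.chainComplex (ModuleCat.of K K)).X n →ₗ[K] (X.chainComplex (ModuleCat.of K K)).X n :=
  ((PInfty : (alternatingFaceMapComplex (ModuleCat K)).obj (((SimplicialObject.whiskering _ _).obj
    (Limits.sigmaConst.obj (ModuleCat.of K K))).obj X) ⟶ _).f n).hom

theorem normalize_σ {n : ℕ} (x : X _⦋n⦌) (i : Fin (n + 1)) :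
    normalize K X (n + 1) (ofSimplex K (X.σ i x)) = 0 := by
  have h := LinearMap.congr_fun (congrArg ModuleCat.Hom.hom (σ_comp_PInfty
    (((SimplicialObject.whiskering _ _).obj
      (Limits.sigmaConst.obj (ModuleCat.of K K))).obj X) i)) (ofSimplex K x)
  refine Eq.trans (congrArg (normalize K X (n + 1)) ?_) h
  have h2 : Limits.Sigma.ι (fun _ : X _⦋n⦌ => ModuleCat.of K K) x ≫
      (Limits.sigmaConst.obj (ModuleCat.of K K)).map (SimplicialObject.σ X i) =
      Limits.Sigma.ι (fun _ : X _⦋n + 1⦌ => ModuleCat.of K K) (X.σ i x) := by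
    simp [Limits.sigmaConst]
  exact (LinearMap.congr_fun (congrArg ModuleCat.Hom.hom h2) (1 : K)).symm

/-- A cycle which vanishes after normalization is a boundary. -/
theorem exists_d_eq_of_normalize_eq_zero {n : ℕ} {z : (X.chainComplex (ModuleCat.of K K)).X (n + 1)}
    (hz : ((X.chainComplex (ModuleCat.of K K)).d (n + 1) n).hom z = 0)
    (hn : normalize K X (n + 1) z = 0) :
    ∃ y, ((X.chainComplex (ModuleCat.of K K)).d (n + 2) (n + 1)).hom y = z := by
  -- The normalizing projector is homotopic to the identity. On a cycle that it kills, the homotopy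
  -- formula reads 0 = d(s' z) + z.
  let H := homotopyPInftyToId (((SimplicialObject.whiskering _ _).obj
      (Limits.sigmaConst.obj (ModuleCat.of K K))).obj X)
  have h := H.comm (n + 1)
  rw [Homotopy.dNext_succ_chainComplex, Homotopy.prevD_chainComplex] at h
  have h' := LinearMap.congr_fun (congrArg ModuleCat.Hom.hom h) z
  let s : (X.chainComplex (ModuleCat.of K K)).X n →ₗ[K] (X.chainComplex (ModuleCat.of K K)).X (n + 1)
    := (H.hom n (n + 1)).hom
  let s' : (X.chainComplex (ModuleCat.of K K)).X (n + 1) →ₗ[K]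
    (X.chainComplex (ModuleCat.of K K)).X (n + 2) := (H.hom (n + 1) (n + 2)).hom
  refine ⟨-s' z, ?_⟩
  have h1 : normalize K X (n + 1) z =
      s (((X.chainComplex (ModuleCat.of K K)).d (n + 1) n).hom z) +
      ((X.chainComplex (ModuleCat.of K K)).d (n + 2) (n + 1)).hom (s' z) + z := h'
  rw [hn, hz, map_zero, zero_add] at h1
  rw [map_neg]
  exact neg_eq_of_add_eq_zero_right h1.symm

end SSetChain

/-! ### Normalized chains of `K̄(r)` -/

namespace PartitionChain

open ListChain

variable {r : ℕ}

/-- The entries of a sequence of partitions other than the first and the last one, from the finest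
to the coarsest. -/
def interiorList {m : ℕ} (c : PartitionChain r (m + 1)) : List (Setoid (Fin r)) :=
  List.ofFn fun k : Fin m => OrderDual.ofDual (c.seq k.succ.castSucc.rev)

theorem strictMono_of_injective {n : ℕ} {c : PartitionChain r n}
    (hc : Function.Injective c.seq) : StrictMono c.seq :=
  c.seq.monotone.strictMono_of_injective hc

theorem interiorList_mem {m : ℕ} {c : PartitionChain r (m + 1)} (hc : Function.Injective c.seq) :
    interiorList c ∈ interior (⊥ : Setoid (Fin r)) ∧ (interiorList c).length = m := by
  have hs := strictMono_of_injective hc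
  refine ⟨⟨?_, fun a ha => ?_⟩, List.length_ofFn⟩
  · rw [interiorList, List.pairwise_ofFn]
    intro i j hij
    refine OrderDual.ofDual_lt_ofDual.mpr (hs ?_)
    rw [Fin.rev_lt_rev]
    simpa using hij
  · obtain ⟨k, rfl⟩ := List.mem_ofFn.mp ha
    constructor
    · have h : c.seq k.succ.castSucc.rev < c.seq (Fin.last _) := hs (by
        rw [← Fin.rev_zero, Fin.rev_lt_rev]
        exact Fin.castSucc_pos (Fin.succ_pos k))
      rw [c.last] at h
      exact h
    · have h : c.seq 0 < c.seq k.succ.castSucc.rev := hs (by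
        rw [← Fin.rev_last, Fin.rev_lt_rev]
        exact Fin.castSucc_lt_last _)
      rw [c.first] at h
      exact h

theorem interiorList_injective {m : ℕ} :
    Function.Injective (interiorList (r := r) (m := m)) := by
  intro c c' h
  have h' := List.ofFn_injective h
  refine ext_seq (OrderHom.ext _ _ (funext fun i => ?_))
  obtain ⟨j, rfl⟩ := Fin.rev_surjective i
  induction j using Fin.cases with
  | zero => rw [Fin.rev_zero, c.last, c'.last]
  | succ j =>
    induction j using Fin.lastCases with
    | last => rw [Fin.succ_last, Fin.rev_last, c.first, c'.first]
    | cast k =>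
      rw [Fin.succ_castSucc]
      exact congrFun h' k

theorem exists_interiorList_eq {m : ℕ} (hr : (⊥ : Setoid (Fin r)) < ⊤) {l : List (Setoid (Fin r))}
    (hl : l ∈ interior (⊥ : Setoid (Fin r))) (hm : l.length = m) :
    ∃ c : PartitionChain r (m + 1), Function.Injective c.seq ∧ interiorList c = l := by
  subst hm
  -- The two fixed ends are put back; `hr` gives strictness when `l` is empty.
  set L : List (Setoid (Fin r)) := ⊥ :: (l ++ [⊤]) with hL
  have hlen : L.length = l.length + 1 + 1 := by simp [hL]
  have hp : L.Pairwise (· < ·) := by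
    rw [hL, List.pairwise_cons, List.pairwise_append]
    refine ⟨fun a ha => ?_, hl.1, List.pairwise_singleton _ _, fun a ha b hb => ?_⟩
    · rcases List.mem_append.mp ha with ha | ha
      · exact (hl.2 a ha).1
      · rw [List.mem_singleton.mp ha]
        exact hr
    · rw [List.mem_singleton.mp hb]
      exact (hl.2 a ha).2
  have hs : StrictMono fun i : Fin (l.length + 1 + 1) => L.get (i.cast hlen.symm) := by
    intro i j hij
    exact List.pairwise_iff_get.mp hp _ _ hij
  refine ⟨⟨⟨fun i => OrderDual.toDual (L.get (i.rev.cast hlen.symm)), fun i j hij =>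
    OrderDual.toDual_le_toDual.mpr (hs.monotone (Fin.rev_le_rev.mpr hij))⟩, ?_, ?_⟩, ?_, ?_⟩
  · change L.get (Fin.cast _ (Fin.rev 0)) = ⊤
    simp [hL]
  · change L.get (Fin.cast _ (Fin.rev (Fin.last _))) = ⊥
    simp [hL]
  · intro i j hij
    have : L.get (i.rev.cast hlen.symm) = L.get (j.rev.cast hlen.symm) := hij
    exact Fin.rev_injective (hs.injective this)
  · refine Eq.trans (congrArg List.ofFn (funext fun k : Fin l.length => ?_)) (List.ofFn_get l)
    change L.get (Fin.cast _ (Fin.rev (Fin.rev _))) = _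
    simp [hL]

theorem face_eq_none {n : ℕ} {c : PartitionChain r (n + 1)} (hc : Function.Injective c.seq)
    {i : Fin (n + 2)} (hi : i = 0 ∨ i = Fin.last _) :
    pull i.succAboveOrderEmb.toOrderHom c = none := by
  refine pull_neg _ _ ?_
  rintro ⟨h1, h2⟩
  rcases hi with rfl | rfl
  · have h : c.seq (Fin.succAbove 0 0) = c.seq 0 := h1.trans c.first.symm
    exact Fin.succAbove_ne 0 0 (hc h)
  · have h : c.seq (Fin.succAbove (Fin.last _) (Fin.last _)) = c.seq (Fin.last _) :=
      h2.trans c.last.symm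
    exact Fin.succAbove_ne _ _ (hc h)

/-- The interior list omits the two ends and is read backwards, so its k-th entry sits at position
`rev (k + 1)` of the sequence. Omitting it keeps both ends. -/
theorem exists_face_eq {m : ℕ} {c : PartitionChain r (m + 1 + 1)} (hc : Function.Injective c.seq)
    (k : Fin (m + 1)) :
    ∃ c' : PartitionChain r (m + 1),
      pull k.succ.castSucc.rev.succAboveOrderEmb.toOrderHom c = some c' ∧
      Function.Injective c'.seq ∧ interiorList c' =
        List.ofFn fun j => OrderDual.ofDual (c.seq (k.succAbove j).succ.castSucc.rev) := by
  have h0 : k.succ.castSucc.rev ≠ 0 := by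
    rw [← Fin.rev_last, Ne, Fin.rev_inj]
    exact (Fin.castSucc_lt_last _).ne
  have h1 : k.succ.castSucc.rev ≠ Fin.last _ := by
    rw [← Fin.rev_zero, Ne, Fin.rev_inj]
    exact (Fin.castSucc_pos (Fin.succ_pos k)).ne'
  have h : c.seq (k.succ.castSucc.rev.succAboveOrderEmb.toOrderHom 0) = ⊥ ∧
      c.seq (k.succ.castSucc.rev.succAboveOrderEmb.toOrderHom (Fin.last _)) = ⊤ := by
    constructor
    · change c.seq (Fin.succAbove _ 0) = ⊥
      rw [Fin.succAbove_ne_zero_zero h0, c.first]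
    · change c.seq (Fin.succAbove _ (Fin.last _)) = ⊤
      rw [Fin.succAbove_ne_last_last h1, c.last]
  refine ⟨_, pull_pos _ _ h, ?_, ?_⟩
  · exact hc.comp (Fin.succAbove_right_injective)
  · refine congrArg List.ofFn (funext fun j => ?_)
    change c.seq (Fin.succAbove _ _) = _
    rw [← Fin.rev_succAbove, Fin.castSucc_succAbove_castSucc, Fin.succ_succAbove_succ]
    rfl

theorem exists_seq_eq_of_not_injective {n : ℕ} {c : PartitionChain r (n + 1)}
    (hc : ¬ Function.Injective c.seq) : ∃ j : Fin (n + 1), c.seq j.castSucc = c.seq j.succ := by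
  by_contra! h
  refine hc (StrictMono.injective (Fin.strictMono_iff_lt_succ.mpr fun j => ?_))
  exact lt_of_le_of_ne (c.seq.monotone (Fin.castSucc_lt_succ).le) (h j)

theorem exists_degeneracy_eq {n : ℕ} {c : PartitionChain r (n + 1)} {j : Fin (n + 1)}
    (hj : c.seq j.castSucc = c.seq j.succ) :
    ∃ c' : PartitionChain r n, pull ⟨j.predAbove, Fin.predAbove_right_monotone j⟩ c' = some c := by
  have hlast : c.seq (j.succ.succAbove (Fin.last n)) = ⊤ := by
    by_cases h : j.succ = Fin.last _
    · have hj' : j = Fin.last n := Fin.succ_injective _ (h.trans (Fin.succ_last n).symm)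
      subst hj'
      rw [Fin.succAbove_succ_self, hj, Fin.succ_last, c.last]
    · rw [Fin.succAbove_ne_last_last h, c.last]
  let c' : PartitionChain r n := ⟨c.seq.comp j.succ.succAboveOrderEmb.toOrderHom, by
    change c.seq (j.succ.succAbove 0) = ⊥
    rw [Fin.succAbove_ne_zero_zero (Fin.succ_ne_zero j), c.first], hlast⟩
  have hval : ∀ i, c'.seq (j.predAbove i) = c.seq i := by
    intro i
    change c.seq (j.succ.succAbove (j.predAbove i)) = _
    by_cases hi : i = j.succ
    · subst hi
      rw [Fin.predAbove_succ_self, Fin.succAbove_succ_self, hj]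
    · rw [Fin.succ_succAbove_predAbove hi]
  refine ⟨c', (pull_pos _ _ ⟨?_, ?_⟩).trans (congrArg some ?_)⟩
  · exact (hval 0).trans c.first
  · exact (hval _).trans c.last
  · exact ext_seq (OrderHom.ext _ _ (funext hval))

theorem pull_succAbove_eq {n : ℕ} {c : PartitionChain r (n + 1)} {j : Fin (n + 1)}
    (hj : c.seq j.castSucc = c.seq j.succ) :
    pull j.castSucc.succAboveOrderEmb.toOrderHom c =
      pull j.succ.succAboveOrderEmb.toOrderHom c := by
  have h : c.seq.comp j.castSucc.succAboveOrderEmb.toOrderHom =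
      c.seq.comp j.succ.succAboveOrderEmb.toOrderHom := by
    refine OrderHom.ext _ _ (funext fun i => ?_)
    change c.seq (j.castSucc.succAbove i) = c.seq (j.succ.succAbove i)
    by_cases hi : i = j
    · subst hi
      rw [Fin.succAbove_castSucc_self, Fin.succAbove_succ_self, hj]
    · rcases lt_or_gt_of_ne hi with hlt | hlt
      · rw [Fin.succAbove_of_castSucc_lt _ _ (Fin.castSucc_lt_castSucc_iff.mpr hlt),
          Fin.succAbove_of_castSucc_lt _ _
            ((Fin.castSucc_lt_castSucc_iff.mpr hlt).trans Fin.castSucc_lt_succ)]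
      · rw [Fin.succAbove_of_lt_succ _ _ (Fin.castSucc_lt_succ.trans (Fin.succ_lt_succ_iff.mpr hlt)),
          Fin.succAbove_of_lt_succ _ _ (Fin.succ_lt_succ_iff.mpr hlt)]
  have hv : ∀ i, c.seq (j.castSucc.succAboveOrderEmb.toOrderHom i) =
      c.seq (j.succ.succAboveOrderEmb.toOrderHom i) := fun i =>
    congrArg (fun f : Fin (n + 1) →o PartitionPoset r => f i) h
  by_cases hp : c.seq (j.succ.succAboveOrderEmb.toOrderHom 0) = ⊥ ∧
      c.seq (j.succ.succAboveOrderEmb.toOrderHom (Fin.last _)) = ⊤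
  · have hp' : c.seq (j.castSucc.succAboveOrderEmb.toOrderHom 0) = ⊥ ∧
        c.seq (j.castSucc.succAboveOrderEmb.toOrderHom (Fin.last _)) = ⊤ := by
      rw [hv, hv]
      exact hp
    rw [pull_pos _ _ hp, pull_pos _ _ hp']
    exact congrArg some (ext_seq h)
  · have hp' : ¬ (c.seq (j.castSucc.succAboveOrderEmb.toOrderHom 0) = ⊥ ∧
        c.seq (j.castSucc.succAboveOrderEmb.toOrderHom (Fin.last _)) = ⊤) := by
      rw [hv, hv]
      exact hp
    rw [pull_neg _ _ hp, pull_neg _ _ hp']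

theorem not_injective_of_pull_succAbove {n : ℕ} {c : PartitionChain r (n + 1)} {j : Fin (n + 1)}
    (hj : c.seq j.castSucc = c.seq j.succ) {i : Fin (n + 2)} (h1 : i ≠ j.castSucc)
    (h2 : i ≠ j.succ) {c' : PartitionChain r n}
    (hc' : pull i.succAboveOrderEmb.toOrderHom c = some c') : ¬ Function.Injective c'.seq := by
  intro hinj
  have hs : ∀ k, c'.seq k = c.seq (i.succAbove k) := by
    by_cases hp : c.seq (i.succAboveOrderEmb.toOrderHom 0) = ⊥ ∧
        c.seq (i.succAboveOrderEmb.toOrderHom (Fin.last _)) = ⊤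
    · rw [pull_pos _ _ hp] at hc'
      obtain rfl := Option.some.inj hc'
      exact fun k => rfl
    · rw [pull_neg _ _ hp] at hc'
      exact absurd hc' (by simp)
  obtain ⟨k, hk⟩ := Fin.exists_succAbove_eq h1.symm
  obtain ⟨k', hk'⟩ := Fin.exists_succAbove_eq h2.symm
  have hkk' : c'.seq k = c'.seq k' := by rw [hs, hs, hk, hk', hj]
  have := hinj hkk'
  subst this
  exact (Fin.castSucc_lt_succ (i := j)).ne (hk.symm.trans hk')

end PartitionChain

namespace ListChain

theorem face_ofFn (K : Type) [CommRing K] {α : Type} {n : ℕ} (f : Fin (n + 1) → α) :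
    face K (List.ofFn f) = ∑ k : Fin (n + 1), (-1 : K) ^ (k : ℕ) •
      Finsupp.single (List.ofFn fun j => f (k.succAbove j)) 1 := by
  induction n with
  | zero => simp [face, consMap]
  | succ n ih =>
    have ih' := ih fun i => f i.succ
    rw [List.ofFn_succ, face, ih', map_sum, sub_eq_add_neg, ← Finset.sum_neg_distrib]
    conv_rhs => rw [Fin.sum_univ_succ]
    congr 1
    · simp
    · refine Finset.sum_congr rfl fun k _ => ?_
      rw [map_smul, consMap_single, ← neg_smul, Fin.val_succ, pow_succ, mul_neg_one]
      congr 2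
      rw [List.ofFn_succ]
      simp

end ListChain

/-! ### Comparison of simplicial chains with lists -/

namespace PartitionHomology

open ListChain SSetChain PartitionChain

variable (K : Type) [CommRing K] (r : ℕ)

/-- The complex of simplicial chains of `K̄(r)`. -/
noncomputable abbrev chainCx : ChainComplex (ModuleCat.{0} K) ℕ :=
  (partitionSSet r).chainComplex (ModuleCat.of K K)

variable {r}

/-- The simplicial chain attached to a simplex of `K̄(r)`. -/
noncomputable def elt {n : ℕ} (x : Option (PartitionChain r n)) : (chainCx K r).X n :=
  ofSimplex K (X := partitionSSet r) (n := n) x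

theorem d_elt_some {n : ℕ} (c : PartitionChain r (n + 1)) :
    ((chainCx K r).d (n + 1) n).hom (elt K (some c)) =
      ∑ i : Fin (n + 2), (-1 : K) ^ (i : ℕ) • elt K (pull i.succAboveOrderEmb.toOrderHom c) :=
  d_ofSimplex K (X := partitionSSet r) (n := n) (some c : Option (PartitionChain r (n + 1)))

theorem d_elt_none (n : ℕ) :
    ((chainCx K r).d (n + 1) n).hom (elt K none) =
      ∑ i : Fin (n + 2), (-1 : K) ^ (i : ℕ) • elt K (none : Option (PartitionChain r n)) :=
  d_ofSimplex K (X := partitionSSet r) (n := n) (none : Option (PartitionChain r (n + 1)))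

variable {K} in
theorem chain_hom_ext {n : ℕ} {M : Type} [AddCommGroup M] [Module K M]
    {f g : (chainCx K r).X n →ₗ[K] M} (h : ∀ x : Option (PartitionChain r n),
      f (elt K x) = g (elt K x)) : f = g :=
  SSetChain.hom_ext (X := partitionSSet r) (n := n) h

theorem normalize_elt_none (n : ℕ) :
    normalize K (partitionSSet r) (n + 1) (elt K none) = 0 :=
  normalize_σ K (X := partitionSSet r) (n := n) (none : Option (PartitionChain r n)) 0

theorem normalize_elt_some {n : ℕ} {c : PartitionChain r (n + 1)}
    (hc : ¬ Function.Injective c.seq) :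
    normalize K (partitionSSet r) (n + 1) (elt K (some c)) = 0 := by
  obtain ⟨j, hj⟩ := exists_seq_eq_of_not_injective hc
  obtain ⟨c', hc'⟩ := exists_degeneracy_eq hj
  have h := normalize_σ K (X := partitionSSet r) (n := n)
    (some c' : Option (PartitionChain r n)) j
  have h2 : (partitionSSet r).σ j (some c' : Option (PartitionChain r n)) = some c := hc'
  rw [h2] at h
  exact h

open Classical in
/-- The projection from simplicial chains to linear combinations of lists, which kills the
base point and the degenerate sequences. -/
noncomputable def toLists (m : ℕ) : (chainCx K r).X (m + 1) →ₗ[K] (List (Setoid (Fin r)) →₀ K) :=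
  lift K (X := partitionSSet r) (n := m + 1) fun x : Option (PartitionChain r (m + 1)) =>
    x.elim 0 fun c => if Function.Injective c.seq then Finsupp.single (interiorList c) 1 else 0

theorem toLists_none (m : ℕ) : toLists K m (elt K (none : Option (PartitionChain r _))) = 0 :=
  lift_ofSimplex K _ _

open Classical in
theorem toLists_some {m : ℕ} (c : PartitionChain r (m + 1)) :
    toLists K m (elt K (some c)) =
      if Function.Injective c.seq then Finsupp.single (interiorList c) 1 else 0 :=
  lift_ofSimplex K _ _

open Classical in
/-- The simplicial chain attached to a list of partitions. -/
noncomputable def ofList (m : ℕ) (l : List (Setoid (Fin r))) : (chainCx K r).X (m + 1) :=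
  if h : ∃ c : PartitionChain r (m + 1), Function.Injective c.seq ∧ interiorList c = l then
    -- Subtracting the base point turns the faces that are sent to the base point into zero.
    elt K (some h.choose) - elt K none
  else 0

theorem ofList_interiorList {m : ℕ} {c : PartitionChain r (m + 1)}
    (hc : Function.Injective c.seq) :
    ofList K m (interiorList c) = elt K (some c) - elt K none := by
  have h : ∃ c' : PartitionChain r (m + 1), Function.Injective c'.seq ∧
      interiorList c' = interiorList c := ⟨c, hc, rfl⟩
  rw [ofList, dif_pos h, interiorList_injective h.choose_spec.2]

/-- The linear extension of `ofList`. -/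
noncomputable def ofLists (m : ℕ) : (List (Setoid (Fin r)) →₀ K) →ₗ[K] (chainCx K r).X (m + 1) :=
  Finsupp.linearCombination K (ofList K m)

theorem ofLists_single (m : ℕ) (l : List (Setoid (Fin r))) :
    ofLists K m (Finsupp.single l 1) = ofList K m l := by
  simp [ofLists]

theorem toLists_mem (m : ℕ) (z : (chainCx K r).X (m + 1)) :
    toLists K m z ∈ chains K (⊥ : Setoid (Fin r)) m := by
  classical
  have h : (chains K (⊥ : Setoid (Fin r)) m).mkQ ∘ₗ toLists K m = 0 := by
    refine chain_hom_ext fun x => ?_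
    rw [LinearMap.comp_apply, LinearMap.zero_apply, Submodule.mkQ_apply,
      Submodule.Quotient.mk_eq_zero]
    cases x with
    | none => rw [toLists_none]; exact Submodule.zero_mem _
    | some c =>
      rw [toLists_some]
      split_ifs with hc
      · exact Finsupp.single_mem_supported K _ (interiorList_mem hc)
      · exact Submodule.zero_mem _
  have := LinearMap.congr_fun h z
  rwa [LinearMap.comp_apply, LinearMap.zero_apply, Submodule.mkQ_apply,
      Submodule.Quotient.mk_eq_zero] at this

/-- The passage through lists loses only degenerate chains: the base point in positive degree and
the sequences with a repetition. -/
theorem normalize_ofLists_toLists (m : ℕ) (z : (chainCx K r).X (m + 1)) :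
    normalize K (partitionSSet r) (m + 1) (ofLists K m (toLists K m z)) =
      normalize K (partitionSSet r) (m + 1) z := by
  classical
  have h : normalize K (partitionSSet r) (m + 1) ∘ₗ ofLists K m ∘ₗ toLists K m =
      normalize K (partitionSSet r) (m + 1) := by
    refine chain_hom_ext fun x => ?_
    simp only [LinearMap.comp_apply]
    cases x with
    | none => rw [toLists_none, map_zero, map_zero, normalize_elt_none]
    | some c =>
      rw [toLists_some]
      split_ifs with hc
      · rw [ofLists_single, ofList_interiorList K hc, map_sub, normalize_elt_none, sub_zero]
      · rw [map_zero, map_zero, normalize_elt_some K hc]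
  exact LinearMap.congr_fun h z

section

variable (hr : (⊥ : Setoid (Fin r)) < ⊤)

include hr in
variable {K} in
theorem toLists_ofLists {m : ℕ} {z : List (Setoid (Fin r)) →₀ K}
    (hz : z ∈ chains K (⊥ : Setoid (Fin r)) m) : toLists K m (ofLists K m z) = z := by
  have := Finsupp.map_eq_of_mem_supported (toLists K m ∘ₗ ofLists K m) LinearMap.id
    (s := {l | l ∈ interior (⊥ : Setoid (Fin r)) ∧ l.length = m}) ?_ hz
  · exact this
  rintro l ⟨hl, hm⟩
  obtain ⟨c, hc, rfl⟩ := exists_interiorList_eq hr hl hm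
  rw [LinearMap.comp_apply, ofLists_single, ofList_interiorList K hc, map_sub, toLists_none,
    sub_zero, toLists_some, if_pos hc]
  rfl

/-- The two outer faces are the base point and cancel. The entry k of the reversed list, which has m
+ 1 entries, is omitted by the face of index m + 1 − k, whence the global sign (−1)^(m+1). -/
theorem d_ofList_interiorList {m : ℕ} {c : PartitionChain r (m + 1 + 1)}
    (hc : Function.Injective c.seq) :
    ((chainCx K r).d (m + 1 + 1) (m + 1)).hom (ofList K (m + 1) (interiorList c)) =
      (-1 : K) ^ (m + 1) • ofLists K m (face K (interiorList c)) := by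
  rw [ofList_interiorList K hc, map_sub, d_elt_some, d_elt_none, ← Finset.sum_sub_distrib]
  simp only [← smul_sub]
  rw [← Equiv.sum_comp Fin.revPerm, Fin.sum_univ_succ, Fin.sum_univ_castSucc]
  have h0 : pull (Fin.revPerm (0 : Fin (m + 1 + 1 + 1))).succAboveOrderEmb.toOrderHom c = none :=
    face_eq_none hc (Or.inr (by simp))
  have h1 : pull (Fin.revPerm (Fin.last (m + 1)).succ).succAboveOrderEmb.toOrderHom c = none :=
    face_eq_none hc (Or.inl (by simp))
  rw [h0, h1, sub_self, smul_zero, smul_zero, zero_add, add_zero, interiorList, face_ofFn, map_sum,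
    Finset.smul_sum]
  refine Finset.sum_congr rfl fun k _ => ?_
  obtain ⟨c', hp, hc', hl⟩ := exists_face_eq hc k
  have hk : Fin.revPerm k.castSucc.succ = k.succ.castSucc.rev := by
    rw [Fin.succ_castSucc]
    rfl
  rw [map_smul, ofLists_single, hk, hp, ← hl, ofList_interiorList K hc', smul_smul]
  congr 1
  rw [Fin.val_rev, Fin.val_castSucc, Fin.val_succ, ← pow_add]
  have hk' := k.isLt
  have : (m + 1 + (k : ℕ)) = (m + 1 + 1 + 1 - ((k : ℕ) + 1 + 1)) + 2 * (k : ℕ) := by omega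
  rw [this, pow_add, pow_mul]
  simp

include hr in
variable {K} in
theorem d_ofLists {m : ℕ} {z : List (Setoid (Fin r)) →₀ K}
    (hz : z ∈ chains K (⊥ : Setoid (Fin r)) (m + 1)) :
    ((chainCx K r).d (m + 1 + 1) (m + 1)).hom (ofLists K (m + 1) z) =
      (-1 : K) ^ (m + 1) • ofLists K m (bd K z) := by
  have := Finsupp.map_eq_of_mem_supported
    (((chainCx K r).d (m + 1 + 1) (m + 1)).hom ∘ₗ ofLists K (m + 1))
    ((-1 : K) ^ (m + 1) • ofLists K m ∘ₗ bd K)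
    (s := {l | l ∈ interior (⊥ : Setoid (Fin r)) ∧ l.length = m + 1}) ?_ hz
  · exact this
  rintro l ⟨hl, hm⟩
  obtain ⟨c, hc, rfl⟩ := exists_interiorList_eq hr hl hm
  rw [LinearMap.comp_apply, ofLists_single, d_ofList_interiorList K hc]
  simp

include hr in
variable {K} in
theorem toLists_d {m : ℕ} (z : (chainCx K r).X (m + 1 + 1)) :
    toLists K m (((chainCx K r).d (m + 1 + 1) (m + 1)).hom z) =
      (-1 : K) ^ (m + 1) • bd K (toLists K (m + 1) z) := by
  classical
  have h : toLists K m ∘ₗ ((chainCx K r).d (m + 1 + 1) (m + 1)).hom =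
      (-1 : K) ^ (m + 1) • bd K ∘ₗ toLists K (m + 1) := by
    have hnone : toLists K m (((chainCx K r).d (m + 1 + 1) (m + 1)).hom (elt K none)) = 0 := by
      rw [d_elt_none, map_sum]
      exact Finset.sum_eq_zero fun i _ => by rw [map_smul, toLists_none, smul_zero]
    refine chain_hom_ext fun x => ?_
    simp only [LinearMap.comp_apply, LinearMap.smul_apply]
    cases x with
    | none => rw [hnone, toLists_none, map_zero, smul_zero]
    | some c =>
      rw [toLists_some]
      split_ifs with hc
      · have h1 := d_ofList_interiorList K hc
        rw [ofList_interiorList K hc, map_sub] at h1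
        have h2 := congrArg (toLists K m) h1
        rw [map_sub, hnone, sub_zero, map_smul, toLists_ofLists hr] at h2
        · rw [h2, bd_single]
        · rw [← bd_single]
          exact bd_mem_chains (Finsupp.single_mem_supported K _ (interiorList_mem hc))
      -- For a repetition at j, the faces j and j + 1 agree and have opposite signs; every other
      -- face is the base point or still has the repetition.
      · rw [map_zero, smul_zero, d_elt_some, map_sum]
        obtain ⟨j, hj⟩ := exists_seq_eq_of_not_injective hc
        rw [Finset.sum_eq_add j.castSucc j.succ (Fin.castSucc_lt_succ).ne]
        · rw [pull_succAbove_eq hj, map_smul, map_smul, Fin.val_succ, Fin.val_castSucc, pow_succ]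
          simp
        · rintro i - ⟨h1, h2⟩
          rw [map_smul]
          cases hp : pull i.succAboveOrderEmb.toOrderHom c with
          | none => rw [toLists_none, smul_zero]
          | some c' =>
            rw [toLists_some, if_neg (not_injective_of_pull_succAbove hj h1 h2 hp), smul_zero]
        · simp
        · simp
  exact LinearMap.congr_fun h z

end

end PartitionHomology

/-! ### Comparison of two quotients of the regular representation -/

/-- Both representations are quotients of the regular one by the same submodule; equivariance need
only be tested on group elements. -/
theorem Representation.nonempty_equiv_of_surjective {K G V W : Type} [CommRing K] [Group G]
    [AddCommGroup V] [Module K V] [AddCommGroup W] [Module K W] {ρ : Representation K G V}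
    {σ : Representation K G W} {f : (G →₀ K) →ₗ[K] V} {g : (G →₀ K) →ₗ[K] W}
    (hf : Function.Surjective f) (hg : Function.Surjective g) (hfg : ∀ a, f a = 0 ↔ g a = 0)
    (hρ : ∀ v w, ρ v (f (Finsupp.single w 1)) = f (Finsupp.single (v * w) 1))
    (hσ : ∀ v w, σ v (g (Finsupp.single w 1)) = g (Finsupp.single (v * w) 1)) :
    Nonempty (ρ.Equiv σ) := by
  have hker : LinearMap.ker f = LinearMap.ker g := Submodule.ext hfg
  let e : V ≃ₗ[K] W := (f.quotKerEquivOfSurjective hf).symm ≪≫ₗ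
    Submodule.quotEquivOfEq _ _ hker ≪≫ₗ g.quotKerEquivOfSurjective hg
  have he : ∀ a, e (f a) = g a := by
    intro a
    simp only [e, LinearEquiv.trans_apply, LinearMap.quotKerEquivOfSurjective_symm_apply]
    rfl
  refine ⟨Representation.Equiv.mk e fun v => ?_⟩
  have key : (e.toLinearMap ∘ₗ ρ v) ∘ₗ f = (σ v ∘ₗ e.toLinearMap) ∘ₗ f := by
    refine Finsupp.lhom_ext' fun w => LinearMap.ext_ring ?_
    change e (ρ v (f (Finsupp.single w 1))) = σ v (e (f (Finsupp.single w 1)))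
    rw [hρ, he, he, hσ]
  exact (LinearMap.cancel_right hf).mp key

/-! ### Words of permutations paired with arrangements -/

namespace LieWord

open ListChain TensorProduct

section

variable {r : ℕ}

/-- The letters to the left of `t` in the word of a permutation, from right to left. -/
def leftPart (t : Fin r) (w : Equiv.Perm (Fin r)) : List (Fin r) :=
  ((List.ofFn w).takeWhile (· ≠ t)).reverse

/-- The letters to the right of `t` in the word of a permutation. -/
def rightPart (t : Fin r) (w : Equiv.Perm (Fin r)) : List (Fin r) :=
  ((List.ofFn w).dropWhile (· ≠ t)).tail

theorem ofFn_perm_nodup (w : Equiv.Perm (Fin r)) : (List.ofFn w).Nodup :=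
  List.nodup_ofFn.mpr w.injective

theorem mem_ofFn_perm (w : Equiv.Perm (Fin r)) (a : Fin r) : a ∈ List.ofFn w :=
  List.mem_ofFn.mpr (w.surjective a)

theorem ofFn_perm_eq (t : Fin r) (w : Equiv.Perm (Fin r)) :
    List.ofFn w = (leftPart t w).reverse ++ t :: rightPart t w := by
  have h := List.takeWhile_append_dropWhile (p := (· ≠ t)) (l := List.ofFn w)
  have ht : t ∉ (List.ofFn w).takeWhile (· ≠ t) := fun h => by
    simpa using List.mem_takeWhile_imp h
  have hne : (List.ofFn w).dropWhile (· ≠ t) ≠ [] := by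
    intro h0
    rw [h0, List.append_nil] at h
    rw [h] at ht
    exact ht (mem_ofFn_perm w t)
  have hhead : ((List.ofFn w).dropWhile (· ≠ t)).head hne = t := by
    have := List.head_dropWhile_not (· ≠ t) hne
    simpa using this
  rw [leftPart, List.reverse_reverse, rightPart]
  conv_lhs => rw [← h, ← List.cons_head_tail hne, hhead]

theorem notMem_leftPart (t : Fin r) (w : Equiv.Perm (Fin r)) : t ∉ leftPart t w := by
  intro h
  rw [leftPart, List.mem_reverse] at h
  simpa using List.mem_takeWhile_imp h

theorem parts_eq {t : Fin r} {w : Equiv.Perm (Fin r)} {v : List (Fin r)}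
    (h : List.ofFn w = t :: v) : leftPart t w = [] ∧ rightPart t w = v := by
  simp [leftPart, rightPart, h]

theorem exists_ofFn_eq {t : Fin r} {v : List (Fin r)} (hv : v ∈ Arrangement t) :
    ∃ w : Equiv.Perm (Fin r), List.ofFn w = t :: v := by
  have hn : (t :: v).Nodup := List.nodup_cons.mpr ⟨fun h => (hv.2 t).mp h rfl, hv.1⟩
  have hmem : ∀ a, a ∈ t :: v := fun a => by
    rw [List.mem_cons, hv.2]
    exact em _
  have hlen : (t :: v).length = r := by
    rw [← List.toFinset_card_of_nodup hn, Finset.eq_univ_of_forall (s := (t :: v).toFinset)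
      fun a => List.mem_toFinset.mpr (hmem a), Finset.card_univ, Fintype.card_fin]
  let f : Fin r → Fin r := fun i => (t :: v).get (i.cast hlen.symm)
  have hf : Function.Injective f := fun i j hij =>
    Fin.cast_injective _ (List.nodup_iff_injective_get.mp hn hij)
  refine ⟨Equiv.ofBijective f (Finite.injective_iff_bijective.mp hf), ?_⟩
  change List.ofFn f = _
  refine List.ext_get (by rw [List.length_ofFn, hlen]) fun i h1 h2 => ?_
  rw [List.get_ofFn]
  rfl

theorem perm_ofFn {t : Fin r} {u : List (Fin r)} (hu : u ∈ Arrangement t)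
    (w : Equiv.Perm (Fin r)) : (List.ofFn w).Perm (t :: u) := by
  have hn : (t :: u).Nodup := List.nodup_cons.mpr ⟨fun h => (hu.2 t).mp h rfl, hu.1⟩
  refine (List.perm_ext_iff_of_nodup (ofFn_perm_nodup w) hn).mpr fun a => ?_
  rw [List.mem_cons, hu.2]
  exact iff_of_true (mem_ofFn_perm w a) (em _)

/-- With nothing to the left, each letter must be attached on the right, so the word dictates the
order; the right signs are all `t 0`. -/
theorem zipCoeff_nil_left {K : Type} [CommRing K] {s t : ℕ → K} (ht : t 0 = 1)
    {X : Type} [DecidableEq X] (u v : List X) :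
    zipCoeff s t u [] v = if u = v then 1 else 0 := by
  induction u generalizing v with
  | nil => simp [zipCoeff, eq_comm]
  | cons a u ih =>
    cases v with
    | nil => simp [zipCoeff]
    | cons b v =>
      simp only [zipCoeff, List.head?_nil, reduceCtorEq, if_false, zero_add, List.head?_cons,
        Option.some.injEq, List.length_nil, ht, one_mul, List.tail_cons, ih, List.cons.injEq]
      by_cases hab : b = a
      · simp [hab]
      · simp [hab, Ne.symm hab]

variable (K : Type) [CommRing K]

/-- The map with matrix the coefficients of the words of permutations in the arrangements. -/
noncomputable def zipMap (t : Fin r) : (Equiv.Perm (Fin r) →₀ K) →ₗ[K] (Arrangement t → K) :=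
  Finsupp.linearCombination K fun w u =>
    zipCoeff (fun m => (-1) ^ m) (fun m => (-1) ^ m) u (leftPart t w) (rightPart t w)

theorem zipMap_single (t : Fin r) (w : Equiv.Perm (Fin r)) (u : Arrangement t) :
    zipMap K t (Finsupp.single w 1) u =
      zipCoeff (fun m => (-1) ^ m) (fun m => (-1) ^ m) u (leftPart t w) (rightPart t w) := by
  simp [zipMap]

/-- The permutations whose word starts with t are indexed by the arrangements, and on them the
matrix is the identity. -/
theorem zipMap_surjective (t : Fin r) : Function.Surjective (zipMap K t) := by
  classical
  choose p hp using fun v : Arrangement t => exists_ofFn_eq v.2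
  have hinj : Function.Injective p := by
    intro v v' h
    have := (hp v).symm.trans ((congrArg (fun w : Equiv.Perm (Fin r) => List.ofFn w) h).trans (hp v'))
    exact Subtype.ext (List.cons.inj this).2
  have : Finite (Arrangement t) := Finite.of_injective p hinj
  have := Fintype.ofFinite (Arrangement t)
  intro c
  refine ⟨∑ v, c v • Finsupp.single (p v) 1, funext fun u => ?_⟩
  rw [map_sum, Finset.sum_apply, Finset.sum_eq_single u]
  · rw [map_smul, Pi.smul_apply, zipMap_single, (parts_eq (hp u)).1, (parts_eq (hp u)).2,
      zipCoeff_nil_left (pow_zero _), if_pos rfl, smul_eq_mul, mul_one]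
  · intro v _ hv
    rw [map_smul, Pi.smul_apply, zipMap_single, (parts_eq (hp v)).1, (parts_eq (hp v)).2,
      zipCoeff_nil_left (pow_zero _), if_neg fun h => hv (Subtype.ext h.symm), smul_zero]
  · simp

/-- The map sending a permutation to its signed word coefficient. -/
noncomputable def lieForm (r : ℕ) :
    (Equiv.Perm (Fin r) →₀ K) →ₗ[K] Module.Dual K (lieComponent K r) ⊗[K] K :=
  Finsupp.linearCombination K fun w =>
    lieWordCoeff K (List.ofFn w) ⊗ₜ ((Equiv.Perm.sign w : ℤ) : K)

theorem lieForm_single (w : Equiv.Perm (Fin r)) :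
    lieForm K r (Finsupp.single w 1) =
      lieWordCoeff K (List.ofFn w) ⊗ₜ ((Equiv.Perm.sign w : ℤ) : K) := by
  simp [lieForm]

theorem tprod_lieForm (v w : Equiv.Perm (Fin r)) :
    (lieRep K r).dual.tprod (sgnRep K r) v (lieForm K r (Finsupp.single w 1)) =
      lieForm K r (Finsupp.single (v * w) 1) := by
  rw [lieForm_single, lieForm_single, Representation.tprod_apply, TensorProduct.map_tmul,
    dual_lieWordCoeff, List.map_ofFn]
  congr 1
  simp [sgnRep]

/-- The matrices of the Lie side and of the homology side differ by one sign per arrangement u,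
independent of the permutation. Hence they have the same kernel. -/
theorem lieForm_apply {t : Fin r} (a : Equiv.Perm (Fin r) →₀ K) (u : Arrangement t) :
    TensorProduct.rid K _ (lieForm K r a) ⟨_, nest_mem_lieComponent K u.2⟩ =
      arrangementSign t u * zipMap K t a u := by
  induction a using Finsupp.induction_linear with
  | zero => simp
  | add a b ha hb =>
    rw [map_add, map_add, map_add, LinearMap.add_apply, ha, hb, Pi.add_apply, mul_add]
  | single w c =>
    have hc : (Finsupp.single w c : Equiv.Perm (Fin r) →₀ K) = c • Finsupp.single w 1 := by simp
    have hn : (t :: (u : List (Fin r))).Nodup :=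
      List.nodup_cons.mpr ⟨fun h => (u.2.2 t).mp h rfl, u.2.1⟩
    have h := wordSign_mul_zipCoeff K t u (leftPart t w) (rightPart t w) hn
      (by rw [← ofFn_perm_eq]; exact perm_ofFn u.2 w)
    rw [← lieWordCoeff_nest K u.2 _ _ (notMem_leftPart t w), ← ofFn_perm_eq, wordSign_perm,
      ← zipMap_single] at h
    rw [hc, map_smul, map_smul, map_smul, lieForm_single, TensorProduct.rid_tmul,
      LinearMap.smul_apply, LinearMap.smul_apply, Pi.smul_apply, smul_eq_mul, smul_eq_mul, h,
      smul_eq_mul]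
    ring

theorem lieForm_eq_zero_iff (t : Fin r) (a : Equiv.Perm (Fin r) →₀ K) :
    lieForm K r a = 0 ↔ zipMap K t a = 0 := by
  have hs : ∀ u, ((arrangementSign t u : ℤ) : K) * arrangementSign t u = 1 := fun u => by
    rw [← Int.cast_mul, arrangementSign_mul_self, Int.cast_one]
  constructor
  · intro h
    funext u
    have h1 := lieForm_apply K a u
    rw [h, map_zero, LinearMap.zero_apply] at h1
    rw [← one_mul (zipMap K t a u), ← hs u, mul_assoc, ← h1, mul_zero]
    rfl
  · intro h
    refine (TensorProduct.rid K _).injective ?_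
    rw [map_zero]
    refine lieComponent_dual_ext K t fun u hu => ?_
    rw [lieForm_apply K a ⟨u, hu⟩, h]
    simp

theorem lieForm_surjective (t : Fin r) : Function.Surjective (lieForm K r) := by
  have hs : ∀ u, ((arrangementSign t u : ℤ) : K) * arrangementSign t u = 1 := fun u => by
    rw [← Int.cast_mul, arrangementSign_mul_self, Int.cast_one]
  intro f
  obtain ⟨a, ha⟩ := zipMap_surjective K t fun u =>
    arrangementSign t u * TensorProduct.rid K _ f ⟨_, nest_mem_lieComponent K u.2⟩
  refine ⟨a, (TensorProduct.rid K _).injective (lieComponent_dual_ext K t fun u hu => ?_)⟩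
  rw [lieForm_apply K a ⟨u, hu⟩, ha, ← mul_assoc, hs, one_mul]

end

end LieWord

/-! ### Reduced homology -/

namespace SSetChain

open Simplicial

variable (K : Type) [CommRing K] (X : SSet.{0})

/-- The normalizing projector vanishes on degenerate simplices, here on all chains of this degree,
so every cycle bounds. -/
theorem homology_eq_zero_of_degenerate {n : ℕ}
    (h : ∀ x : X _⦋n + 1⦌, ∃ (i : Fin (n + 1)) (y : X _⦋n⦌), X.σ i y = x)
    (c : ssetHomology K X (n + 1)) : c = 0 := by
  obtain ⟨z, rfl⟩ := homologyClass_surjective _ _ c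
  refine (homologyClass_eq_zero_iff _ _ z).mpr (exists_d_eq_of_normalize_eq_zero K z.2 ?_)
  have h0 : normalize K X (n + 1) = 0 := hom_ext fun x => by
    obtain ⟨i, y, rfl⟩ := h x
    exact normalize_σ K y i
  rw [h0]
  rfl

theorem eq_of_stdSimplex_zero {n : ℕ} (x y : (Δ[0] : SSet.{0}) _⦋n⦌) : x = y :=
  SSet.yonedaEquiv.symm.injective (SSet.stdSimplex.isTerminalObj₀.hom_ext _ _)

/-- A point has only degenerate simplices in positive degree, so the map to its homology is zero
there. -/
theorem reducedHomology_succ (n : ℕ) : reducedHomology K X (n + 1) = ⊤ :=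
  eq_top_iff.mpr fun _ _ => homology_eq_zero_of_degenerate K _ (fun x =>
    ⟨0, (Δ[0] : SSet.{0}).δ 0 x, eq_of_stdSimplex_zero _ _⟩) _

/-- The sum of the coefficients of a chain of degree zero. -/
noncomputable def augmentation : (X.chainComplex (ModuleCat.of K K)).X 0 →ₗ[K] K :=
  lift K (X := X) fun _ => 1

theorem augmentation_d (y : (X.chainComplex (ModuleCat.of K K)).X 1) :
    augmentation K X (((X.chainComplex (ModuleCat.of K K)).d 1 0).hom y) = 0 := by
  have h : augmentation K X ∘ₗ ((X.chainComplex (ModuleCat.of K K)).d (0 + 1) 0).hom = 0 := by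
    refine hom_ext fun x => ?_
    rw [LinearMap.comp_apply, d_ofSimplex, map_sum]
    simp [augmentation]
  exact LinearMap.congr_fun h y

/-- The projection to the point sends a chain to its augmentation times the unique vertex. A
multiple of that vertex is a boundary only when the coefficient is 0, since augmentation kills
boundaries. -/
theorem homologyClass_mem_reducedHomology_iff
    (z : LinearMap.ker ((X.chainComplex (ModuleCat.of K K)).d 0 (0 - 1)).hom) :
    homologyClass (X.chainComplex (ModuleCat.of K K)) 0 z ∈ reducedHomology K X 0 ↔
      augmentation K X z = 0 := by
  set f := SSet.chainComplexMap (SSet.stdSimplex.isTerminalObj₀.from X) (ModuleCat.of K K)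
    with hf
  have hker : ∀ y, y ∈
      LinearMap.ker (((Δ[0] : SSet.{0}).chainComplex (ModuleCat.of K K)).d 0 (0 - 1)).hom := by
    intro y
    rw [HomologicalComplex.shape _ _ _ (by simp)]
    rfl
  have hcls := homologyMap_homologyClass f 0 z ⟨(f.f 0).hom z, hker _⟩ rfl
  have hmap : (f.f 0).hom = (augmentation K X).smulRight
      (ofSimplex K (X := Δ[0]) (n := 0) (SSet.yonedaEquiv (𝟙 Δ[0]))) := by
    refine hom_ext fun x => ?_
    rw [hf, map_ofSimplex, LinearMap.smulRight_apply, augmentation, lift_ofSimplex, one_smul]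
    exact congrArg _ (eq_of_stdSimplex_zero _ _)
  have hiff : homologyClass (X.chainComplex (ModuleCat.of K K)) 0 z ∈ reducedHomology K X 0 ↔
      homologyClass _ 0 (⟨(f.f 0).hom z, hker _⟩ : LinearMap.ker _) = 0 := by
    rw [← hcls]
    exact Iff.rfl
  rw [hiff, homologyClass_eq_zero_iff]
  change (∃ y, _ = (f.f 0).hom (z : (X.chainComplex (ModuleCat.of K K)).X 0)) ↔ _
  rw [hmap, LinearMap.smulRight_apply]
  constructor
  · rintro ⟨y, hy⟩
    have h := augmentation_d K _ y
    have h1 : augmentation K Δ[0] (ofSimplex K (X := Δ[0]) (n := 0) (SSet.yonedaEquiv (𝟙 Δ[0]))) =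
        1 := lift_ofSimplex K _ _
    rw [hy, map_smul, h1] at h
    simpa using h
  · intro h
    exact ⟨0, by rw [h, zero_smul, map_zero]⟩

end SSetChain

/-! ### Bound on the length of chains of partitions -/

namespace ListChain

theorem card_quotient_lt {X : Type} [Finite X] {a b : Setoid X} (h : a < b) :
    Nat.card (Quotient b) < Nat.card (Quotient a) := by
  obtain ⟨s, t, hb, ha⟩ := Setoid.exists_rel_of_lt h
  let f : Quotient a → Quotient b := Quotient.map id fun _ _ hxy => h.le hxy
  have hf : Function.Surjective f := by
    intro q
    induction q using Quotient.ind with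
    | _ x => exact ⟨Quotient.mk a x, rfl⟩
  refine lt_of_le_of_ne (Nat.card_le_card_of_surjective f hf) fun hc => ha ?_
  have hbij := (Nat.bijective_iff_surjective_and_card f).mpr ⟨hf, hc.symm⟩
  exact Quotient.exact (hbij.1 (Quotient.sound hb : f (Quotient.mk a s) = f (Quotient.mk a t)))

/-- The number of classes drops at every strict step and is still positive at ⊤. This excludes
nonzero list chains above the top degree, hence boundaries into the top degree. -/
theorem length_lt_of_mem_interior {X : Type} [Finite X] [Nonempty X] {x : Setoid X} (hx : x < ⊤)
    {l : List (Setoid X)} (hl : l ∈ interior x) : l.length + 1 < Nat.card (Quotient x) := by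
  induction l generalizing x with
  | nil =>
    have h1 := card_quotient_lt hx
    have : Nonempty (Quotient (⊤ : Setoid X)) := ‹Nonempty X›.map (Quotient.mk _)
    have h2 : 0 < Nat.card (Quotient (⊤ : Setoid X)) := Nat.card_pos
    rw [List.length_nil]
    omega
  | cons a l ih =>
    obtain ⟨h1, h2, h3⟩ := cons_mem_interior_iff.mp hl
    have := ih h2 h3
    have := card_quotient_lt h1
    rw [List.length_cons]
    omega

theorem chains_bot_eq_zero {K : Type} [CommRing K] {r m : ℕ} (hr : (⊥ : Setoid (Fin r)) < ⊤)
    (hm : r ≤ m + 1) {z : List (Setoid (Fin r)) →₀ K} (hz : z ∈ chains K ⊥ m) : z = 0 := by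
  have : Nonempty (Fin r) := by
    obtain ⟨s, _⟩ := Setoid.exists_rel_of_lt hr
    exact ⟨s⟩
  refine Finsupp.map_eq_of_mem_supported LinearMap.id (0 : (List (Setoid (Fin r)) →₀ K) →ₗ[K] _)
    ?_ hz
  rintro l ⟨hl, hlen⟩
  have h1 := length_lt_of_mem_interior hr hl
  have h2 : Nat.card (Quotient (⊥ : Setoid (Fin r))) ≤ r := by
    refine (Nat.card_le_card_of_surjective (Quotient.mk _) Quotient.mk_surjective).trans ?_
    simp
  omega

theorem blockSetoid_singleton {X : Type} [DecidableEq X] (t : X) :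
    blockSetoid ({t} : Finset X) = ⊥ := by
  refine le_bot_iff.mp (blockSetoid_le_iff.mpr fun i hi j hj => ?_)
  rw [Finset.mem_singleton.mp hi, Finset.mem_singleton.mp hj]

end ListChain

/-! ### Cycles and boundaries of K̄(r) for r ≥ 2 -/

namespace PartitionHomology

open ListChain SSetChain PartitionChain LieWord

variable (K : Type) [CommRing K] {r : ℕ}

section

variable (hr : (⊥ : Setoid (Fin r)) < ⊤)

include hr

theorem chain_zero_eq_none (x : Option (PartitionChain r 0)) : x = none := by
  cases x with
  | none => rfl
  | some c =>
    have h : (⊤ : Setoid (Fin r)) = ⊥ := c.first.symm.trans c.last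
    exact absurd h hr.ne'

theorem d_one_eq_zero : ((chainCx K r).d 1 0).hom = 0 := by
  refine chain_hom_ext fun x => ?_
  cases x with
  | none =>
    refine (d_elt_none K 0).trans ?_
    simp
  | some c =>
    refine (d_elt_some K c).trans ?_
    simp [chain_zero_eq_none hr]

/-- The base point is the only vertex, because a sequence with one term would have to be both ⊥ and
⊤. A chain of degree 0 is thus its augmentation times this vertex. -/
theorem reducedHomology_zero_eq_bot : reducedHomology K (partitionSSet r) 0 = ⊥ := by
  refine eq_bot_iff.mpr fun c hc => ?_
  obtain ⟨z, rfl⟩ := homologyClass_surjective _ _ c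
  have h0 := (homologyClass_mem_reducedHomology_iff K _ z).mp hc
  have h1 : (LinearMap.id : (chainCx K r).X 0 →ₗ[K] _) =
      (augmentation K (partitionSSet r)).smulRight (elt K none) := by
    refine chain_hom_ext fun x => ?_
    rw [chain_zero_eq_none hr x, LinearMap.smulRight_apply]
    have : augmentation K (partitionSSet r) (elt K (none : Option (PartitionChain r 0))) = 1 :=
      lift_ofSimplex K _ _
    rw [this, one_smul]
    rfl
  have h2 : z = 0 := Subtype.ext ((LinearMap.congr_fun h1 _).trans
    (by rw [LinearMap.smulRight_apply, h0, zero_smul]; rfl))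
  rw [h2, map_zero]
  exact Submodule.zero_mem _

theorem bd_toLists_eq_zero {m : ℕ} {z : (chainCx K r).X (m + 1)}
    (hz : ((chainCx K r).d (m + 1) m).hom z = 0) : bd K (toLists K m z) = 0 := by
  cases m with
  | zero =>
    refine Finsupp.map_eq_of_mem_supported (bd K) 0 ?_ (toLists_mem K 0 z)
    rintro l ⟨-, hl⟩
    rw [List.length_eq_zero_iff.mp hl, bd_single]
    rfl
  | succ m =>
    have h := toLists_d hr z
    rw [hz, map_zero] at h
    have h1 := congrArg (fun x => (-1 : K) ^ (m + 1) • x) h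
    simp only [smul_zero, smul_smul] at h1
    rw [← mul_pow, neg_mul_neg, one_mul, one_pow, one_smul] at h1
    exact h1.symm

end

theorem bot_lt_top (k : ℕ) : (⊥ : Setoid (Fin (k + 2))) < ⊤ := by
  refine lt_of_le_of_ne bot_le fun h => ?_
  have : (⊥ : Setoid (Fin (k + 2))) 0 1 := h ▸ trivial
  exact absurd (this : (0 : Fin (k + 2)) = 1) (by simp)

variable {k : ℕ}

/-- The criterion for a cycle of `K̄(r)` to be a boundary. -/
theorem exists_d_eq {m : ℕ} (t : Fin (k + 2)) {z : (chainCx K (k + 2)).X (m + 1)}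
    (hz : ((chainCx K (k + 2)).d (m + 1) m).hom z = 0)
    (h : m = k → ∀ u ∈ Arrangement t, toLists K m z (mergeList u {t}) = 0) :
    ∃ y, ((chainCx K (k + 2)).d (m + 2) (m + 1)).hom y = z := by
  have hr := bot_lt_top k
  -- Taking J = {t} makes the lower end ⊥, with k + 1 elements outside the block.
  obtain ⟨y, hy, hbd⟩ := exists_bd_eq (K := K) k (J := {t}) (Finset.singleton_nonempty t)
    (by rw [Finset.card_compl, Finset.card_singleton, Fintype.card_fin]; rfl) m
    (z := toLists K m z) (by rw [blockSetoid_singleton]; exact toLists_mem K m z)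
    (bd_toLists_eq_zero K hr hz)
    (fun hm u hu hmem => h hm u ⟨hu, fun a => (hmem a).trans (not_congr Finset.mem_singleton)⟩)
  rw [blockSetoid_singleton] at hy
  have h1 := d_ofLists hr hy
  rw [hbd] at h1
  have hdd : ∀ x : (chainCx K (k + 2)).X (m + 2), ((chainCx K (k + 2)).d (m + 1) m).hom
      (((chainCx K (k + 2)).d (m + 2) (m + 1)).hom x) = 0 := fun x =>
    LinearMap.congr_fun (congrArg ModuleCat.Hom.hom
      ((chainCx K (k + 2)).d_comp_d (m + 2) (m + 1) m)) x
  have h2 : ((chainCx K (k + 2)).d (m + 2) (m + 1)).hom ((-1 : K) ^ (m + 1) • ofLists K (m + 1) y) =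
      ofLists K m (toLists K m z) := by
    rw [map_smul]
    refine (congrArg _ h1).trans ?_
    rw [smul_smul, ← mul_pow, neg_mul_neg, one_mul, one_pow, one_smul]
  -- The list part of `z` has been bounded; the remainder is a cycle with zero normalization.
  obtain ⟨y', hy'⟩ := exists_d_eq_of_normalize_eq_zero K (X := partitionSSet (k + 2)) (n := m)
    (z := z - ofLists K m (toLists K m z))
    (by rw [map_sub, ← h2]; exact sub_eq_zero.mpr (hz.trans (hdd _).symm))
    (by rw [map_sub, normalize_ofLists_toLists, sub_self])
  refine ⟨y' + (-1 : K) ^ (m + 1) • ofLists K (m + 1) y, ?_⟩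
  rw [map_add, h2]
  refine (congrArg (· + _) hy').trans (sub_add_cancel _ _)

theorem homology_eq_zero {m : ℕ} (hm : m ≠ k)
    (c : ssetHomology K (partitionSSet (k + 2)) (m + 1)) : c = 0 := by
  obtain ⟨z, rfl⟩ := homologyClass_surjective _ _ c
  exact (homologyClass_eq_zero_iff _ _ z).mpr (exists_d_eq K 0 z.2 fun h => absurd h hm)

/-! ### The top homology -/

section Top

variable (K : Type) [CommRing K] {k : ℕ}

/-- The word of a permutation, as a word of singletons. -/
def permWord {r : ℕ} (w : Equiv.Perm (Fin r)) : List (List (Fin r)) :=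
  (List.ofFn w).map fun x => [x]

theorem isBlockWord_permWord {r : ℕ} (w : Equiv.Perm (Fin r)) : IsBlockWord (permWord w) := by
  constructor
  · rw [permWord, ← List.flatMap_def, List.flatMap_singleton']
    exact ofFn_perm_nodup w
  · intro B hB
    obtain ⟨x, -, rfl⟩ := List.mem_map.mp hB
    exact List.cons_ne_nil _ _

theorem length_permWord {r : ℕ} (w : Equiv.Perm (Fin r)) : (permWord w).length = r := by
  simp [permWord]

theorem permWord_eq_zipWord {r : ℕ} (t : Fin r) (w : Equiv.Perm (Fin r)) :
    permWord w = zipWord (leftPart t w) [t] (rightPart t w) := by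
  rw [permWord, ofFn_perm_eq t w, zipWord, List.map_append, List.map_cons]

theorem fund_permWord_mem (w : Equiv.Perm (Fin (k + 2))) :
    fund K k (permWord w) ∈ chains K (⊥ : Setoid (Fin (k + 2))) k := by
  have h := fund_mem_chains (K := K) k (isBlockWord_permWord w) (length_permWord w)
  rwa [permWord_eq_zipWord 0 w, wordPartition_zipWord, ← permWord_eq_zipWord,
    List.toFinset_cons, List.toFinset_nil, insert_empty_eq, blockSetoid_singleton] at h

theorem d_ofLists_fund (w : Equiv.Perm (Fin (k + 2))) :
    ((chainCx K (k + 2)).d (k + 1) (k + 1 - 1)).hom (ofLists K k (fund K k (permWord w))) = 0 := by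
  cases k with
  | zero => exact LinearMap.congr_fun (d_one_eq_zero K (bot_lt_top 0)) _
  | succ k =>
    refine (d_ofLists (bot_lt_top (k + 1)) (fund_permWord_mem K w)).trans ?_
    rw [bd_fund (k + 1) (length_permWord w), map_zero, smul_zero]

/-- The cycles attached to the permutations. -/
noncomputable def permCycle (k : ℕ) : (Equiv.Perm (Fin (k + 2)) →₀ K) →ₗ[K]
    LinearMap.ker ((chainCx K (k + 2)).d (k + 1) (k + 1 - 1)).hom :=
  Finsupp.linearCombination K fun w => ⟨_, d_ofLists_fund K w⟩

theorem permCycle_single (w : Equiv.Perm (Fin (k + 2))) :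
    permCycle K k (Finsupp.single w 1) = ⟨_, d_ofLists_fund K w⟩ := by
  simp [permCycle]

/-- Reading the word of w around t turns it into a `zipWord` with middle block [t], so the
coefficients are those computed by `fund_zipWord_mergeList`. The coordinates of the cycles are thus
exactly the matrix of `zipMap`. -/
theorem toLists_permCycle {t : Fin (k + 2)} (a : Equiv.Perm (Fin (k + 2)) →₀ K)
    (u : Arrangement t) :
    toLists K k (permCycle K k a) (mergeList u {t}) = zipMap K t a u := by
  induction a using Finsupp.induction_linear with
  | zero => simp
  | add a b ha hb =>
    rw [map_add, map_add, Submodule.coe_add, map_add, Finsupp.add_apply, ha, hb, Pi.add_apply]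
  | single w c =>
    have hc : (Finsupp.single w c : Equiv.Perm (Fin (k + 2)) →₀ K) = c • Finsupp.single w 1 := by
      simp
    rw [hc, map_smul, map_smul, Submodule.coe_smul, map_smul, Finsupp.smul_apply, Pi.smul_apply,
      permCycle_single, zipMap_single, toLists_ofLists (bot_lt_top k) (fund_permWord_mem K w),
      permWord_eq_zipWord t]
    congr 1
    have hp := perm_ofFn u.2 w
    have hn := ofFn_perm_nodup w
    have hl : (List.ofFn w).length = k + 2 := List.length_ofFn
    have hl2 := hp.length_eq
    rw [ofFn_perm_eq t w] at hn hl hp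
    simp only [List.length_append, List.length_reverse, List.length_cons, List.length_ofFn]
      at hl hl2
    refine fund_zipWord_mergeList k (I := [t]) (List.cons_ne_nil _ _) (by simpa using hn) u.2.1
      (fun a ha h => (u.2.2 a).mp ha (List.mem_singleton.mp h)) (by omega) (by omega) ?_
    intro a ha
    refine (u.2.2 a).mpr ?_
    rintro rfl
    rw [List.nodup_middle, List.nodup_cons] at hn
    simp only [List.mem_append, List.mem_reverse] at hn ha
    exact hn.1 ha

/-- The homology classes attached to the permutations. -/
noncomputable def permClass (k : ℕ) : (Equiv.Perm (Fin (k + 2)) →₀ K) →ₗ[K]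
    ssetHomology K (partitionSSet (k + 2)) (k + 1) :=
  homologyClass (chainCx K (k + 2)) (k + 1) ∘ₗ permCycle K k

/-- A boundary in this degree has zero list part, as there are no longer lists, so its coordinates
vanish. Conversely, a cycle with vanishing coordinates bounds by `exists_d_eq`. -/
theorem permClass_eq_zero_iff (t : Fin (k + 2)) (a : Equiv.Perm (Fin (k + 2)) →₀ K) :
    permClass K k a = 0 ↔ zipMap K t a = 0 := by
  rw [permClass, LinearMap.comp_apply, homologyClass_eq_zero_iff]
  constructor
  · rintro ⟨y, hy⟩
    funext u
    have h0 : toLists K (k + 1) y = 0 :=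
      chains_bot_eq_zero (bot_lt_top k) le_rfl (toLists_mem K (k + 1) y)
    have h1 := toLists_d (bot_lt_top k) y
    rw [h0, map_zero, smul_zero] at h1
    rw [← toLists_permCycle, ← hy]
    exact DFunLike.congr_fun h1 _
  · intro h
    refine exists_d_eq K t (permCycle K k a).2 fun _ u hu => ?_
    rw [toLists_permCycle K a ⟨u, hu⟩, h]
    rfl

/-- Surjectivity of `zipMap` matches the coordinates of any cycle by a combination of permutation
cycles; the difference then bounds. -/
theorem permClass_surjective (k : ℕ) : Function.Surjective (permClass K k) := by
  intro c
  obtain ⟨z, rfl⟩ := homologyClass_surjective _ _ c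
  obtain ⟨a, ha⟩ := zipMap_surjective K (0 : Fin (k + 2)) fun u : Arrangement (0 : Fin (k + 2)) =>
    toLists K k z (mergeList (u : List (Fin (k + 2))) {0})
  refine ⟨a, ?_⟩
  rw [permClass, LinearMap.comp_apply, ← sub_eq_zero, ← map_sub, homologyClass_eq_zero_iff]
  refine exists_d_eq K 0 (permCycle K k a - z).2 fun _ u hu => ?_
  rw [Submodule.coe_sub, map_sub, Finsupp.sub_apply, toLists_permCycle K a ⟨u, hu⟩, ha, sub_self]

theorem map_elt {r n : ℕ} (w : Equiv.Perm (Fin r)) (x : Option (PartitionChain r n)) :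
    ((SSet.chainComplexMap (partitionSSetPerm w) (ModuleCat.of K K)).f n).hom (elt K x) =
      elt K (Option.map (PartitionChain.perm w) x) :=
  map_ofSimplex K (X := partitionSSet r) (Y := partitionSSet r) (partitionSSetPerm w) (n := n) x

theorem map_ofLists {r m : ℕ} (hr : (⊥ : Setoid (Fin r)) < ⊤) (w : Equiv.Perm (Fin r))
    {z : List (Setoid (Fin r)) →₀ K} (hz : z ∈ chains K ⊥ m) :
    ((SSet.chainComplexMap (partitionSSetPerm w) (ModuleCat.of K K)).f (m + 1)).hom
      (ofLists K m z) = ofLists K m (Finsupp.lmapDomain K K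
        (List.map (Setoid.comap (w⁻¹ : Equiv.Perm (Fin r)))) z) := by
  refine Finsupp.map_eq_of_mem_supported
    (((SSet.chainComplexMap (partitionSSetPerm w) (ModuleCat.of K K)).f (m + 1)).hom ∘ₗ ofLists K m)
    (ofLists K m ∘ₗ Finsupp.lmapDomain K K
      (List.map (Setoid.comap (w⁻¹ : Equiv.Perm (Fin r))))) ?_ hz
  rintro l ⟨hl, hm⟩
  obtain ⟨c, hc, rfl⟩ := exists_interiorList_eq hr hl hm
  have hc' : Function.Injective (PartitionChain.perm w c).seq := by
    intro i j hij
    refine hc (Setoid.ext fun a b => ?_)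
    have h := congrArg (fun s : PartitionPoset r => (OrderDual.ofDual s) (w a) (w b)) hij
    change (OrderDual.ofDual (c.seq i)) (w.symm (w a)) (w.symm (w b)) =
      (OrderDual.ofDual (c.seq j)) (w.symm (w a)) (w.symm (w b)) at h
    rw [Equiv.symm_apply_apply, Equiv.symm_apply_apply] at h
    exact Iff.of_eq h
  have hl' : (interiorList c).map (Setoid.comap (w⁻¹ : Equiv.Perm (Fin r))) =
      interiorList (PartitionChain.perm w c) := List.map_ofFn ..
  rw [LinearMap.comp_apply, LinearMap.comp_apply, Finsupp.lmapDomain_apply,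
    Finsupp.mapDomain_single, ofLists_single, ofLists_single, hl', ofList_interiorList K hc,
    ofList_interiorList K hc', map_sub, map_elt, map_elt]
  rfl

theorem partitionHomologyRep_permClass (v w : Equiv.Perm (Fin (k + 2))) :
    partitionHomologyRep K (k + 2) (k + 1) v (permClass K k (Finsupp.single w 1)) =
      permClass K k (Finsupp.single (v * w) 1) := by
  rw [permClass, LinearMap.comp_apply, LinearMap.comp_apply]
  refine homologyMap_homologyClass
    (SSet.chainComplexMap (partitionSSetPerm v) (ModuleCat.of K K)) (k + 1) _ _ ?_
  rw [permCycle_single, permCycle_single]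
  refine (map_ofLists K (bot_lt_top k) v (fund_permWord_mem K w)).trans ?_
  rw [← fund_map]
  change _ = ofLists K k (fund K k (permWord (v * w)))
  rw [permWord, permWord, List.map_map, List.map_ofFn, List.map_ofFn]
  rfl

theorem nonempty_equiv_top (k : ℕ) :
    Nonempty ((partitionReducedHomologyRep K (k + 2) (k + 1)).Equiv
      ((lieRep K (k + 2)).dual.tprod (sgnRep K (k + 2)))) := by
  have hmem : ∀ a, permClass K k a ∈ reducedHomology K (partitionSSet (k + 2)) (k + 1) := by
    intro a
    rw [reducedHomology_succ]
    trivial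
  refine Representation.nonempty_equiv_of_surjective
    (W := TensorProduct K (Module.Dual K (lieComponent K (k + 2))) K)
    (f := (permClass K k).codRestrict _ hmem) (g := lieForm K (k + 2)) ?_
    (lieForm_surjective K 0) ?_ ?_ (tprod_lieForm K)
  · rintro ⟨c, hc⟩
    obtain ⟨a, rfl⟩ := permClass_surjective K k c
    exact ⟨a, rfl⟩
  · intro a
    rw [lieForm_eq_zero_iff K 0, ← permClass_eq_zero_iff K 0, ← Subtype.coe_inj]
    rfl
  · intro v w
    exact Subtype.ext (partitionHomologyRep_permClass K v w)

end Top

/-! ### Partitions of a set with one element -/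

section One

variable (K : Type) [CommRing K]

theorem partitionPoset_one_eq (a b : PartitionPoset 1) : a = b := by
  refine Setoid.ext fun i j => ?_
  rw [Subsingleton.elim i j]
  exact iff_of_true (Setoid.refl' _ _) (Setoid.refl' _ _)

theorem homology_one_eq_zero {n : ℕ} (c : ssetHomology K (partitionSSet 1) (n + 1)) : c = 0 := by
  refine homology_eq_zero_of_degenerate K _ (fun x : Option (PartitionChain 1 (n + 1)) => ?_) c
  cases x with
  | none => exact ⟨0, (none : Option (PartitionChain 1 n)), rfl⟩
  | some c =>
    obtain ⟨c', hc'⟩ := exists_degeneracy_eq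
      (partitionPoset_one_eq (c.seq (0 : Fin (n + 1)).castSucc) (c.seq (0 : Fin (n + 1)).succ))
    exact ⟨0, (some c' : Option (PartitionChain 1 n)), hc'⟩

/-- The sequence consisting of the unique partition. -/
def oneChain : PartitionChain 1 0 :=
  ⟨⟨fun _ => ⊥, fun _ _ _ => le_rfl⟩, rfl, partitionPoset_one_eq _ _⟩

theorem eq_oneChain (c : PartitionChain 1 0) : c = oneChain :=
  ext_seq (OrderHom.ext _ _ (funext fun _ => partitionPoset_one_eq _ _))

/-- The coefficient of the nondegenerate simplex which is not the base point. -/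
noncomputable def oneCoeff : (chainCx K 1).X 0 →ₗ[K] K :=
  lift K (X := partitionSSet 1) (n := 0) fun x : Option (PartitionChain 1 0) =>
    x.elim 0 fun _ => 1

theorem oneCoeff_none : oneCoeff K (elt K none) = 0 := lift_ofSimplex K _ _

theorem oneCoeff_some (c : PartitionChain 1 0) : oneCoeff K (elt K (some c)) = 1 :=
  lift_ofSimplex K _ _

theorem oneCoeff_d (y : (chainCx K 1).X 1) : oneCoeff K (((chainCx K 1).d 1 0).hom y) = 0 := by
  have h : oneCoeff K ∘ₗ ((chainCx K 1).d (0 + 1) 0).hom = 0 := by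
    refine chain_hom_ext fun x => ?_
    rw [LinearMap.comp_apply, LinearMap.zero_apply]
    cases x with
    | none =>
      rw [d_elt_none, map_sum]
      simp [oneCoeff_none]
    | some c =>
      rw [d_elt_some, map_sum]
      simp only [pull_pos _ c ⟨partitionPoset_one_eq _ _, partitionPoset_one_eq _ _⟩, map_smul,
        oneCoeff_some]
      simp
  exact LinearMap.congr_fun h y

theorem eq_oneCoeff_smul {z : (chainCx K 1).X 0} (hz : augmentation K (partitionSSet 1) z = 0) :
    z = oneCoeff K z • (elt K (some oneChain) - elt K none) := by
  have h : (LinearMap.id : (chainCx K 1).X 0 →ₗ[K] _) =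
      (oneCoeff K).smulRight (elt K (some oneChain) - elt K none) +
        (augmentation K (partitionSSet 1)).smulRight (elt K none) := by
    refine chain_hom_ext fun x => ?_
    have hx : augmentation K (partitionSSet 1) (elt K x) = 1 := lift_ofSimplex K _ _
    rw [LinearMap.add_apply, LinearMap.smulRight_apply, LinearMap.smulRight_apply, hx, one_smul]
    cases x with
    | none => rw [oneCoeff_none, zero_smul, zero_add]; rfl
    | some c => rw [oneCoeff_some, one_smul, sub_add_cancel, ← eq_oneChain c]; rfl
  have h1 := LinearMap.congr_fun h z
  rw [LinearMap.add_apply, LinearMap.smulRight_apply, LinearMap.smulRight_apply] at h1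
  rw [hz, zero_smul, add_zero] at h1
  exact h1

/-- The generator of the reduced chains in degree zero. -/
noncomputable def oneCycle : LinearMap.ker ((chainCx K 1).d 0 (0 - 1)).hom :=
  ⟨elt K (some oneChain) - elt K none, by
    rw [HomologicalComplex.shape _ _ _ (by simp)]
    rfl⟩

theorem oneClass_mem :
    homologyClass (chainCx K 1) 0 (oneCycle K) ∈ reducedHomology K (partitionSSet 1) 0 := by
  refine (homologyClass_mem_reducedHomology_iff K _ _).mpr ?_
  have hx : ∀ x, augmentation K (partitionSSet 1) (elt K x) = 1 := fun x => lift_ofSimplex K _ _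
  change augmentation K (partitionSSet 1) (elt K (some oneChain) - elt K none) = 0
  rw [map_sub, hx, hx, sub_self]

/-- For r = 1 there are two vertices, and all simplices of positive degree are degenerate. The
reduced homology in degree 0 is free on the difference of the vertices, and `zipMap` has the single
entry 1. -/
theorem nonempty_equiv_one :
    Nonempty ((partitionReducedHomologyRep K 1 0).Equiv
      ((lieRep K 1).dual.tprod (sgnRep K 1))) := by
  let b : reducedHomology K (partitionSSet 1) 0 := ⟨_, oneClass_mem K⟩
  have hb : ∀ a : K, a • b = 0 ↔ a = 0 := by
    intro a
    constructor
    · intro h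
      have h1 : homologyClass (chainCx K 1) 0 (a • oneCycle K) = 0 := by
        rw [map_smul]
        exact congrArg Subtype.val h
      obtain ⟨y, hy⟩ := (homologyClass_eq_zero_iff _ _ _).mp h1
      have h2 := oneCoeff_d K y
      have h3 : ((chainCx K 1).d 1 0).hom y = a • (elt K (some oneChain) - elt K none) := hy
      rw [h3, map_smul, map_sub, oneCoeff_some, oneCoeff_none, sub_zero, smul_eq_mul,
        mul_one] at h2
      exact h2
    · rintro rfl
      exact zero_smul K b
  have hsurj : ∀ c, ∃ a : K, a • b = c := by
    rintro ⟨c, hc⟩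
    obtain ⟨z, rfl⟩ := homologyClass_surjective _ _ c
    refine ⟨oneCoeff K z, Subtype.ext ?_⟩
    have h := eq_oneCoeff_smul K ((homologyClass_mem_reducedHomology_iff K _ _).mp hc)
    change oneCoeff K z • homologyClass (chainCx K 1) 0 (oneCycle K) = _
    rw [← map_smul]
    exact congrArg _ (Subtype.ext h.symm)
  let f : (Equiv.Perm (Fin 1) →₀ K) →ₗ[K] reducedHomology K (partitionSSet 1) 0 :=
    Finsupp.linearCombination K fun _ => b
  have hf : ∀ w a, f (Finsupp.single w a) = a • b := fun w a => by simp [f]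
  have hsingle : ∀ a : Equiv.Perm (Fin 1) →₀ K, a = Finsupp.single 1 (a 1) := fun a =>
    Finsupp.unique_single a
  have hnil : ([] : List (Fin 1)) ∈ Arrangement (0 : Fin 1) :=
    ⟨List.nodup_nil, fun a => by simp [Subsingleton.elim a 0]⟩
  have hzip : ∀ a : K, zipMap K (0 : Fin 1) (Finsupp.single 1 a) = 0 ↔ a = 0 := by
    intro a
    constructor
    · intro h
      have h1 := congrFun h ⟨[], hnil⟩
      have h2 := parts_eq (t := (0 : Fin 1)) (w := 1) (v := []) rfl
      have h3 : (Finsupp.single 1 a : Equiv.Perm (Fin 1) →₀ K) = a • Finsupp.single 1 1 := by simp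
      rw [h3, map_smul, Pi.smul_apply, zipMap_single, h2.1, h2.2,
        zipCoeff_nil_left (pow_zero _)] at h1
      simpa using h1
    · rintro rfl
      rw [Finsupp.single_zero, map_zero]
  refine Representation.nonempty_equiv_of_surjective
    (W := TensorProduct K (Module.Dual K (lieComponent K 1)) K) (f := f) (g := lieForm K 1) ?_
    (lieForm_surjective K 0) ?_ ?_ (tprod_lieForm K)
  · intro c
    obtain ⟨a, ha⟩ := hsurj c
    exact ⟨Finsupp.single 1 a, (hf 1 a).trans ha⟩
  · intro a
    rw [lieForm_eq_zero_iff K 0, hsingle a, hf, hb, hzip]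
  · intro v w
    rw [hf, hf, Subsingleton.elim v 1, map_one]
    rfl

end One

end PartitionHomology

/-! ### The theorem -/

theorem mainTheorem1 (K : Type) [CommRing K]
    (hK : Nonempty (K ≃+* ℤ) ∨ Nonempty (K ≃+* ℚ) ∨
      ∃ p : ℕ, p.Prime ∧ Nonempty (K ≃+* ZMod p))
    (r : ℕ) (hr : 1 ≤ r) :
    (∀ n : ℕ, n ≠ r - 1 → reducedHomology K (partitionSSet r) n = ⊥) ∧
    Nonempty ((partitionReducedHomologyRep K r (r - 1)).Equiv
      ((lieRep K r).dual.tprod (sgnRep K r))) := by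
  obtain ⟨r, rfl⟩ := Nat.exists_eq_add_of_le' hr
  -- One letter is set apart because ⊥ = ⊤ there; from two letters on, ⊥ < ⊤ and the list model
  -- applies.
  cases r with
  | zero =>
    refine ⟨fun n hn => ?_, PartitionHomology.nonempty_equiv_one K⟩
    obtain ⟨n, rfl⟩ := Nat.exists_eq_succ_of_ne_zero hn
    exact eq_bot_iff.mpr fun c _ => PartitionHomology.homology_one_eq_zero K c
  | succ k =>
    refine ⟨fun n hn => ?_, PartitionHomology.nonempty_equiv_top K k⟩
    cases n with
    | zero => exact PartitionHomology.reducedHomology_zero_eq_bot K (PartitionHomology.bot_lt_top k)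
    | succ m =>
      exact eq_bot_iff.mpr fun c _ => PartitionHomology.homology_eq_zero K
        (fun h => hn (congrArg (· + 1) h)) c
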